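/- Let $\mathbf D$ be a triangulated category whose Grothendieck group $K_0(\mathbf D)$ is finitely generated up to torsion (i.e. $K_0(\mathbf D)/\mathrm{tors}$ is finitely generated). Let $\mathbf D=\langle\mathbf D_1,\mathbf D_2\rangle$ be a semiorthogonal decomposition: exact fully faithful functors $i_k\colon\mathbf D_k\to\mathbf D$, a left adjoint $\tau_1^L$ of $i_1$ and a right adjoint $\tau_2^R$ of $i_2$ with $\tau_1^L i_2=0=\tau_2^R i_1$, such that every $E\in\mathbf D$ lies in a distinguished triangle $i_2E_2\to E\to i_1E_1\to i_2E_2[1]$. Assume (2) $i_1$ has a right adjoint $\tau_1^R$, and there are a triangulated category $\mathbf C$ and exact equivalences $\mathbf D_1\simeq\mathbf C\simeq\mathbf D_2$ under which $\tau_1^R$ becomes a left adjoint of $i_2$. Put $\Phi=\tau_1^R\circ i_2[1]\colon\mathbf D_2\to\mathbf D_1$. Let $\sigma_k=(Z_k,\mathcal P_k)$ $(k=1,2)$ be locally finite stability conditions on $\mathbf D_k$ which are rational ($Z_k$ takes values in $\mathbb Q+\mathbb Q\sqrt{-1}$), with hearts $\mathcal A_k=\mathcal P_k(0,1]$, and assume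 (5) $\Phi$ is t-exact for the t-structures of $\sigma_2$ and $\sigma_1$, $\Phi(\mathcal P_2(0,1))\subset\mathcal P_1(0,1)$, and $Z_2(E_2)=Z_1(\Phi E_2)$ for all $E_2\in\mathcal A_2$. Let $\mathcal A=\{E\in\mathbf D\mid \tau_1^LE\in\mathcal A_1,\ \tau_2^RE\in\mathcal A_2\}$ be the glued heart. Call $E\in\mathcal A$ torsion if $\operatorname{Im}Z_1(\tau_1^LE)=\operatorname{Im}Z_2(\tau_2^RE)=0$, and free if $\tau_1^LE\in\mathcal P_1(0,1)$ and $\tau_2^RE\in\mathcal P_2(0,1)$. For $\beta\in\mathbb R$, $\omega>0$ and nonzero free $E$ put $$\mu_{\beta,\omega}(E)=\frac{\operatorname{Im}Z_1(\tau_1^LE)-\omega\operatorname{Re}Z_2(\tau_2^RE)+\beta\operatorname{Im}Z_2(\tau_2^RE)}{\operatorname{Im}Z_1(\tau_1^LE)+\operatorname{Im}Z_2(\tau_2^RE)}.$$ A nonzero free $E$ is semistable if $\mu_{\beta,\omega}(F)\le\mu_{\beta,\omega}(E)$ for all nonzero subobjects $F\subset E$ in $\mathcal A$; write $\mu^{+}_{\beta,\omega}(E)$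 and $\mu^{-}_{\beta,\omega}(E)$ for the largest and the smallest slope of the (free, semistable) factors of the Harder–Narasimhan filtration of a nonzero free $E$ in $\mathcal A$. Let $\mathcal F_{\beta,\omega}$ consist of the free $E$ with $E=0$ or $\mu^+_{\beta,\omega}(E)\le0$, let $\mathcal T_{\beta,\omega}$ consist of the $E\in\mathcal A$ whose free part $E_{\mathrm{fr}}$ (the quotient of $E$ by its maximal torsion subobject) is zero or has $\mu^-_{\beta,\omega}(E_{\mathrm{fr}})>0$, and let $\mathcal A_{\beta,\omega}$ be the tilted heart, i.e. the category of all $E\in\mathbf D$ that lie in a distinguished triangle $F[1]\to E\to T\to F[2]$ with $F\in\mathcal F_{\beta,\omega}$ and $T\in\mathcal T_{\beta,\omega}$. Define $Z_{\beta,\omega}\colon K_0(\mathbf D)\to\mathbb C$ by $$Z_{\beta,\omega}(E)=Z_1(\tau_1^LE)+(\beta-\sqrt{-1}\,\omega)\,Z_2(\tau_2^RE).$$ Then: 1. For every $\beta\in\mathbb R$ and $\omega\in\mathbb R_{>0}$, $\mathcal A_{\beta,\omega}$ is the heart of a bounded t-structure on $\mathbf D$, and $Z_{\beta,\omega}$ is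 a central charge on it: $0<\arg Z_{\beta,\omega}(E)\le\pi$ (in particular $Z_{\beta,\omega}(E)\neq0$) for every nonzero $E\in\mathcal A_{\beta,\omega}$. 2. If $\beta\in\mathbb Q$ and $\omega\in\mathbb Q_{>0}$, then $(\mathcal A_{\beta,\omega},Z_{\beta,\omega})$ is a locally finite and rational stability condition on $\mathbf D$: there is a stability condition with heart $\mathcal A_{\beta,\omega}$ and central charge $Z_{\beta,\omega}$, it is locally finite, and its central charge takes values in $\mathbb Q+\mathbb Q\sqrt{-1}$. -/

import Mathlib

open CategoryTheory CategoryTheory.Limits CategoryTheory.Pretriangulated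

universe v u v₁ u₁ v₂ u₂ v₃ u₃

noncomputable section

namespace TriStab

section General

variable (D : Type u) [Category.{v} D] [Preadditive D] [HasZeroObject D] [HasShift D ℤ]
  [∀ n : ℤ, (shiftFunctor D n).Additive] [Pretriangulated D]

/-! ### The Grothendieck group -/

/-- The subgroup of relations `[Y] - [X] - [W]` for distinguished triangles `X ⟶ Y ⟶ W ⟶ X⟦1⟧`. -/
def K0Relations : AddSubgroup (FreeAbelianGroup D) :=
  AddSubgroup.closure {x | ∃ T ∈ distTriang D, x = FreeAbelianGroup.of T.obj₂ -
    FreeAbelianGroup.of T.obj₁ - FreeAbelianGroup.of T.obj₃}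

/-- The Grothendieck group of a triangulated category. -/
def K0 : Type u := FreeAbelianGroup D ⧸ K0Relations D

instance : AddCommGroup (K0 D) :=
  inferInstanceAs (AddCommGroup (FreeAbelianGroup D ⧸ K0Relations D))

variable {D}

/-- The class of an object in the Grothendieck group. -/
def K0.of (X : D) : K0 D :=
  QuotientAddGroup.mk' (K0Relations D) (FreeAbelianGroup.of X)

theorem K0.of_triangle (T : Triangle D) (hT : T ∈ distTriang D) :
    (K0.of T.obj₂ : K0 D) - K0.of T.obj₁ - K0.of T.obj₃ = 0 := by
  have h : FreeAbelianGroup.of T.obj₂ - FreeAbelianGroup.of T.obj₁ - FreeAbelianGroup.of T.obj₃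
      ∈ K0Relations D := AddSubgroup.subset_closure ⟨T, hT, rfl⟩
  have h' := (QuotientAddGroup.eq_zero_iff
    (N := K0Relations D) (FreeAbelianGroup.of T.obj₂ - FreeAbelianGroup.of T.obj₁ -
      FreeAbelianGroup.of T.obj₃)).2 h
  exact h'

/-- The homomorphism of Grothendieck groups induced by an exact functor. -/
def K0.map {D' : Type u₁} [Category.{v₁} D'] [Preadditive D'] [HasZeroObject D'] [HasShift D' ℤ]
    [∀ n : ℤ, (shiftFunctor D' n).Additive] [Pretriangulated D']
    (F : D ⥤ D') [F.CommShift ℤ] [F.IsTriangulated] : K0 D →+ K0 D' :=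
  QuotientAddGroup.lift (K0Relations D)
    (FreeAbelianGroup.lift fun X : D => (K0.of (F.obj X) : K0 D')) (by
      rw [K0Relations, AddSubgroup.closure_le]
      rintro x ⟨T, hT, rfl⟩
      have h := K0.of_triangle _ (F.map_distinguished T hT)
      simpa using h)

@[simp]
theorem K0.map_of {D' : Type u₁} [Category.{v₁} D'] [Preadditive D'] [HasZeroObject D']
    [HasShift D' ℤ] [∀ n : ℤ, (shiftFunctor D' n).Additive] [Pretriangulated D']
    (F : D ⥤ D') [F.CommShift ℤ] [F.IsTriangulated] (X : D) :
    K0.map F (K0.of X) = K0.of (F.obj X) := by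
  change QuotientAddGroup.lift _ _ _ (QuotientAddGroup.mk' _ _) = _
  simp

/-! ### Filtrations, extensions, strict subobjects, finite length -/

/-- A finite sequence of distinguished triangles `F i ⟶ F (i+1) ⟶ A i ⟶ (F i)⟦1⟧` which starts
with a zero object and ends with `E`; the objects `A i` are its factors. -/
def IsFiltration (n : ℕ) (F : Fin (n + 1) → D) (A : Fin n → D) (E : D) : Prop :=
  IsZero (F 0) ∧ Nonempty (F (Fin.last n) ≅ E) ∧
    ∀ i : Fin n, ∃ (f : F i.castSucc ⟶ F i.succ) (g : F i.succ ⟶ A i) (h : A i ⟶ (F i.castSucc)⟦(1 : ℤ)⟧),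
      Triangle.mk f g h ∈ distTriang D

/-- The extension closure of a class of objects: the smallest class containing it and the zero
objects which is closed under extensions. -/
inductive ExtensionClosure (P : ObjectProperty D) : ObjectProperty D
  | zero (X : D) : IsZero X → ExtensionClosure P X
  | of (X : D) : P X → ExtensionClosure P X
  | ext {X Y W : D} (f : X ⟶ Y) (g : Y ⟶ W) (h : W ⟶ X⟦(1 : ℤ)⟧) :
      Triangle.mk f g h ∈ distTriang D → ExtensionClosure P X → ExtensionClosure P W →
      ExtensionClosure P Y

/-- `f : X ⟶ Y` is the first morphism of a short exact sequence in the full subcategory `Q`, i.e.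
of a distinguished triangle with all three vertices in `Q`. If `Q` is the heart of a t-structure
these are the monomorphisms of the abelian category `Q`; if `Q` is the quasi-abelian category of an
interval of length `< 1` of a slicing these are the strict monomorphisms of `Q`. -/
def IsStrictMono (Q : ObjectProperty D) {X Y : D} (f : X ⟶ Y) : Prop :=
  Q X ∧ Q Y ∧ ∃ (W : D) (g : Y ⟶ W) (h : W ⟶ X⟦(1 : ℤ)⟧), Q W ∧ Triangle.mk f g h ∈ distTriang D

/-- Finite length: ascending and descending chains of strict subobjects of any object become
stationary. -/
def IsFiniteLength (Q : ObjectProperty D) : Prop :=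
  ∀ (E : D) (X : ℕ → D) (ι : ∀ n, X n ⟶ E), (∀ n, IsStrictMono Q (ι n)) →
    (∀ f : ∀ n, X n ⟶ X (n + 1), (∀ n, f n ≫ ι (n + 1) = ι n) → ∃ N, ∀ n ≥ N, IsIso (f n)) ∧
    (∀ f : ∀ n, X (n + 1) ⟶ X n, (∀ n, f n ≫ ι n = ι (n + 1)) → ∃ N, ∀ n ≥ N, IsIso (f n))

variable (D)

/-! ### Stability conditions -/

/-- A stability condition `(Z, P)` on a triangulated category: a central charge and a slicing. -/
structure StabilityCondition where
  /-- the central charge -/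
  Z : K0 D →+ ℂ
  /-- the full subcategory of semistable objects of phase `φ` (together with zero) -/
  P : ℝ → ObjectProperty D
  isClosedUnderIso : ∀ φ, (P φ).IsClosedUnderIsomorphisms
  zero_mem : ∀ (φ : ℝ) (E : D), IsZero E → P φ E
  charge_mem : ∀ (φ : ℝ) (E : D), P φ E → ¬ IsZero E →
    ∃ m : ℝ, 0 < m ∧ Z (K0.of E) = m * Complex.exp (Real.pi * φ * Complex.I)
  shift_iff : ∀ (φ : ℝ) (E : D), P φ E ↔ P (φ + 1) (E⟦(1 : ℤ)⟧)
  hom_eq_zero : ∀ (φ ψ : ℝ), ψ < φ → ∀ (E F : D), P φ E → P ψ F → ∀ f : E ⟶ F, f = 0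
  exists_hn : ∀ E : D, ∃ (n : ℕ) (F : Fin (n + 1) → D) (A : Fin n → D) (φ : Fin n → ℝ),
    IsFiltration n F A E ∧ StrictAnti φ ∧ ∀ i, P (φ i) (A i) ∧ ¬ IsZero (A i)

namespace StabilityCondition

variable {D} (σ : StabilityCondition D)

/-- The central charge of an object. -/
def charge (E : D) : ℂ := σ.Z (K0.of E)

/-- The category `P(I)`: the extension closure of the `P(φ)` with `φ ∈ I`. -/
def interval (I : Set ℝ) : ObjectProperty D :=
  ExtensionClosure fun E => ∃ φ ∈ I, σ.P φ E

/-- The aisle `D^{≤ 0} = P(0, ∞)` of the t-structure of `σ`. -/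
def le0 : ObjectProperty D := σ.interval (Set.Ioi 0)

/-- The coaisle `D^{≥ 0} = P(-∞, 1]` of the t-structure of `σ`. -/
def ge0 : ObjectProperty D := σ.interval (Set.Iic 1)

/-- The heart `P(0, 1]`. -/
def heart : ObjectProperty D := σ.interval (Set.Ioc 0 1)

/-- The `σ`-torsion objects of the heart. -/
def torsion : ObjectProperty D := fun E => σ.heart E ∧ (σ.charge E).im = 0

/-- The `σ`-free objects of the heart. -/
def free : ObjectProperty D := σ.interval (Set.Ioo 0 1)

/-- Local finiteness. -/
def IsLocallyFinite : Prop :=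
  ∀ φ : ℝ, ∃ ε : ℝ, 0 < ε ∧ ε < 1 / 2 ∧ IsFiniteLength (σ.interval (Set.Ioo (φ - ε) (φ + ε)))

/-- The central charge takes values in `ℚ + ℚ i`. -/
def IsRational : Prop :=
  ∀ x : K0 D, ∃ a b : ℚ, σ.Z x = (a : ℂ) + (b : ℂ) * Complex.I

end StabilityCondition

variable {D}

/-- `A` is the heart of a bounded t-structure. -/
def IsBoundedHeart (A : ObjectProperty D) : Prop :=
  ∃ t : Triangulated.TStructure D, (∀ E : D, t.bounded E) ∧ t.heart = A

/-- `0 < arg Z(E) ≤ π` for each nonzero object `E` of `A`. As `Complex.arg 0 = 0`, this includes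
`Z(E) ≠ 0`. -/
def IsCentralCharge (A : ObjectProperty D) (Z : K0 D →+ ℂ) : Prop :=
  ∀ E : D, A E → ¬ IsZero E → 0 < (Z (K0.of E)).arg ∧ (Z (K0.of E)).arg ≤ Real.pi

end General

/-! ### Semiorthogonal decompositions -/

section SOD

variable (D : Type u) [Category.{v} D] [Preadditive D] [HasZeroObject D] [HasShift D ℤ]
  [∀ n : ℤ, (shiftFunctor D n).Additive] [Pretriangulated D]
  (D₁ : Type u₁) [Category.{v₁} D₁] [Preadditive D₁] [HasZeroObject D₁] [HasShift D₁ ℤ]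
  [∀ n : ℤ, (shiftFunctor D₁ n).Additive] [Pretriangulated D₁]
  (D₂ : Type u₂) [Category.{v₂} D₂] [Preadditive D₂] [HasZeroObject D₂] [HasShift D₂ ℤ]
  [∀ n : ℤ, (shiftFunctor D₂ n).Additive] [Pretriangulated D₂]

/-- A semiorthogonal decomposition `D = ⟨D₁, D₂⟩`: exact fully faithful functors `i₁`, `i₂`, a left
adjoint `τ₁L` of `i₁` and a right adjoint `τ₂R` of `i₂` with `τ₁L ∘ i₂ = 0 = τ₂R ∘ i₁`, such that
each object `E` is an extension `i₂ E₂ ⟶ E ⟶ i₁ E₁ ⟶ (i₂ E₂)⟦1⟧`. -/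
structure SemiorthogonalDecomposition where
  i₁ : D₁ ⥤ D
  i₂ : D₂ ⥤ D
  τ₁L : D ⥤ D₁
  τ₂R : D ⥤ D₂
  commShift₁ : i₁.CommShift ℤ
  commShift₂ : i₂.CommShift ℤ
  isTriangulated₁ : i₁.IsTriangulated
  isTriangulated₂ : i₂.IsTriangulated
  full₁ : i₁.Full
  faithful₁ : i₁.Faithful
  full₂ : i₂.Full
  faithful₂ : i₂.Faithful
  adj₁ : τ₁L ⊣ i₁
  adj₂ : i₂ ⊣ τ₂R
  isZero₁₂ : ∀ X : D₂, IsZero (τ₁L.obj (i₂.obj X))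
  isZero₂₁ : ∀ X : D₁, IsZero (τ₂R.obj (i₁.obj X))
  exists_triangle : ∀ E : D, ∃ (E₂ : D₂) (E₁ : D₁) (f : i₂.obj E₂ ⟶ E) (g : E ⟶ i₁.obj E₁)
    (h : i₁.obj E₁ ⟶ (i₂.obj E₂)⟦(1 : ℤ)⟧), Triangle.mk f g h ∈ distTriang D

variable {D D₁ D₂}

namespace SemiorthogonalDecomposition

variable (S : SemiorthogonalDecomposition D D₁ D₂)

instance : S.i₁.CommShift ℤ := S.commShift₁
instance : S.i₂.CommShift ℤ := S.commShift₂
instance : S.i₁.IsTriangulated := S.isTriangulated₁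
instance : S.i₂.IsTriangulated := S.isTriangulated₂

/-- The commutation with shifts which `τ₁L` inherits from its right adjoint `i₁`. -/
instance : S.τ₁L.CommShift ℤ := S.adj₁.leftAdjointCommShift ℤ

/-- The commutation with shifts which `τ₂R` inherits from its left adjoint `i₂`. -/
instance : S.τ₂R.CommShift ℤ := S.adj₂.rightAdjointCommShift ℤ

instance : S.τ₁L.IsTriangulated :=
  haveI : S.adj₁.CommShift ℤ := S.adj₁.commShift_of_rightAdjoint ℤ
  S.adj₁.isTriangulated_leftAdjoint

instance : S.τ₂R.IsTriangulated :=
  haveI : S.adj₂.CommShift ℤ := S.adj₂.commShift_of_leftAdjoint ℤ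
  S.adj₂.isTriangulated_rightAdjoint

/-- Condition 1: `i₁` has a right adjoint `τ₁R`, here with a choice of it (it is unique up to
isomorphism). -/
structure ConditionOne where
  τ₁R : D ⥤ D₁
  adj : S.i₁ ⊣ τ₁R

variable {S}

/-- The gluing functor `Φ = τ₁R ∘ i₂ [1]`. -/
def ConditionOne.gluingFunctor (h : S.ConditionOne) : D₂ ⥤ D₁ :=
  S.i₂ ⋙ h.τ₁R ⋙ shiftFunctor D₁ (1 : ℤ)

/-- Condition 2: under the equivalences `e₁ : D₁ ≌ C` and `e₂ : D₂ ≌ C`, the right adjoint `τ₁R`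
of `i₁` becomes a left adjoint of `i₂`. -/
def ConditionOne.IsConditionTwo (h : S.ConditionOne) {C : Type u₃} [Category.{v₃} C]
    (e₁ : D₁ ≌ C) (e₂ : D₂ ≌ C) : Prop :=
  Nonempty ((h.τ₁R ⋙ e₁.functor ⋙ e₂.inverse) ⊣ S.i₂)

/-- Condition 5 for a pair of stability conditions. The first two fields say that the gluing functor
is t-exact (condition 3), the third that it preserves free objects (condition 4). -/
structure ConditionOne.IsConditionFive (h : S.ConditionOne) (σ₁ : StabilityCondition D₁)
    (σ₂ : StabilityCondition D₂) : Prop where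
  map_le0 : ∀ E : D₂, σ₂.le0 E → σ₁.le0 (h.gluingFunctor.obj E)
  map_ge0 : ∀ E : D₂, σ₂.ge0 E → σ₁.ge0 (h.gluingFunctor.obj E)
  map_free : ∀ E : D₂, σ₂.free E → σ₁.free (h.gluingFunctor.obj E)
  charge_eq : ∀ E : D₂, σ₂.heart E → σ₂.charge E = σ₁.charge (h.gluingFunctor.obj E)

variable (S) (σ₁ : StabilityCondition D₁) (σ₂ : StabilityCondition D₂)

/-! ### The glued heart, slopes and the tilted heart -/

/-- The glued heart `gl(A₁, A₂)`. -/
def gluedHeart : ObjectProperty D :=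
  fun E => σ₁.heart (S.τ₁L.obj E) ∧ σ₂.heart (S.τ₂R.obj E)

/-- The `(σ₁, σ₂)`-torsion objects of the glued heart. -/
def gluedTorsion : ObjectProperty D :=
  fun E => S.gluedHeart σ₁ σ₂ E ∧ σ₁.torsion (S.τ₁L.obj E) ∧ σ₂.torsion (S.τ₂R.obj E)

/-- The `(σ₁, σ₂)`-free objects of the glued heart. -/
def gluedFree : ObjectProperty D :=
  fun E => S.gluedHeart σ₁ σ₂ E ∧ σ₁.free (S.τ₁L.obj E) ∧ σ₂.free (S.τ₂R.obj E)

/-- The slope `μ_{β,ω}`. It is used only for nonzero `(σ₁, σ₂)`-free objects, where the denominator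
is positive. -/
def slope (β ω : ℝ) (E : D) : ℝ :=
  ((σ₁.charge (S.τ₁L.obj E)).im - ω * (σ₂.charge (S.τ₂R.obj E)).re
      + β * (σ₂.charge (S.τ₂R.obj E)).im) /
    ((σ₁.charge (S.τ₁L.obj E)).im + (σ₂.charge (S.τ₂R.obj E)).im)

/-- A nonzero free object is `μ_{β,ω}`-semistable if no nonzero subobject in the glued heart has
larger slope. -/
def IsSlopeSemistable (β ω : ℝ) (E : D) : Prop :=
  S.gluedFree σ₁ σ₂ E ∧ ¬ IsZero E ∧
    ∀ (F : D) (f : F ⟶ E), IsStrictMono (S.gluedHeart σ₁ σ₂) f → ¬ IsZero F →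
      S.slope σ₁ σ₂ β ω F ≤ S.slope σ₁ σ₂ β ω E

/-- A Harder-Narasimhan filtration of a free object with respect to `μ_{β,ω}`: a filtration in the
glued heart with semistable free factors of strictly decreasing slope. The slope of the first factor
is `μ⁺(E)`, the slope of the last factor is `μ⁻(E)`. -/
def IsSlopeHN (β ω : ℝ) (n : ℕ) (F : Fin (n + 1) → D) (A : Fin n → D) (E : D) : Prop :=
  IsFiltration n F A E ∧ (∀ i, S.gluedHeart σ₁ σ₂ (F i)) ∧
    (∀ i, S.IsSlopeSemistable σ₁ σ₂ β ω (A i)) ∧ StrictAnti fun i => S.slope σ₁ σ₂ β ω (A i)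

/-- The torsion-free class `F_{β,ω}`: the free objects with `μ⁺ ≤ 0` (and zero). -/
def tiltFree (β ω : ℝ) : ObjectProperty D := fun E =>
  S.gluedFree σ₁ σ₂ E ∧ ∃ (n : ℕ) (F : Fin (n + 1) → D) (A : Fin n → D),
    S.IsSlopeHN σ₁ σ₂ β ω n F A E ∧ ∀ i, S.slope σ₁ σ₂ β ω (A i) ≤ 0

/-- The torsion class `T_{β,ω}`: the objects `E` of the glued heart whose free part `E_fr` is zero
or has `μ⁻(E_fr) > 0`. The free part is the cokernel of the torsion part `T ⟶ E`. -/
def tiltTorsion (β ω : ℝ) : ObjectProperty D := fun E =>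
  S.gluedHeart σ₁ σ₂ E ∧ ∃ (T Efr : D) (f : T ⟶ E) (g : E ⟶ Efr) (h : Efr ⟶ T⟦(1 : ℤ)⟧),
    Triangle.mk f g h ∈ distTriang D ∧ S.gluedTorsion σ₁ σ₂ T ∧ S.gluedFree σ₁ σ₂ Efr ∧
    ∃ (n : ℕ) (F : Fin (n + 1) → D) (A : Fin n → D),
      S.IsSlopeHN σ₁ σ₂ β ω n F A Efr ∧ ∀ i, 0 < S.slope σ₁ σ₂ β ω (A i)

/-- The tilted heart `A_{β,ω}`: the extensions of objects of `T_{β,ω}` by objects of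
`F_{β,ω}⟦1⟧`. -/
def tiltedHeart (β ω : ℝ) : ObjectProperty D := fun E =>
  ∃ (F T : D) (f : F⟦(1 : ℤ)⟧ ⟶ E) (g : E ⟶ T) (h : T ⟶ (F⟦(1 : ℤ)⟧)⟦(1 : ℤ)⟧),
    Triangle.mk f g h ∈ distTriang D ∧ S.tiltFree σ₁ σ₂ β ω F ∧ S.tiltTorsion σ₁ σ₂ β ω T

/-- The homomorphism `Z_{β,ω} = Z₁ ∘ τ₁L + (β - i ω) Z₂ ∘ τ₂R`. -/
def tiltedCharge (β ω : ℝ) : K0 D →+ ℂ :=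
  σ₁.Z.comp (K0.map S.τ₁L) +
    (AddMonoidHom.mulLeft ((β : ℂ) - Complex.I * (ω : ℂ))).comp (σ₂.Z.comp (K0.map S.τ₂R))

end SemiorthogonalDecomposition

end SOD

end TriStab

end

/-! Write `xₖ + i yₖ` for the charges of the two components `τ₁L E`, `τ₂R E` of an object. The slope
is `Im Z_{β,ω}` divided by the rank `y₁ + y₂`, so tilting at slope `0` makes `Im Z_{β,ω}`
nonnegative by design. What needs an argument is that the hearts and Harder-Narasimhan filtrations
exist, and that `Z_{β,ω}` is negative on nonzero objects of the tilted heart where its imaginary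
part vanishes.

Gluing rests on `Hom(i₁ X, i₂ Y[1]) = Hom(X, Φ Y)`: truncations of the two components glue as soon
as `Φ` respects the coaisles (`isCut_glue`). At phase `0` this gives the glued heart, at phase `1`
the decomposition of its objects into torsion and free parts.

Harder-Narasimhan filtrations come from `IsSlopeData`: a nonnegative rank with discrete values, a
degree that is nonnegative in rank `0`, and torsion-free quotients. Induction on the rank then takes
the place of chain conditions. Discreteness comes from rationality and finite generation of `K₀` up
to torsion. The construction is used twice: on the glued heart with degree `Im Z_{β,ω}`, and on the
tilted heart with rank `Im Z_{β,ω}` and degree `-Re Z_{β,ω}`.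

The heart of the matter is `re_charge_pos`: a nonzero `F` in the torsion-free class with `Im
Z_{β,ω}(F) = 0` has `Re Z_{β,ω}(F) > 0`. Condition 2 turns a left adjoint of `i₂` into `τ₁R`, and
its unit gives a triangle `G ⟶ F ⟶ i₂ Q` with `τ₁R G = 0`. Vanishing of `τ₁R G` means `Φ(τ₂R G) ≅
τ₁L G ≅ τ₁L F`, so by condition 5 the second charge of `G` is the first charge of `F`. Since every
`i₁ X` with `X` free has all slopes equal to `1`, `i₁` is right exact for the tilted t-structure,
hence `τ₁R` is left exact; this places `Φ Q`, and so `Q`, in a heart. Thus `G` is a subobject of `F`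
in the glued heart, its degree is nonpositive, and this together with `y₁ ≤ y₂` gives the sign.

For a stability condition one also needs a largest subobject with `Im Z_{β,ω} = 0` in the tilted
heart. It is built in two steps: first the slope-`0` part of `F`, shifted, then `i₁` of the
phase-`1` part of `τ₁R`. Finally, discrete values of the charge imply local finiteness, because
charges of phases in a narrow sector cannot cancel. -/

namespace TriStab

set_option linter.unusedSectionVars false

/-! ### Triangles, vanishing of morphisms and classes in `K₀` -/

section Basics

variable {D : Type u} [Category.{v} D] [Preadditive D] [HasZeroObject D] [HasShift D ℤ]
  [∀ n : ℤ, (shiftFunctor D n).Additive] [Pretriangulated D]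

/-- The pair `X ⟶ Y ⟶ Z` extends to a distinguished triangle. -/
def Tri {X Y Z : D} (f : X ⟶ Y) (g : Y ⟶ Z) : Prop :=
  ∃ h : Z ⟶ X⟦(1 : ℤ)⟧, Triangle.mk f g h ∈ distTriang D

/-- All morphisms from `X` to `Y` vanish. -/
def HomZero (X Y : D) : Prop := ∀ f : X ⟶ Y, f = 0

namespace Tri

variable {X Y Z : D} {f : X ⟶ Y} {g : Y ⟶ Z}

theorem zero (h : Tri f g) : f ≫ g = 0 := by
  obtain ⟨w, hw⟩ := h
  exact comp_distTriang_mor_zero₁₂ _ hw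

theorem desc (h : Tri f g) {W : D} (k : Y ⟶ W) (hk : f ≫ k = 0) : ∃ l : Z ⟶ W, k = g ≫ l := by
  obtain ⟨w, hw⟩ := h
  exact Triangle.yoneda_exact₂ _ hw k hk

theorem lift (h : Tri f g) {W : D} (k : W ⟶ Y) (hk : k ≫ g = 0) : ∃ l : W ⟶ X, k = l ≫ f := by
  obtain ⟨w, hw⟩ := h
  exact Triangle.coyoneda_exact₂ _ hw k hk

theorem rotate (h : Tri f g) : ∃ w : Z ⟶ X⟦(1 : ℤ)⟧, Tri g w := by
  obtain ⟨w, hw⟩ := h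
  exact ⟨w, _, rot_of_distTriang _ hw⟩

theorem invRotate (h : Tri f g) : ∃ w : Z⟦(-1 : ℤ)⟧ ⟶ X, Tri w f := by
  obtain ⟨w, hw⟩ := h
  exact ⟨_, _, inv_rot_of_distTriang _ hw⟩

theorem of_iso (h : Tri f g) {X' Y' Z' : D} {f' : X' ⟶ Y'} {g' : Y' ⟶ Z'} (a : X' ≅ X) (b : Y' ≅ Y)
    (c : Z' ≅ Z) (h₁ : f' ≫ b.hom = a.hom ≫ f) (h₂ : g' ≫ c.hom = b.hom ≫ g) : Tri f' g' := by
  obtain ⟨w, hw⟩ := h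
  refine ⟨c.hom ≫ w ≫ a.inv⟦(1 : ℤ)⟧', isomorphic_distinguished _ hw _ ?_⟩
  refine Triangle.isoMk _ _ a b c h₁ h₂ ?_
  change (c.hom ≫ w ≫ a.inv⟦(1 : ℤ)⟧') ≫ a.hom⟦(1 : ℤ)⟧' = c.hom ≫ w
  rw [Category.assoc, Category.assoc, ← Functor.map_comp, a.inv_hom_id, CategoryTheory.Functor.map_id,
    Category.comp_id]

theorem of_iso₁ (h : Tri f g) {X' : D} (a : X' ≅ X) : Tri (a.hom ≫ f) g :=
  h.of_iso a (Iso.refl _) (Iso.refl _) (by simp) (by simp)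

theorem of_iso₂ (h : Tri f g) {Y' : D} (b : Y' ≅ Y) : Tri (f ≫ b.inv) (b.hom ≫ g) :=
  h.of_iso (Iso.refl _) b (Iso.refl _) (by simp) (by simp)

theorem of_iso₃ (h : Tri f g) {Z' : D} (c : Z' ≅ Z) : Tri f (g ≫ c.inv) :=
  h.of_iso (Iso.refl _) (Iso.refl _) c (by simp) (by simp)

theorem exists_cone {X Y : D} (f : X ⟶ Y) : ∃ (Z : D) (g : Y ⟶ Z), Tri f g := by
  obtain ⟨Z, g, h, H⟩ := distinguished_cocone_triangle f
  exact ⟨Z, g, h, H⟩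

theorem exists_fiber {Y Z : D} (g : Y ⟶ Z) : ∃ (X : D) (f : X ⟶ Y), Tri f g := by
  obtain ⟨X, f, h, H⟩ := distinguished_cocone_triangle₁ g
  exact ⟨X, f, h, H⟩

theorem id_zero (X : D) {Z : D} (hZ : IsZero Z) : Tri (𝟙 X) (0 : X ⟶ Z) :=
  Tri.of_iso ⟨_, contractible_distinguished X⟩ (Iso.refl _) (Iso.refl _) (hZ.iso (isZero_zero D))
    (by simp) (by simp)

theorem zero_id (X : D) {Z : D} (hZ : IsZero Z) : Tri (0 : Z ⟶ X) (𝟙 X) :=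
  Tri.of_iso ⟨_, contractible_distinguished₁ X⟩ (hZ.iso (isZero_zero D)) (Iso.refl _) (Iso.refl _)
    (by simp) (by simp)

theorem isIso₁ (h : Tri f g) (hZ : IsZero Z) : IsIso f := by
  obtain ⟨w, hw⟩ := h
  exact (Triangle.isZero₃_iff_isIso₁ _ hw).1 hZ

theorem isIso₂ (h : Tri f g) (hX : IsZero X) : IsIso g := by
  obtain ⟨w, hw⟩ := h
  exact (Triangle.isZero₁_iff_isIso₂ _ hw).1 hX

theorem isZero₁ (h : Tri f g) (hg : IsIso g) : IsZero X := by
  obtain ⟨w, hw⟩ := h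
  exact (Triangle.isZero₁_iff_isIso₂ _ hw).2 hg

theorem isZero₂ (h : Tri f g) (hX : IsZero X) (hZ : IsZero Z) : IsZero Y := by
  obtain ⟨w, hw⟩ := h
  exact Triangle.isZero₂_of_isZero₁₃ _ hw hX hZ

theorem of_isIso₁ {X Y Z : D} (f : X ⟶ Y) [IsIso f] (hZ : IsZero Z) : Tri f (0 : Y ⟶ Z) :=
  (id_zero X hZ).of_iso (Iso.refl _) (asIso f).symm (Iso.refl _) (by simp) (by simp)

theorem homZero_left (h : Tri f g) {W : D} (h₁ : HomZero X W) (h₃ : HomZero Z W) :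
    HomZero Y W := by
  intro k
  obtain ⟨l, rfl⟩ := h.desc k (h₁ _)
  rw [h₃ l, comp_zero]

theorem homZero_right (h : Tri f g) {W : D} (h₁ : HomZero W X) (h₃ : HomZero W Z) :
    HomZero W Y := by
  intro k
  obtain ⟨l, rfl⟩ := h.lift k (h₃ _)
  rw [h₁ l, zero_comp]

theorem rotate_shift (h : Tri f g) : ∃ w : Z ⟶ X⟦(1 : ℤ)⟧, Tri g w ∧ Tri w (f⟦(1 : ℤ)⟧') := by
  obtain ⟨w, hw⟩ := h
  have h₁ : Tri g w := ⟨_, rot_of_distTriang _ hw⟩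
  have h₂ : Tri w (-f⟦(1 : ℤ)⟧') := ⟨_, rot_of_distTriang _ (rot_of_distTriang _ hw)⟩
  refine ⟨w, h₁, h₂.of_iso (Iso.refl _) (Iso.refl _) ⟨-𝟙 _, -𝟙 _, by simp, by simp⟩ (by simp) ?_⟩
  simp

/-- If the first map is zero, the identity of `X⟦1⟧` factors through the connecting map from `Z`. In
a heart this says that a zero monomorphism has zero source. -/
theorem isZero_of_eq_zero₁ (h : Tri f g) (hf : f = 0) (hZ : HomZero (X⟦(1 : ℤ)⟧) Z) :
    IsZero X := by
  obtain ⟨w, -, hw⟩ := h.rotate_shift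
  obtain ⟨l, hl⟩ := hw.lift (𝟙 (X⟦(1 : ℤ)⟧)) (by rw [hf, Functor.map_zero, comp_zero])
  rw [hZ l, zero_comp] at hl
  rw [IsZero.iff_id_eq_zero]
  apply (shiftFunctor D (1 : ℤ)).map_injective
  rw [CategoryTheory.Functor.map_id, hl, Functor.map_zero]

theorem isZero_of_eq_zero₂ (h : Tri f g) (hg : g = 0) (hX : HomZero (X⟦(1 : ℤ)⟧) Z) :
    IsZero Z := by
  obtain ⟨w, hw⟩ := h.rotate
  obtain ⟨l, hl⟩ := hw.desc (𝟙 Z) (by rw [hg, zero_comp])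
  rw [IsZero.iff_id_eq_zero, hl, hX l, comp_zero]

/-- Shifting a triangle multiplies its maps by a sign. On the first two maps the sign is absorbed by
the automorphism `ε` of the middle vertex. -/
theorem neg_one_pow_smul {ε : ℤˣ} (h : Tri (ε • f) (ε • g)) : Tri f g := by
  have hε : (ε * ε : ℤˣ) = 1 := Int.units_mul_self ε
  let e : Y ≅ Y := ⟨ε • 𝟙 Y, ε • 𝟙 Y, by simp [smul_smul, hε], by simp [smul_smul, hε]⟩
  exact h.of_iso (Iso.refl _) e (Iso.refl _) (by simp [e]) (by simp [e, smul_smul, hε])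

theorem shift (h : Tri f g) (n : ℤ) : Tri (f⟦n⟧') (g⟦n⟧') := by
  obtain ⟨v, hv⟩ := h
  exact neg_one_pow_smul (ε := n.negOnePow) ⟨_, Triangle.shift_distinguished _ hv n⟩

theorem map {D' : Type u₁} [Category.{v₁} D'] [Preadditive D'] [HasZeroObject D'] [HasShift D' ℤ]
    [∀ n : ℤ, (shiftFunctor D' n).Additive] [Pretriangulated D']
    (F : D ⥤ D') [F.CommShift ℤ] [F.IsTriangulated] (h : Tri f g) : Tri (F.map f) (F.map g) := by
  obtain ⟨v, hv⟩ := h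
  exact ⟨_, F.map_distinguished _ hv⟩

/-- A triangle on `X⟦1⟧ ⟶ Y ⟶ Z` from one on `X ⟶ Y⟦-1⟧ ⟶ Z⟦-1⟧`, with the outer shifts
cancelled. -/
theorem unshift {X Y Z : D} {n : ℤ} {f : X ⟶ Y⟦-n⟧} {g : Y⟦-n⟧ ⟶ Z} (h : Tri f g) :
    ∃ (f' : X⟦n⟧ ⟶ Y) (g' : Y ⟶ Z⟦n⟧), Tri f' g' :=
  ⟨_, _, (h.shift n).of_iso₂ ((shiftNegShift Y n).symm)⟩

variable [IsTriangulated D]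

/-- Octahedral axiom: the cone of a composite is an extension of the cones of its factors.
`comp_right` is the dual form for fibres. -/
theorem comp_left (h : Tri f g) {W V : D} {f' : Y ⟶ W} {g' : W ⟶ V} (h' : Tri f' g') :
    ∃ (C : D) (k : W ⟶ C) (a : Z ⟶ C) (b : C ⟶ V), Tri (f ≫ f') k ∧ Tri a b ∧
      g ≫ a = f' ≫ k ∧ k ≫ b = g' := by
  obtain ⟨w, hw⟩ := h
  obtain ⟨w', hw'⟩ := h'
  obtain ⟨C, k, w'', hw''⟩ := distinguished_cocone_triangle (f ≫ f')
  let o := Triangulated.someOctahedron rfl hw hw' hw''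
  exact ⟨C, k, o.m₁, o.m₃, ⟨_, hw''⟩, ⟨_, o.mem⟩, o.comm₁, o.comm₃⟩

theorem comp_left_of (h : Tri f g) {W V C : D} {f' : Y ⟶ W} {g' : W ⟶ V} (h' : Tri f' g')
    {k : W ⟶ C} {f'' : X ⟶ W} (hf : f ≫ f' = f'') (hk : Tri f'' k) :
    ∃ (a : Z ⟶ C) (b : C ⟶ V), Tri a b ∧ g ≫ a = f' ≫ k ∧ k ≫ b = g' := by
  obtain ⟨w, hw⟩ := h
  obtain ⟨w', hw'⟩ := h'
  obtain ⟨w'', hw''⟩ := hk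
  let o := Triangulated.someOctahedron hf hw hw' hw''
  exact ⟨o.m₁, o.m₃, ⟨_, o.mem⟩, o.comm₁, o.comm₃⟩

theorem comp_right (h : Tri f g) {W V : D} {f' : W ⟶ Z} {g' : Z ⟶ V} (h' : Tri f' g') :
    ∃ (C : D) (k : C ⟶ Y) (a : X ⟶ C) (b : C ⟶ W), Tri k (g ≫ g') ∧ Tri a b ∧
      a ≫ k = f ∧ b ≫ f' = k ≫ g := by
  obtain ⟨w, hw⟩ := h
  obtain ⟨w', hw'⟩ := h'
  obtain ⟨C, k, w'', hw''⟩ := distinguished_cocone_triangle₁ (g ≫ g')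
  let o := Triangulated.someOctahedron' rfl hw hw' hw''
  exact ⟨C, k, o.m₁, o.m₃, ⟨_, hw''⟩, ⟨_, o.mem⟩, o.comm₁, o.comm₄⟩

theorem comp_right_of (h : Tri f g) {W V C : D} {f' : W ⟶ Z} {g' : Z ⟶ V} (h' : Tri f' g')
    {k : C ⟶ Y} {g'' : Y ⟶ V} (hg : g ≫ g' = g'') (hk : Tri k g'') :
    ∃ (a : X ⟶ C) (b : C ⟶ W), Tri a b ∧ a ≫ k = f ∧ b ≫ f' = k ≫ g := by
  obtain ⟨w, hw⟩ := h
  obtain ⟨w', hw'⟩ := h'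
  obtain ⟨w'', hw''⟩ := hk
  let o := Triangulated.someOctahedron' hg hw hw' hw''
  exact ⟨o.m₁, o.m₃, ⟨_, o.mem⟩, o.comm₁, o.comm₄⟩

end Tri

namespace HomZero

theorem of_isZero_left {X Y : D} (h : IsZero X) : HomZero X Y := fun _ => h.eq_of_src _ _

theorem of_isZero_right {X Y : D} (h : IsZero Y) : HomZero X Y := fun _ => h.eq_of_tgt _ _

theorem of_iso {X Y X' Y' : D} (h : HomZero X Y) (a : X ≅ X') (b : Y ≅ Y') : HomZero X' Y' := by
  intro f
  rw [← cancel_epi a.hom, ← cancel_mono b.inv, h (_ ≫ _)]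
  simp

theorem shift {X Y : D} (h : HomZero X Y) (n : ℤ) : HomZero (X⟦n⟧) (Y⟦n⟧) := by
  intro f
  obtain ⟨g, rfl⟩ := (shiftFunctor D n).map_surjective f
  rw [h g, Functor.map_zero]

theorem of_shift {X Y : D} {n : ℤ} (h : HomZero (X⟦n⟧) (Y⟦n⟧)) : HomZero X Y := by
  intro f
  apply (shiftFunctor D n).map_injective
  rw [h (f⟦n⟧'), Functor.map_zero]

end HomZero

namespace K0

theorem of_tri {X Y Z : D} {f : X ⟶ Y} {g : Y ⟶ Z} (h : Tri f g) :
    (K0.of Y : K0 D) = K0.of X + K0.of Z := by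
  obtain ⟨w, hw⟩ := h
  have h := K0.of_triangle (Triangle.mk f g w) hw
  exact sub_eq_zero.1 ((sub_sub _ _ _).symm.trans h)

theorem of_isZero {X : D} (h : IsZero X) : (K0.of X : K0 D) = 0 := by
  have := of_tri (Tri.id_zero X h)
  simpa using this

theorem of_iso {X Y : D} (e : X ≅ Y) : (K0.of X : K0 D) = K0.of Y := by
  have := of_tri (Tri.of_isIso₁ e.hom (isZero_zero D))
  rw [this, of_isZero (isZero_zero D), add_zero]

theorem of_shift_one (X : D) : (K0.of (X⟦(1 : ℤ)⟧) : K0 D) = - K0.of X := by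
  obtain ⟨w, hw⟩ := (Tri.id_zero X (isZero_zero D)).rotate
  have h1 := of_tri hw
  rw [of_isZero (isZero_zero D)] at h1
  exact (neg_eq_of_add_eq_zero_right h1.symm).symm

theorem of_shift (X : D) (n : ℤ) : (K0.of (X⟦n⟧) : K0 D) = n.negOnePow • (K0.of X : K0 D) := by
  have step : ∀ n : ℤ, (K0.of (X⟦n + 1⟧) : K0 D) = - K0.of (X⟦n⟧) := fun n => by
    rw [← of_shift_one, of_iso ((shiftFunctorAdd D n 1).app X)]
    rfl
  induction n using Int.induction_on with
  | zero => rw [of_iso ((shiftFunctorZero D ℤ).app X)]; simp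
  | succ n ih => rw [step, ih, Int.negOnePow_succ]; simp
  | pred n ih =>
    have := step (-n - 1)
    rw [sub_add_cancel, ih] at this
    rw [Int.negOnePow_sub, Int.negOnePow_one, ← neg_eq_iff_eq_neg.2 this]
    simp

end K0

end Basics

/-! ### Cuts of a triangulated category and their t-structures -/

section Cuts

variable {D : Type u} [Category.{v} D] [Preadditive D] [HasZeroObject D] [HasShift D ℤ]
  [∀ n : ℤ, (shiftFunctor D n).Additive] [Pretriangulated D]

theorem extensionProduct_iff_tri {P Q : ObjectProperty D} {E : D} :
    P.extensionProduct Q E ↔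
      ∃ (X Y : D) (f : X ⟶ E) (g : E ⟶ Y), Tri f g ∧ P X ∧ Q Y := by
  constructor
  · rintro ⟨X, Y, f, g, h, H, hX, hY⟩
    exact ⟨X, Y, f, g, ⟨h, H⟩, hX, hY⟩
  · rintro ⟨X, Y, f, g, ⟨h, H⟩, hX, hY⟩
    exact ⟨X, Y, f, g, h, H, hX, hY⟩

theorem extensionProduct_of_tri {P Q : ObjectProperty D} {X Y E : D} {f : X ⟶ E} {g : E ⟶ Y}
    (h : Tri f g) (hX : P X) (hY : Q Y) : P.extensionProduct Q E :=
  extensionProduct_iff_tri.2 ⟨X, Y, f, g, h, hX, hY⟩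

theorem extensionProduct_mono {P P' Q Q' : ObjectProperty D} (hP : P ≤ P') (hQ : Q ≤ Q') :
    P.extensionProduct Q ≤ P'.extensionProduct Q' := by
  rintro E ⟨X, Y, f, g, h, H, hX, hY⟩
  exact ⟨X, Y, f, g, h, H, hP _ hX, hQ _ hY⟩

/-- If there are no extensions of `Q`-objects by `P`-objects, then an object of `P ⋆ Q` is a direct
sum, so it also lies in `Q ⋆ P`. -/
theorem extensionProduct_swap {P Q : ObjectProperty D}
    (h : ∀ X Y, P X → Q Y → HomZero Y (X⟦(1 : ℤ)⟧)) :
    P.extensionProduct Q ≤ Q.extensionProduct P := by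
  rintro E ⟨X, Y, f, g, w, H, hX, hY⟩
  obtain ⟨e, -, -⟩ := exists_iso_binaryBiproduct_of_distTriang _ H (h X Y hX hY w)
  have h1 := binaryBiproductTriangle_distinguished Y X
  have h2 : Tri (biprod.inl : Y ⟶ Y ⊞ X) biprod.snd := ⟨_, h1⟩
  exact extensionProduct_of_tri (h2.of_iso₂ (e ≪≫ biprod.braiding X Y)) hY hX

/-- A pair of orthogonal classes which decompose the category, the first one stable under `⟦1⟧`:
the aisle and the shifted coaisle of a t-structure. -/
structure IsCut (U V : ObjectProperty D) : Prop where
  isoU : U.IsClosedUnderIsomorphisms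
  isoV : V.IsClosedUnderIsomorphisms
  hom : ∀ X Y, U X → V Y → HomZero X Y
  shiftU : ∀ X, U X → U (X⟦(1 : ℤ)⟧)
  shiftV : ∀ X, V X → V (X⟦(-1 : ℤ)⟧)
  tri : ∀ E, U.extensionProduct V E

namespace IsCut

variable {U V : ObjectProperty D} (h : IsCut U V)
include h

theorem exists_tri (E : D) : ∃ (X Y : D) (f : X ⟶ E) (g : E ⟶ Y), Tri f g ∧ U X ∧ V Y :=
  extensionProduct_iff_tri.1 (h.tri E)

/-- In the truncation triangle of `X` the map to the `V`-part vanishes, which forces that part to be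
zero. Since each half of a cut is the orthogonal of the other, closure under extensions, cones and
fibres follows. -/
theorem U_iff (X : D) : U X ↔ ∀ Y, V Y → HomZero X Y := by
  refine ⟨fun hX Y hY => h.hom X Y hX hY, fun H => ?_⟩
  obtain ⟨A, B, f, g, hT, hA, hB⟩ := h.exists_tri X
  have : IsZero B := hT.isZero_of_eq_zero₂ (H _ hB g) (h.hom _ _ (h.shiftU _ hA) hB)
  have := hT.isIso₁ this
  have := h.isoU
  exact U.prop_of_iso (asIso f) hA

theorem V_iff (Y : D) : V Y ↔ ∀ X, U X → HomZero X Y := by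
  refine ⟨fun hY X hX => h.hom X Y hX hY, fun H => ?_⟩
  obtain ⟨A, B, f, g, hT, hA, hB⟩ := h.exists_tri Y
  have : IsZero A := hT.isZero_of_eq_zero₁ (H _ hA f) (h.hom _ _ (h.shiftU _ hA) hB)
  have := hT.isIso₂ this
  have := h.isoV
  exact V.prop_of_iso (asIso g).symm hB

theorem U_ext {X Y Z : D} {f : X ⟶ Y} {g : Y ⟶ Z} (hT : Tri f g) (hX : U X) (hZ : U Z) : U Y :=
  (h.U_iff Y).2 fun _ hW => hT.homZero_left (h.hom _ _ hX hW) (h.hom _ _ hZ hW)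

theorem V_ext {X Y Z : D} {f : X ⟶ Y} {g : Y ⟶ Z} (hT : Tri f g) (hX : V X) (hZ : V Z) : V Y :=
  (h.V_iff Y).2 fun _ hW => hT.homZero_right (h.hom _ _ hW hX) (h.hom _ _ hW hZ)

theorem U_zero {X : D} (hX : IsZero X) : U X :=
  (h.U_iff X).2 fun _ _ => HomZero.of_isZero_left hX

theorem V_zero {X : D} (hX : IsZero X) : V X :=
  (h.V_iff X).2 fun _ _ => HomZero.of_isZero_right hX

theorem U_cone {X Y Z : D} {f : X ⟶ Y} {g : Y ⟶ Z} (hT : Tri f g) (hX : U X) (hY : U Y) : U Z := by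
  obtain ⟨w, hw⟩ := hT.rotate
  exact h.U_ext hw hY (h.shiftU _ hX)

theorem V_fiber {X Y Z : D} {f : X ⟶ Y} {g : Y ⟶ Z} (hT : Tri f g) (hY : V Y) (hZ : V Z) : V X := by
  obtain ⟨w, hw⟩ := hT.invRotate
  exact h.V_ext hw (h.shiftV _ hZ) hY

/-- The t-structure of a cut, with aisle `U` and coaisle `V⟦1⟧`. -/
def toTStructure : Triangulated.TStructure D where
  le n := fun X => U (X⟦n⟧)
  ge n := fun X => V (X⟦n - 1⟧)
  le_isClosedUnderIsomorphisms n := ⟨fun e hX => by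
    have := h.isoU
    exact U.prop_of_iso ((shiftFunctor D n).mapIso e) hX⟩
  ge_isClosedUnderIsomorphisms n := ⟨fun e hX => by
    have := h.isoV
    exact V.prop_of_iso ((shiftFunctor D (n - 1)).mapIso e) hX⟩
  le_shift n a n' ha X hX := by
    have := h.isoU
    exact U.prop_of_iso ((shiftFunctorAdd' D a n' n ha).app X) hX
  ge_shift n a n' ha X hX := by
    have := h.isoV
    exact V.prop_of_iso ((shiftFunctorAdd' D a (n' - 1) (n - 1) (by omega)).app X) hX
  zero' X Y f hX hY := by
    have := h.isoU
    have := h.isoV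
    exact h.hom X Y (U.prop_of_iso ((shiftFunctorZero D ℤ).app X) hX)
      (V.prop_of_iso ((shiftFunctorZero D ℤ).app Y) hY) f
  le_zero_le X hX := by
    have := h.isoU
    exact h.shiftU _ (U.prop_of_iso ((shiftFunctorZero D ℤ).app X) hX)
  ge_one_le X hX := by
    have := h.isoV
    exact h.shiftV _ (V.prop_of_iso ((shiftFunctorZero D ℤ).app X) hX)
  exists_triangle_zero_one E := by
    have := h.isoU
    have := h.isoV
    obtain ⟨X, Y, f, g, w, H, hX, hY⟩ := h.tri E
    exact ⟨X, Y, U.prop_of_iso ((shiftFunctorZero D ℤ).symm.app X) hX,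
      V.prop_of_iso ((shiftFunctorZero D ℤ).symm.app Y) hY, f, g, w, H⟩

theorem toTStructure_le_zero (X : D) : h.toTStructure.le 0 X ↔ U X := by
  have := h.isoU
  exact U.prop_iff_of_iso ((shiftFunctorZero D ℤ).app X)

theorem toTStructure_ge_one (X : D) : h.toTStructure.ge 1 X ↔ V X := by
  have := h.isoV
  exact V.prop_iff_of_iso ((shiftFunctorZero D ℤ).app X)

theorem toTStructure_heart (X : D) : h.toTStructure.heart X ↔ U X ∧ V (X⟦(-1 : ℤ)⟧) :=
  and_congr (h.toTStructure_le_zero X) Iff.rfl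

theorem U_shift {X : D} (hX : U X) (n : ℕ) : U (X⟦(n : ℤ)⟧) :=
  h.toTStructure.le_monotone (Int.natCast_nonneg n) _ ((h.toTStructure_le_zero X).2 hX)

theorem V_shift {X : D} (hX : V X) (n : ℕ) : V (X⟦-(n : ℤ)⟧) := by
  have := h.toTStructure.ge_antitone (a := 1 - n) (b := 1) (by omega) _
    ((h.toTStructure_ge_one X).2 hX)
  change V (X⟦(1 - n : ℤ) - 1⟧) at this
  rwa [show (1 - n : ℤ) - 1 = - n by ring] at this

end IsCut

end Cuts

/-! ### Exact sequences in the heart of a t-structure -/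

section Hearts

variable {D : Type u} [Category.{v} D] [Preadditive D] [HasZeroObject D] [HasShift D ℤ]
  [∀ n : ℤ, (shiftFunctor D n).Additive] [Pretriangulated D] (t : Triangulated.TStructure D)

theorem hom_of_le_ge {X Y : D} {m n : ℤ} (hX : t.le m X) (hY : t.ge n Y) (h : m < n) :
    HomZero X Y := fun f =>
  t.zero_of_isLE_of_isGE f m n h ⟨hX⟩ ⟨hY⟩

theorem isCut_of_tStructure (n : ℤ) : IsCut (t.le n) (t.ge (n + 1)) where
  isoU := inferInstance
  isoV := inferInstance
  hom X Y hX hY := hom_of_le_ge t hX hY (by omega)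
  shiftU X hX := t.le_monotone (by omega : n - 1 ≤ n) _ (t.le_shift n 1 (n - 1) (by omega) X hX)
  shiftV X hX := t.ge_antitone (by omega : n + 1 ≤ n + 2) _
    (t.ge_shift (n + 1) (-1) (n + 2) (by omega) X hX)
  tri E := by
    obtain ⟨X, Y, hX, hY, f, g, w, H⟩ := t.exists_triangle E n (n + 1) rfl
    exact ⟨X, Y, f, g, w, H, hX, hY⟩

variable {t}

theorem le_ext {X Y Z : D} {f : X ⟶ Y} {g : Y ⟶ Z} {n : ℤ} (h : Tri f g) (hX : t.le n X)
    (hZ : t.le n Z) : t.le n Y :=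
  (isCut_of_tStructure t n).U_ext h hX hZ

theorem ge_ext {X Y Z : D} {f : X ⟶ Y} {g : Y ⟶ Z} {n : ℤ} (h : Tri f g) (hX : t.ge n X)
    (hZ : t.ge n Z) : t.ge n Y := by
  have := isCut_of_tStructure t (n - 1)
  rw [sub_add_cancel] at this
  exact this.V_ext h hX hZ

theorem le_cone {X Y Z : D} {f : X ⟶ Y} {g : Y ⟶ Z} {n : ℤ} (h : Tri f g) (hX : t.le (n + 1) X)
    (hY : t.le n Y) : t.le n Z := by
  obtain ⟨w, hw⟩ := h.rotate
  exact le_ext hw hY (t.le_shift (n + 1) 1 n (by omega) X hX)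

theorem ge_fiber {X Y Z : D} {f : X ⟶ Y} {g : Y ⟶ Z} {n : ℤ} (h : Tri f g) (hY : t.ge n Y)
    (hZ : t.ge (n - 1) Z) : t.ge n X := by
  obtain ⟨w, hw⟩ := h.invRotate
  exact ge_ext hw (t.ge_shift (n - 1) (-1) n (by omega) Z hZ) hY

theorem le_of_heart_shift {X : D} (hX : t.heart X) (n : ℤ) : t.le (-n) (X⟦n⟧) :=
  t.le_shift 0 n (-n) (by omega) X hX.1

theorem ge_of_heart_shift {X : D} (hX : t.heart X) (n : ℤ) : t.ge (-n) (X⟦n⟧) :=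
  t.ge_shift 0 n (-n) (by omega) X hX.2

theorem heart_hom {X Y : D} (hX : t.heart X) (hY : t.heart Y) {n : ℤ} (hn : 0 < n) :
    HomZero (X⟦n⟧) Y :=
  hom_of_le_ge t (le_of_heart_shift hX n) hY.2 (by omega)

theorem heart_zero {X : D} (hX : IsZero X) : t.heart X :=
  ⟨(isCut_of_tStructure t 0).U_zero hX, by
    have := (isCut_of_tStructure t (-1)).V_zero hX
    simpa using this⟩

theorem heart_ext {X Y Z : D} {f : X ⟶ Y} {g : Y ⟶ Z} (h : Tri f g) (hX : t.heart X)
    (hZ : t.heart Z) : t.heart Y :=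
  ⟨le_ext h hX.1 hZ.1, ge_ext h hX.2 hZ.2⟩

theorem heart_of_iso {X Y : D} (e : X ≅ Y) (hX : t.heart X) : t.heart Y :=
  t.heart.prop_of_iso e hX

/-- A short exact sequence in the full subcategory `A`: a distinguished triangle with vertices in
`A`. -/
structure Ses (A : ObjectProperty D) {X Y Z : D} (f : X ⟶ Y) (g : Y ⟶ Z) : Prop where
  left : A X
  mid : A Y
  right : A Z
  tri : Tri f g

theorem isStrictMono_iff {A : ObjectProperty D} {X Y : D} {f : X ⟶ Y} :
    IsStrictMono A f ↔ ∃ (Z : D) (g : Y ⟶ Z), Ses A f g := by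
  constructor
  · rintro ⟨hX, hY, Z, g, h, hZ, H⟩
    exact ⟨Z, g, hX, hY, hZ, h, H⟩
  · rintro ⟨Z, g, hX, hY, hZ, h, H⟩
    exact ⟨hX, hY, Z, g, h, hZ, H⟩

namespace Ses

variable {X Y Z : D} {f : X ⟶ Y} {g : Y ⟶ Z}

theorem id_left {A : ObjectProperty D} {X Z : D} (hX : A X) (hZ : A Z) (h : IsZero Z) :
    Ses A (𝟙 X) (0 : X ⟶ Z) := ⟨hX, hX, hZ, Tri.id_zero X h⟩

theorem id_right {A : ObjectProperty D} {X Z : D} (hX : A X) (hZ : A Z) (h : IsZero Z) :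
    Ses A (0 : Z ⟶ X) (𝟙 X) := ⟨hZ, hX, hX, Tri.zero_id X h⟩

/-- The first morphism of a short exact sequence is a monomorphism of the heart. -/
theorem eq_zero_of_comp (h : Ses t.heart f g) {W : D} (hW : t.heart W) (k : W ⟶ X)
    (hk : k ≫ f = 0) : k = 0 := by
  obtain ⟨w, hw⟩ := h.tri.invRotate
  obtain ⟨l, rfl⟩ := hw.lift k hk
  have : HomZero W (Z⟦(-1 : ℤ)⟧) :=
    hom_of_le_ge t hW.1 (ge_of_heart_shift h.right (-1)) (by omega)
  rw [this l, zero_comp]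

theorem isZero_left (h : Ses t.heart f g) (hf : f = 0) : IsZero X :=
  h.tri.isZero_of_eq_zero₁ hf (heart_hom h.left h.right one_pos)

theorem isZero_right (h : Ses t.heart f g) (hg : g = 0) : IsZero Z :=
  h.tri.isZero_of_eq_zero₂ hg (heart_hom h.left h.right one_pos)

theorem isZero_left_of_mid (h : Ses t.heart f g) (hY : IsZero Y) : IsZero X :=
  h.isZero_left (hY.eq_of_tgt _ _)

theorem isZero_right_of_mid (h : Ses t.heart f g) (hY : IsZero Y) : IsZero Z :=
  h.isZero_right (hY.eq_of_src _ _)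

variable [IsTriangulated D]

theorem comp_mono (h : Ses t.heart f g) {W V : D} {f' : Y ⟶ W} {g' : W ⟶ V}
    (h' : Ses t.heart f' g') :
    ∃ (C : D) (k : W ⟶ C) (a : Z ⟶ C) (b : C ⟶ V), Ses t.heart (f ≫ f') k ∧ Ses t.heart a b := by
  obtain ⟨C, k, a, b, h1, h2, -, -⟩ := h.tri.comp_left h'.tri
  have hC := heart_ext h2 h.right h'.right
  exact ⟨C, k, a, b, ⟨h.left, h'.mid, hC, h1⟩, ⟨h.right, hC, h'.right, h2⟩⟩

theorem comp_epi (h : Ses t.heart f g) {W V : D} {f' : W ⟶ Z} {g' : Z ⟶ V}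
    (h' : Ses t.heart f' g') :
    ∃ (C : D) (k : C ⟶ Y) (a : X ⟶ C) (b : C ⟶ W), Ses t.heart k (g ≫ g') ∧ Ses t.heart a b := by
  obtain ⟨C, k, a, b, h1, h2, -, -⟩ := h.tri.comp_right h'.tri
  have hC := heart_ext h2 h.left h'.left
  exact ⟨C, k, a, b, ⟨hC, h.mid, h'.right, h1⟩, ⟨h.left, hC, h'.left, h2⟩⟩

/-- If `g` and `g ≫ s` are epimorphisms of the heart, so is `s`. -/
theorem of_comp_epi (h : Ses t.heart f g) {W C : D} {s : Z ⟶ W} {c : C ⟶ Y}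
    (h' : Ses t.heart c (g ≫ s)) : ∃ (F : D) (a : F ⟶ Z), Ses t.heart a s := by
  obtain ⟨F, a, hF⟩ := Tri.exists_fiber s
  obtain ⟨a', b, h1, -, -⟩ := h.tri.comp_right_of hF rfl h'.tri
  refine ⟨F, a, ⟨le_cone h1 (t.le_monotone (by omega) _ h.left.1) h'.left.1, ?_⟩, h.right,
    h'.right, hF⟩
  exact ge_fiber hF h.right.2 (t.ge_antitone (by omega) _ h'.right.2)

/-- Each morphism of the heart factors as an epimorphism followed by a monomorphism. -/
theorem exists_image {X Y : D} (hX : t.heart X) (hY : t.heart Y) (f : X ⟶ Y) :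
    ∃ (K I Q : D) (k : K ⟶ X) (p : X ⟶ I) (i : I ⟶ Y) (q : Y ⟶ Q),
      Ses t.heart k p ∧ Ses t.heart i q ∧ p ≫ i = f := by
  obtain ⟨C, g, hC⟩ := Tri.exists_cone f
  obtain ⟨w, hw, hw'⟩ := hC.rotate_shift
  have hCle : t.le 0 C := le_cone hC (t.le_monotone (by omega) _ hX.1) hY.1
  have hCge : t.ge (-1) C :=
    ge_ext hw (t.ge_antitone (by omega) _ hY.2) (ge_of_heart_shift hX 1)
  -- The cone of `f` has cohomology only in degrees `-1` and `0`: truncating it gives the shifted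
  -- kernel `K'` and the cokernel `Q`.
  obtain ⟨K', Q, a, b, hab, hK', hQ⟩ := (isCut_of_tStructure t (-1)).exists_tri C
  have hQ' : t.heart Q := ⟨le_cone hab (t.le_monotone (by omega) _ hK') hCle, hQ⟩
  have hK'' : t.ge (-1) K' := ge_fiber hab hCge (t.ge_antitone (by omega) _ hQ)
  have hK : t.heart (K'⟦(-1 : ℤ)⟧) :=
    ⟨t.le_shift (-1) (-1) 0 (by omega) _ hK', t.ge_shift (-1) (-1) 0 (by omega) _ hK''⟩
  obtain ⟨I, i, p, c, h1, h2, h3, h4⟩ := hC.comp_right hab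
  obtain ⟨k, hk⟩ := h2.invRotate
  have hI : t.heart I :=
    ⟨le_ext h2 hX.1 (t.le_monotone (by omega) _ hK'),
      ge_fiber h1 hY.2 (t.ge_antitone (by omega) _ hQ)⟩
  exact ⟨_, I, Q, k, p, i, _, ⟨hK, hX, hI, hk⟩, ⟨hI, hY, hQ', h1⟩, h3⟩

/-- The image of a subobject `X` of `Y` in a quotient `Q` of `Y`: it is a quotient of `X`, and the
quotient of `Q` by it is a quotient of `Y / X`. -/
theorem exists_image_in_quotient (h : Ses t.heart f g) {K Q : D} {k : K ⟶ Y} {q : Y ⟶ Q}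
    (h' : Ses t.heart k q) :
    ∃ (J I R F : D) (j : J ⟶ X) (p : X ⟶ I) (i : I ⟶ Q) (r : Q ⟶ R) (c : F ⟶ Z) (s : Z ⟶ R),
      Ses t.heart j p ∧ Ses t.heart i r ∧ Ses t.heart c s := by
  obtain ⟨J, I, R, j, p, i, r, h1, h2, h3⟩ := exists_image h.left h'.right (f ≫ q)
  obtain ⟨C, c, a, b, h4, -⟩ := h'.comp_epi h2
  obtain ⟨s, hs⟩ := h.tri.desc (q ≫ r) (by
    rw [← Category.assoc, ← h3, Category.assoc, h2.tri.zero, comp_zero])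
  rw [hs] at h4
  obtain ⟨F, d, h5⟩ := h.of_comp_epi h4
  exact ⟨J, I, R, F, j, p, i, r, d, s, h1, h2, h5⟩

end Ses

end Hearts

/-! ### Harder-Narasimhan filtrations from a rank and a degree -/

section Slopes

variable {D : Type u} [Category.{v} D] [Preadditive D] [HasZeroObject D] [HasShift D ℤ]
  [∀ n : ℤ, (shiftFunctor D n).Additive] [Pretriangulated D]

/-- `E` has a finite filtration with nonzero factors in `P φ`, the phases `φ > a` decreasing. -/
inductive Filtered (P : ℝ → ObjectProperty D) : ℝ → D → Prop
  | zero (a : ℝ) (E : D) : IsZero E → Filtered P a E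
  | snoc {a b : ℝ} {K E B : D} {f : K ⟶ E} {g : E ⟶ B} : Filtered P b K → Tri f g → P b B →
      ¬ IsZero B → a < b → Filtered P a E

namespace Filtered

variable {P : ℝ → ObjectProperty D}

theorem mono {a a' : ℝ} {E : D} (h : Filtered P a E) (ha : a' ≤ a) : Filtered P a' E := by
  cases h with
  | zero _ _ h => exact zero _ _ h
  | snoc h1 h2 h3 h4 h5 => exact snoc h1 h2 h3 h4 (ha.trans_lt h5)

theorem of_mem {a b : ℝ} {E : D} (h : P b E) (hab : a < b) : Filtered P a E := by
  by_cases hE : IsZero E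
  · exact zero _ _ hE
  · exact snoc (zero b _ (isZero_zero D)) (Tri.zero_id E (isZero_zero D)) h hE hab

theorem of_iso {a : ℝ} {E E' : D} (h : Filtered P a E) (e : E' ≅ E) : Filtered P a E' := by
  cases h with
  | zero _ _ h => exact zero _ _ (h.of_iso e)
  | snoc h1 h2 h3 h4 h5 => exact snoc h1 (h2.of_iso₂ e) h3 h4 h5

theorem imp {P' : ℝ → ObjectProperty D} {a a' : ℝ} {E : D} (h : Filtered P a E)
    (hP : ∀ b, a < b → ∀ B, P b B → P' b B) (ha : a' ≤ a) : Filtered P' a' E := by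
  induction h generalizing a' with
  | zero a E hE => exact zero _ _ hE
  | snoc h1 h2 h3 h4 h5 ih =>
    exact snoc (ih (fun b hb => hP b (h5.trans hb)) le_rfl) h2 (hP _ h5 _ h3) h4 (ha.trans_lt h5)

/-- Splicing: an extension of `B` by an object whose phases exceed those of `B`. -/
theorem append [IsTriangulated D] {R : ℝ → Prop} {a : ℝ} {K E B : D} {f : K ⟶ E} {g : E ⟶ B}
    (hK : ∀ c, R c → Filtered P c K) (hT : Tri f g)
    (hB : Filtered (fun φ X => P φ X ∧ R φ) a B) (ha : R a) : Filtered P a E := by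
  induction hB generalizing E with
  | zero a B hB =>
    have := hT.isIso₁ hB
    exact (hK a ha).of_iso (asIso f).symm
  | snoc h1 h2 h3 h4 h5 ih =>
    obtain ⟨C, k, x, y, h6, h7, -, -⟩ := hT.comp_right h2
    exact snoc (ih h7 h3.2) h6 h3.1 h4 h5

theorem reindex {P' : ℝ → ObjectProperty D} {θ : ℝ → ℝ} (hθ : StrictMono θ) {a : ℝ} {E : D}
    (h : Filtered P a E) (hP : ∀ b B, P b B → P' (θ b) B) : Filtered P' (θ a) E := by
  induction h with
  | zero a E hE => exact zero _ _ hE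
  | snoc h1 h2 h3 h4 h5 ih => exact snoc ih h2 (hP _ _ h3) h4 (hθ h5)

theorem shift {P' : ℝ → ObjectProperty D} {a c : ℝ} {E : D} (n : ℤ) (h : Filtered P a E)
    (hP : ∀ b B, P b B → P' (b + c) (B⟦n⟧)) : Filtered P' (a + c) (E⟦n⟧) := by
  induction h with
  | zero a E hE => exact zero _ _ ((shiftFunctor D n).map_isZero hE)
  | snoc h1 h2 h3 h4 h5 ih =>
    refine snoc ih (h2.shift n) (hP _ _ h3) (fun h0 => h4 ?_) (by linarith)
    exact IsZero.of_iso ((shiftFunctor D (-n)).map_isZero h0) (shiftShiftNeg _ n).symm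

theorem homZero {a c : ℝ} {E F : D} (hE : Filtered P a E) (hac : c ≤ a)
    (hF : ∀ b, c < b → ∀ B, P b B → HomZero B F) : HomZero E F := by
  induction hE with
  | zero a E hE => exact HomZero.of_isZero_left hE
  | snoc h1 h2 h3 h4 h5 ih =>
    exact h2.homZero_left (ih (hac.trans h5.le)) (hF _ (hac.trans_lt h5) _ h3)

theorem homZero_right {a : ℝ} {E F : D} (hF : Filtered P a F)
    (hE : ∀ b, a < b → ∀ B, P b B → HomZero E B) : HomZero E F := by
  induction hF with
  | zero a E h0 => exact HomZero.of_isZero_right h0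
  | snoc h1 h2 h3 h4 h5 ih =>
    exact h2.homZero_right (ih fun b hb => hE b (h5.trans hb)) (hE _ h5 _ h3)

/-- The objects of a filtration whose factors lie in a class closed under extensions. -/
theorem prop {Q : ObjectProperty D} {a : ℝ} {E : D} (h : Filtered P a E)
    (h0 : ∀ X, IsZero X → Q X) (hP : ∀ b, a < b → ∀ X, P b X → Q X)
    (hext : ∀ {X Y Z : D} {f : X ⟶ Y} {g : Y ⟶ Z}, Tri f g → Q X → Q Z → Q Y) : Q E := by
  induction h with
  | zero a E h => exact h0 _ h
  | snoc h1 h2 h3 h4 h5 ih =>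
    exact hext h2 (ih fun b hb => hP b (h5.trans hb)) (hP _ h5 _ h3)

theorem exists_isFiltration {a : ℝ} {E : D} (h : Filtered P a E) :
    ∃ (n : ℕ) (F : Fin (n + 1) → D) (A : Fin n → D) (φ : Fin n → ℝ),
      IsFiltration n F A E ∧ StrictAnti φ ∧ (∀ i, a < φ i ∧ P (φ i) (A i) ∧ ¬ IsZero (A i)) ∧
        ∀ i, Filtered P a (F i) := by
  induction h with
  | zero a E hE =>
    exact ⟨0, fun _ => E, Fin.elim0, Fin.elim0, ⟨hE, ⟨Iso.refl _⟩, fun i => i.elim0⟩,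
      fun i => i.elim0, fun i => i.elim0, fun _ => zero _ _ hE⟩
  | @snoc a b K E B f g h1 h2 h3 h4 h5 ih =>
    obtain ⟨n, F, A, φ, ⟨hF0, ⟨e⟩, hF⟩, hφ, hA, hF'⟩ := ih
    refine ⟨n + 1, Fin.snoc F E, Fin.snoc A B, Fin.snoc φ b, ⟨?_, ?_, ?_⟩, ?_, ?_, ?_⟩
    · have : (Fin.snoc F E : Fin (n + 2) → D) 0 = F 0 := Fin.snoc_castSucc (i := (0 : Fin (n + 1))) ..
      rwa [this]
    · rw [Fin.snoc_last]
      exact ⟨Iso.refl _⟩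
    · intro i
      induction i using Fin.lastCases with
      | last =>
        rw [Fin.snoc_castSucc, Fin.succ_last, Fin.snoc_last, Fin.snoc_last]
        obtain ⟨w, hw⟩ := h2.of_iso₁ e
        exact ⟨_, _, w, hw⟩
      | cast i =>
        rw [Fin.snoc_castSucc, Fin.succ_castSucc, Fin.snoc_castSucc, Fin.snoc_castSucc]
        exact hF i
    · intro i j hij
      induction j using Fin.lastCases with
      | last =>
        induction i using Fin.lastCases with
        | last => exact absurd hij (lt_irrefl _)
        | cast i =>
          rw [Fin.snoc_castSucc, Fin.snoc_last]
          exact (hA i).1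
      | cast j =>
        induction i using Fin.lastCases with
        | last => exact absurd (hij.trans (Fin.castSucc_lt_last j)) (lt_irrefl _)
        | cast i =>
          rw [Fin.snoc_castSucc, Fin.snoc_castSucc]
          exact hφ (by simpa using hij)
    · intro i
      induction i using Fin.lastCases with
      | last =>
        rw [Fin.snoc_last, Fin.snoc_last]
        exact ⟨h5, h3, h4⟩
      | cast i =>
        rw [Fin.snoc_castSucc, Fin.snoc_castSucc]
        exact ⟨h5.trans (hA i).1, (hA i).2⟩
    · intro i
      induction i using Fin.lastCases with
      | last =>
        rw [Fin.snoc_last]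
        exact snoc h1 h2 h3 h4 h5
      | cast i =>
        rw [Fin.snoc_castSucc]
        exact (hF' i).mono h5.le

theorem of_isFiltration {n : ℕ} {F : Fin (n + 1) → D} {A : Fin n → D} {E : D} {φ : Fin n → ℝ}
    (h : IsFiltration n F A E) (hφ : StrictAnti φ) (hA : ∀ i, P (φ i) (A i) ∧ ¬ IsZero (A i))
    {a : ℝ} (ha : ∀ i, a < φ i) : Filtered P a E := by
  induction n generalizing a E with
  | zero =>
    obtain ⟨h0, ⟨e⟩, -⟩ := h
    exact zero _ _ (h0.of_iso e.symm)
  | succ n ih =>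
    obtain ⟨h0, ⟨e⟩, h⟩ := h
    obtain ⟨f, g, w, hw⟩ := h (Fin.last n)
    have hT : Tri f g := ⟨w, hw⟩
    have hK : Filtered P (φ (Fin.last n)) (F (Fin.last n).castSucc) := by
      refine ih (F := fun i => F i.castSucc) (A := fun i => A i.castSucc)
        (φ := fun i => φ i.castSucc) ⟨h0, ⟨Iso.refl _⟩, fun i => h i.castSucc⟩
        (fun i j hij => hφ (by simpa using hij)) (fun i => hA _) fun i => hφ (Fin.castSucc_lt_last i)
    exact of_iso (snoc hK hT (hA _).1 (hA _).2 (ha _)) e.symm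

end Filtered

variable (t : Triangulated.TStructure D) (d n : K0 D →+ ℝ)

/-- Objects of the heart without nonzero subobjects of rank `0`. -/
def IsTorsionFree (E : D) : Prop :=
  t.heart E ∧ ∀ (K Q : D) (f : K ⟶ E) (g : E ⟶ Q), Ses t.heart f g → d (K0.of K) = 0 → IsZero K

/-- Nonzero torsion-free objects whose subobjects have no larger slope `n / d`. -/
def IsSemistable (E : D) : Prop :=
  IsTorsionFree t d E ∧ ¬ IsZero E ∧ ∀ (K Q : D) (f : K ⟶ E) (g : E ⟶ Q), Ses t.heart f g →
    n (K0.of K) * d (K0.of E) ≤ n (K0.of E) * d (K0.of K)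

/-- Semistable objects of slope `b`. -/
def SemistableOfSlope (b : ℝ) : ObjectProperty D := fun E =>
  IsSemistable t d n E ∧ n (K0.of E) = b * d (K0.of E)

/-- A rank and a degree on a heart for which Harder-Narasimhan filtrations exist. -/
structure IsSlopeData : Prop where
  rank_nonneg : ∀ E, t.heart E → 0 ≤ d (K0.of E)
  degree_nonneg : ∀ E, t.heart E → d (K0.of E) = 0 → 0 ≤ n (K0.of E)
  discrete : ∃ N : ℝ, 0 < N ∧ ∀ x, ∃ k : ℤ, N * d x = k
  torsion : ∀ E, t.heart E → ∃ (K Q : D) (f : K ⟶ E) (g : E ⟶ Q), Ses t.heart f g ∧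
    d (K0.of K) = 0 ∧ IsTorsionFree t d Q

variable {t d n}

theorem Ses.map_eq {X Y Z : D} {f : X ⟶ Y} {g : Y ⟶ Z} (h : Ses t.heart f g) (m : K0 D →+ ℝ) :
    m (K0.of Y) = m (K0.of X) + m (K0.of Z) := by
  rw [K0.of_tri h.tri, map_add]

theorem IsTorsionFree.rank_pos (h : IsSlopeData t d n) {E : D} (hE : IsTorsionFree t d E)
    (h0 : ¬ IsZero E) : 0 < d (K0.of E) := by
  refine lt_of_le_of_ne (h.rank_nonneg E hE.1) fun h1 => h0 ?_
  exact hE.2 E _ (𝟙 E) 0 (Ses.id_left hE.1 (heart_zero (isZero_zero D)) (isZero_zero D)) h1.symm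

theorem IsTorsionFree.of_sub [IsTriangulated D] {X Y Z : D} {f : X ⟶ Y} {g : Y ⟶ Z}
    (hY : IsTorsionFree t d Y) (h : Ses t.heart f g) : IsTorsionFree t d X := by
  refine ⟨h.left, fun K Q a b hab hK => ?_⟩
  obtain ⟨C, k, _, _, h1, -⟩ := hab.comp_mono h
  exact hY.2 _ _ _ _ h1 hK

theorem IsTorsionFree.of_iso {E E' : D} (hE : IsTorsionFree t d E) (e : E' ≅ E) :
    IsTorsionFree t d E' := by
  refine ⟨heart_of_iso e.symm hE.1, fun K Q f g h => hE.2 K Q (f ≫ e.hom) (e.inv ≫ g) ?_⟩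
  exact ⟨h.left, hE.1, h.right, h.tri.of_iso₂ e.symm⟩

/-- `Q` is a quotient of `E` of positive rank whose slope is minimal. -/
def IsMinimalQuotient (t : Triangulated.TStructure D) (d n : K0 D →+ ℝ) (E Q : D) : Prop :=
  (∃ (K : D) (k : K ⟶ E) (q : E ⟶ Q), Ses t.heart k q) ∧ 0 < d (K0.of Q) ∧
    ∀ (K' Q' : D) (k' : K' ⟶ E) (q' : E ⟶ Q'), Ses t.heart k' q' →
      n (K0.of Q) * d (K0.of Q') ≤ n (K0.of Q') * d (K0.of Q)

namespace IsSlopeData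

variable (h : IsSlopeData t d n)
include h

theorem exists_nat {N : ℝ} (hN : 0 < N) (hd : ∀ x, ∃ k : ℤ, N * d x = k) {E : D}
    (hE : t.heart E) : ∃ k : ℕ, N * d (K0.of E) = k := by
  obtain ⟨k, hk⟩ := hd (K0.of E)
  have h1 : (0 : ℝ) ≤ k := hk ▸ mul_nonneg hN.le (h.rank_nonneg E hE)
  lift k to ℕ using by exact_mod_cast h1
  exact ⟨k, by simpa using hk⟩

variable [IsTriangulated D]

/-- If `K` is a subobject of `E` whose quotients have slope at least that of `Q`, then a minimal
quotient `Q` of `E / K` is a minimal quotient of `E`. -/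
theorem isMinimalQuotient_of_quotient {K E E₀ Q : D} {k : K ⟶ E} {e : E ⟶ E₀}
    (hs : Ses t.heart k e) (hQ : IsMinimalQuotient t d n E₀ Q)
    (hK : ∀ (J I : D) (j : J ⟶ K) (p : K ⟶ I), Ses t.heart j p →
      n (K0.of Q) * d (K0.of I) ≤ n (K0.of I) * d (K0.of Q)) :
    IsMinimalQuotient t d n E Q := by
  obtain ⟨⟨L, l, q, hq⟩, hd, hmin⟩ := hQ
  obtain ⟨C, c, _, _, h1, -⟩ := hs.comp_epi hq
  refine ⟨⟨C, c, _, h1⟩, hd, fun K' Q' k' q' h' => ?_⟩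
  obtain ⟨J, I, R, F, j, p, i, r, c, s, h2, h3, h4⟩ := hs.exists_image_in_quotient h'
  have e1 := h3.map_eq d
  have e2 := h3.map_eq n
  have e3 := hmin _ _ _ _ h4
  have e4 := hK _ _ _ _ h2
  rw [e1, e2]
  linarith

/-- Induction on the rank; only the rank has to be discrete, not the degree. A torsion-free `E`
which is not semistable has a destabilizing subobject `A` of minimal rank, which is semistable. The
quotient `B = E / A` has smaller rank, and a minimal quotient of `B` is one of `E`, because the
quotients of `A` have slope at least that of `A`, which exceeds that of `B`. -/
theorem exists_isMinimalQuotient {E : D} (hE : t.heart E) (hd : 0 < d (K0.of E)) :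
    ∃ Q, IsMinimalQuotient t d n E Q := by
  obtain ⟨N, hN, hdisc⟩ := h.discrete
  obtain ⟨m, hm⟩ := h.exists_nat hN hdisc hE
  induction m using Nat.strong_induction_on generalizing E with
  | _ m ih =>
  -- reduction to torsion-free objects
  suffices H : ∀ E, IsTorsionFree t d E → 0 < d (K0.of E) → N * d (K0.of E) = m →
      ∃ Q, IsMinimalQuotient t d n E Q by
    obtain ⟨K, E₀, k, e, hs, hK, hE₀⟩ := h.torsion E hE
    have hd₀ : d (K0.of E₀) = d (K0.of E) := by rw [hs.map_eq d, hK, zero_add]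
    obtain ⟨Q, hQ⟩ := H E₀ hE₀ (hd₀ ▸ hd) (hd₀ ▸ hm)
    refine ⟨Q, h.isMinimalQuotient_of_quotient hs hQ fun J I j p hjp => ?_⟩
    have e1 := hjp.map_eq d
    have e2 := h.rank_nonneg _ hjp.left
    have e3 := h.rank_nonneg _ hjp.right
    have e4 : d (K0.of I) = 0 := by linarith
    rw [e4, mul_zero]
    exact mul_nonneg (h.degree_nonneg _ hjp.right e4) hQ.2.1.le
  clear hE hd hm E
  intro E hE hd hm
  by_cases hss : ∀ (A B : D) (f : A ⟶ E) (g : E ⟶ B), Ses t.heart f g →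
      n (K0.of A) * d (K0.of E) ≤ n (K0.of E) * d (K0.of A)
  · refine ⟨E, ⟨_, 0, 𝟙 E, Ses.id_right hE.1 (heart_zero (isZero_zero D)) (isZero_zero D)⟩, hd,
      fun K' Q' k' q' h' => ?_⟩
    have e1 := h'.map_eq d
    have e2 := h'.map_eq n
    have e3 := hss _ _ _ _ h'
    have e4 : d (K0.of Q') = d (K0.of E) - d (K0.of K') := by linarith
    have e5 : n (K0.of Q') = n (K0.of E) - n (K0.of K') := by linarith
    rw [e4, e5]
    linarith
  · -- a destabilizing subobject of minimal rank is semistable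
    have hex : ∃ r : ℕ, ∃ (A B : D) (f : A ⟶ E) (g : E ⟶ B), Ses t.heart f g ∧
        n (K0.of E) * d (K0.of A) < n (K0.of A) * d (K0.of E) ∧ N * d (K0.of A) = r := by
      push Not at hss
      obtain ⟨A, B, f, g, h1, h2⟩ := hss
      obtain ⟨r, hr⟩ := h.exists_nat hN hdisc h1.left
      exact ⟨r, A, B, f, g, h1, h2, hr⟩
    classical
    obtain ⟨A, B, f, g, hs, hA, hr⟩ := Nat.find_spec hex
    have hmin := fun r hr => Nat.find_min hex (m := r) hr
    set r := Nat.find hex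
    have hAtf := hE.of_sub hs
    have hA0 : ¬ IsZero A := by
      intro h0
      rw [K0.of_isZero h0] at hA
      simp at hA
    have hdA := hAtf.rank_pos h hA0
    have hAss : ∀ (A' B' : D) (f' : A' ⟶ A) (g' : A ⟶ B'), Ses t.heart f' g' →
        n (K0.of A') * d (K0.of A) ≤ n (K0.of A) * d (K0.of A') := by
      intro A' B' f' g' h'
      by_contra! hlt
      have hA'0 : ¬ IsZero A' := by
        intro h0
        rw [K0.of_isZero h0] at hlt
        simp at hlt
      have hdA' := (hAtf.of_sub h').rank_pos h hA'0
      obtain ⟨C, k, a, b, h1, -⟩ := h'.comp_mono hs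
      have hdest : n (K0.of E) * d (K0.of A') < n (K0.of A') * d (K0.of E) := by
        have e1 : n (K0.of E) * d (K0.of A) * d (K0.of A') <
            n (K0.of A) * d (K0.of E) * d (K0.of A') := mul_lt_mul_of_pos_right hA hdA'
        have e2 : n (K0.of A) * d (K0.of A') * d (K0.of E) <
          n (K0.of A') * d (K0.of A) * d (K0.of E) := mul_lt_mul_of_pos_right hlt hd
        refine lt_of_mul_lt_mul_right (a := d (K0.of A)) ?_ hdA.le
        linarith
      obtain ⟨r', hr'⟩ := h.exists_nat hN hdisc h'.left
      have hle : r ≤ r' := by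
        by_contra! hlt'
        exact hmin r' hlt' ⟨A', C, _, k, h1, hdest, hr'⟩
      have e3 := h'.map_eq d
      have e4 := h'.map_eq n
      have e5 := h.rank_nonneg _ h'.right
      have e6 : d (K0.of A) ≤ d (K0.of A') := by
        refine le_of_mul_le_mul_left ?_ hN
        rw [hr, hr']
        exact_mod_cast hle
      -- By minimality `A'` has the rank of `A`, so `A / A'` has rank `0` and nonnegative degree:
      -- the slope of `A'` cannot be larger.
      have e7 : d (K0.of B') = 0 := by linarith
      have e8 := h.degree_nonneg _ h'.right e7
      rw [show d (K0.of A') = d (K0.of A) by linarith] at hlt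
      have := lt_of_mul_lt_mul_right hlt hdA.le
      linarith
    have e1 := hs.map_eq d
    have e2 := hs.map_eq n
    have e3 := h.rank_nonneg _ hs.right
    have hdB : 0 < d (K0.of B) := by
      refine lt_of_le_of_ne e3 fun h0 => ?_
      have e4 := h.degree_nonneg _ hs.right h0.symm
      have e5 : d (K0.of E) = d (K0.of A) := by linarith
      rw [e5] at hA
      have := lt_of_mul_lt_mul_right hA hdA.le
      linarith
    obtain ⟨m', hm'⟩ := h.exists_nat hN hdisc hs.right
    have hlt : m' < m := by
      have : (m' : ℝ) < m := by
        rw [← hm', ← hm]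
        exact mul_lt_mul_of_pos_left (by linarith) hN
      exact_mod_cast this
    obtain ⟨Q, hQ⟩ := ih m' hlt hs.right hdB hm'
    refine ⟨Q, h.isMinimalQuotient_of_quotient hs hQ fun J I j p hjp => ?_⟩
    -- Compare `Q` with the trivial quotient `B` of `B`. The chain of slopes is `μ(Q) ≤ μ(B) ≤ μ(A)
    -- ≤ μ(I)`, cleared of denominators.
    have e4 := hQ.2.2 _ _ _ _ (Ses.id_right hs.right (heart_zero (isZero_zero D)) (isZero_zero D))
    have e5 := hjp.map_eq d
    have e6 := hjp.map_eq n
    have e7 := hAss _ _ _ _ hjp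
    have e8 := h.rank_nonneg _ hjp.right
    have hdQ := hQ.2.1
    have e9 : n (K0.of A) * d (K0.of I) ≤ n (K0.of I) * d (K0.of A) := by
      have e10 : n (K0.of I) = n (K0.of A) - n (K0.of J) := by linarith
      have e11 : d (K0.of I) = d (K0.of A) - d (K0.of J) := by linarith
      rw [e10, e11]
      linarith
    have e12 : n (K0.of B) * d (K0.of A) ≤ n (K0.of A) * d (K0.of B) := by
      rw [e1, e2] at hA
      linarith
    have e13 : n (K0.of Q) * d (K0.of A) ≤ n (K0.of A) * d (K0.of Q) := by
      refine le_of_mul_le_mul_right ?_ hdB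
      have a1 := mul_le_mul_of_nonneg_right e4 hdA.le
      have a2 := mul_le_mul_of_nonneg_right e12 hdQ.le
      linarith
    refine le_of_mul_le_mul_right ?_ hdA
    have a1 := mul_le_mul_of_nonneg_right e13 e8
    have a2 := mul_le_mul_of_nonneg_right e9 hdQ.le
    linarith

/-- Existence of Harder-Narasimhan filtrations. -/
theorem exists_filtered {E : D} (hE : IsTorsionFree t d E) :
    ∃ a, Filtered (SemistableOfSlope t d n) a E := by
  obtain ⟨N, hN, hdisc⟩ := h.discrete
  obtain ⟨m, hm⟩ := h.exists_nat hN hdisc hE.1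
  induction m using Nat.strong_induction_on generalizing E with
  | _ m ih =>
  by_cases h0 : IsZero E
  · exact ⟨0, Filtered.zero _ _ h0⟩
  have hd := hE.rank_pos h h0
  -- Among the minimal quotients one of largest rank is wanted; `r` is `N` times the rank of the
  -- kernel. It will be the last factor of the filtration.
  have hex : ∃ r : ℕ, ∃ Q, IsMinimalQuotient t d n E Q ∧ N * d (K0.of Q) + r = N * d (K0.of E) := by
    obtain ⟨Q, hQ⟩ := h.exists_isMinimalQuotient hE.1 hd
    obtain ⟨K, k, q, hq⟩ := hQ.1
    obtain ⟨r, hr⟩ := h.exists_nat hN hdisc hq.left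
    exact ⟨r, Q, hQ, by rw [hq.map_eq d, ← hr]; ring⟩
  classical
  obtain ⟨Q₀, hQ₀, hr⟩ := Nat.find_spec hex
  have hmax : ∀ Q, IsMinimalQuotient t d n E Q → d (K0.of Q) ≤ d (K0.of Q₀) := by
    intro Q hQ
    by_contra! hlt
    obtain ⟨K, k, q, hq⟩ := hQ.1
    obtain ⟨r, hr'⟩ := h.exists_nat hN hdisc hq.left
    refine Nat.find_min hex (m := r) ?_ ⟨Q, hQ, by rw [hq.map_eq d, ← hr']; ring⟩
    have e1 := hq.map_eq d
    have : (r : ℝ) < Nat.find hex := by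
      rw [← hr']
      have := mul_lt_mul_of_pos_left hlt hN
      have e2 : N * d (K0.of E) = N * d (K0.of K) + N * d (K0.of Q) := by rw [e1, mul_add]
      linarith
    exact_mod_cast this
  -- the torsion-free quotient of `Q₀` is still minimal
  obtain ⟨Q, hQ, hQtf, hdQ⟩ : ∃ Q, IsMinimalQuotient t d n E Q ∧ IsTorsionFree t d Q ∧
      d (K0.of Q) = d (K0.of Q₀) := by
    obtain ⟨T, Q, i, p, hs, hT, hQ⟩ := h.torsion Q₀ (by
      obtain ⟨K, k, q, hq⟩ := hQ₀.1
      exact hq.right)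
    obtain ⟨⟨K, k, q, hq⟩, h1, h2⟩ := hQ₀
    obtain ⟨C, c, _, _, h3, -⟩ := hq.comp_epi hs
    have e1 := hs.map_eq d
    have e2 := hs.map_eq n
    have e3 := h.degree_nonneg _ hs.left hT
    have e4 : d (K0.of Q) = d (K0.of Q₀) := by rw [e1, hT, zero_add]
    refine ⟨Q, ⟨⟨C, c, _, h3⟩, by rwa [e4], fun K' Q' k' q' h' => ?_⟩, hQ, e4⟩
    have e5 := h2 _ _ _ _ h'
    have e6 := h.rank_nonneg _ h'.right
    rw [e4]
    refine le_trans ?_ e5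
    exact mul_le_mul_of_nonneg_right (by linarith) e6
  obtain ⟨⟨K, k, q, hq⟩, hdQ0, hmin⟩ := hQ
  have hQss : IsSemistable t d n Q := by
    refine ⟨hQtf, fun h0 => ?_, fun A B f g hs => ?_⟩
    · rw [K0.of_isZero h0, map_zero] at hdQ0
      exact lt_irrefl _ hdQ0
    · obtain ⟨C, c, _, _, h3, -⟩ := hq.comp_epi hs
      have e1 := hmin _ _ _ _ h3
      have e2 := hs.map_eq d
      have e3 := hs.map_eq n
      have e4 : n (K0.of B) = n (K0.of Q) - n (K0.of A) := by linarith
      have e5 : d (K0.of B) = d (K0.of Q) - d (K0.of A) := by linarith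
      rw [e4, e5] at e1
      linarith
  obtain ⟨m', hm'⟩ := h.exists_nat hN hdisc hq.left
  have hlt : m' < m := by
    have : (m' : ℝ) < m := by
      have := hq.map_eq d
      rw [← hm', ← hm]
      exact mul_lt_mul_of_pos_left (by linarith) hN
    exact_mod_cast this
  obtain ⟨a, ha⟩ := ih m' hlt (hE.of_sub hq) hm'
  set b := n (K0.of Q) / d (K0.of Q) with hb
  have hbQ : n (K0.of Q) = b * d (K0.of Q) := by rw [hb, div_mul_cancel₀ _ hdQ0.ne']
  -- The outer bound only has to lie below the last slope `b`. The point is that all slopes in the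
  -- filtration of the kernel exceed `b`.
  refine ⟨b - 1, Filtered.snoc (b := b) ?_ hq.tri ⟨hQss, hbQ⟩ hQss.2.1 (by linarith)⟩
  have hheart : ∀ {c : ℝ} {X : D}, Filtered (SemistableOfSlope t d n) c X → t.heart X :=
    fun hX => hX.prop (fun _ hX => heart_zero hX) (fun b _ B hB => hB.1.1.1) heart_ext
  cases ha with
  | zero _ _ h0 => exact Filtered.zero _ _ h0
  | @snoc _ c K' _ B f g h1 h2 h3 h4 h5 =>
    refine Filtered.snoc h1 h2 h3 h4 ?_
    have hs : Ses t.heart f g := ⟨hheart h1, hq.left, h3.1.1.1, h2⟩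
    obtain ⟨C, c', x, y, h6, h7⟩ := hs.comp_mono hq
    have hdB := h3.1.1.rank_pos h h4
    have e1 := hmin _ _ _ _ h6
    have e2 := h7.map_eq d
    have e3 := h7.map_eq n
    have e4 := h3.2
    -- If the last slope `c` of the kernel were at most `b`, the extension `C` of `Q` by `B` would
    -- be a minimal quotient of larger rank than `Q`.
    by_contra! hcb
    have e5 : n (K0.of B) * d (K0.of Q) ≤ n (K0.of Q) * d (K0.of B) := by
      rw [e4, hbQ]
      have := mul_le_mul_of_nonneg_right hcb (mul_pos hdB hdQ0).le
      linarith
    have hC : IsMinimalQuotient t d n E C := by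
      refine ⟨⟨_, _, _, h6⟩, by linarith, fun K₁ Q₁ k₁ q₁ h₁ => ?_⟩
      have e6 := hmin _ _ _ _ h₁
      have e7 := h.rank_nonneg _ h₁.right
      have e8 : n (K0.of C) * d (K0.of Q) ≤ n (K0.of Q) * d (K0.of C) := by
        rw [e2, e3]
        linarith
      refine le_of_mul_le_mul_right ?_ hdQ0
      have a1 := mul_le_mul_of_nonneg_right e8 e7
      have a2 := mul_le_mul_of_nonneg_right e6 (show 0 ≤ d (K0.of C) by linarith)
      linarith
    have := hmax C hC
    linarith

/-- A nonzero image would have slope at least `b` as a quotient of `X` and at most `c` as a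
subobject of `Y`; its rank is positive because `Y` is torsion-free. -/
theorem homZero_of_slope_lt {b c : ℝ} (hbc : c < b) {X Y : D} (hX : SemistableOfSlope t d n b X)
    (hY : SemistableOfSlope t d n c Y) : HomZero X Y := by
  intro f
  obtain ⟨K, I, Q, k, p, i, q, h1, h2, h3⟩ := Ses.exists_image hX.1.1.1 hY.1.1.1 f
  by_cases hI : IsZero I
  · rw [← h3, hI.eq_of_tgt p 0, zero_comp]
  exfalso
  have hdI := (hY.1.1.of_sub h2).rank_pos h hI
  have hdX := hX.1.1.rank_pos h hX.1.2.1
  have hdY := hY.1.1.rank_pos h hY.1.2.1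
  have e1 := hX.1.2.2 _ _ _ _ h1
  have e2 := hY.1.2.2 _ _ _ _ h2
  have e3 := h1.map_eq d
  have e4 := h1.map_eq n
  have e5 : n (K0.of K) = n (K0.of X) - n (K0.of I) := by linarith
  have e6 : d (K0.of K) = d (K0.of X) - d (K0.of I) := by linarith
  rw [e5, e6, hX.2] at e1
  rw [hY.2] at e2
  have a1 : b * d (K0.of I) ≤ n (K0.of I) := by
    refine le_of_mul_le_mul_right ?_ hdX
    linarith
  have a2 : n (K0.of I) ≤ c * d (K0.of I) := by
    refine le_of_mul_le_mul_right ?_ hdY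
    linarith
  have := mul_lt_mul_of_pos_right hbc hdI
  linarith

end IsSlopeData

end Slopes

/-! ### Slicings: intervals of phases, truncation and the heart -/

section Slicings

variable {D : Type u} [Category.{v} D] [Preadditive D] [HasZeroObject D] [HasShift D ℤ]
  [∀ n : ℤ, (shiftFunctor D n).Additive] [Pretriangulated D]

namespace ExtensionClosure

variable {P : ObjectProperty D}

theorem of_tri {X Y Z : D} {f : X ⟶ Y} {g : Y ⟶ Z} (h : Tri f g) (hX : ExtensionClosure P X)
    (hZ : ExtensionClosure P Z) : ExtensionClosure P Y := by
  obtain ⟨w, hw⟩ := h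
  exact ext f g w hw hX hZ

theorem of_iso {X Y : D} (e : X ≅ Y) (h : ExtensionClosure P X) : ExtensionClosure P Y :=
  of_tri (Tri.of_isIso₁ e.hom (isZero_zero D)) h (zero _ (isZero_zero D))

theorem prop {Q : ObjectProperty D} {X : D} (h : ExtensionClosure P X) (h0 : ∀ X, IsZero X → Q X)
    (hP : ∀ X, P X → Q X)
    (hext : ∀ {X Y Z : D} {f : X ⟶ Y} {g : Y ⟶ Z}, Tri f g → Q X → Q Z → Q Y) : Q X := by
  induction h with
  | zero X h => exact h0 X h
  | of X h => exact hP X h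
  | ext f g w hw _ _ h1 h3 => exact hext ⟨w, hw⟩ h1 h3

theorem mono {P' : ObjectProperty D} {X : D} (h : ExtensionClosure P X) (hP : ∀ X, P X → P' X) :
    ExtensionClosure P' X :=
  h.prop zero (fun X hX => of X (hP X hX)) of_tri

theorem homZero_left {X Y : D} (h : ExtensionClosure P X) (hP : ∀ X, P X → HomZero X Y) :
    HomZero X Y :=
  h.prop (Q := fun X => HomZero X Y) (fun _ h => HomZero.of_isZero_left h) hP
    fun hT h1 h3 => hT.homZero_left h1 h3

theorem homZero_right {X Y : D} (h : ExtensionClosure P Y) (hP : ∀ Y, P Y → HomZero X Y) :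
    HomZero X Y :=
  h.prop (Q := fun Y => HomZero X Y) (fun _ h => HomZero.of_isZero_right h) hP
    fun hT h1 h3 => hT.homZero_right h1 h3

theorem shift {n : ℤ} {P' : ObjectProperty D} {X : D} (h : ExtensionClosure P X)
    (hP : ∀ X, P X → P' (X⟦n⟧)) : ExtensionClosure P' (X⟦n⟧) :=
  h.prop (Q := fun X => ExtensionClosure P' (X⟦n⟧))
    (fun _ h => zero _ ((shiftFunctor D n).map_isZero h)) (fun _ hX => of _ (hP _ hX))
    fun hT h1 h3 => of_tri (hT.shift n) h1 h3

end ExtensionClosure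

theorem Filtered.extensionClosure {P : ℝ → ObjectProperty D} {Q : ObjectProperty D} {a : ℝ} {E : D}
    (h : Filtered P a E) (hQ : ∀ b, a < b → ∀ X, P b X → Q X) : ExtensionClosure Q E :=
  h.prop ExtensionClosure.zero (fun b hb X hX => ExtensionClosure.of X (hQ b hb X hX))
    ExtensionClosure.of_tri

/-- Cutting a filtration at an upper set of phases. -/
theorem Filtered.split [IsTriangulated D] {P : ℝ → ObjectProperty D} {a : ℝ} {E : D}
    (h : Filtered P a E) {S : Set ℝ} (hS : IsUpperSet S) :
    ∃ (X Y : D) (f : X ⟶ E) (g : E ⟶ Y), Tri f g ∧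
      Filtered (fun φ X => P φ X ∧ φ ∈ S) a X ∧ Filtered (fun φ X => P φ X ∧ φ ∈ Sᶜ) a Y := by
  induction h with
  | zero a E hE =>
    exact ⟨E, _, 𝟙 E, 0, Tri.id_zero _ hE, .zero _ _ hE, .zero _ _ hE⟩
  | @snoc a b K E B f g h1 h2 h3 h4 h5 ih =>
    by_cases hb : b ∈ S
    · refine ⟨E, _, 𝟙 E, 0, Tri.id_zero _ (isZero_zero D), ?_, .zero _ _ (isZero_zero D)⟩
      exact .snoc (h1.imp (fun c hc X hX => ⟨hX, hS hc.le hb⟩) le_rfl) h2 ⟨h3, hb⟩ h4 h5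
    · obtain ⟨X, Y, k, l, hT, hX, hY⟩ := ih
      obtain ⟨C, k', x, y, h6, h7, -, -⟩ := hT.comp_left h2
      exact ⟨X, C, _, _, h6, hX.mono h5.le, .snoc hY h7 ⟨h3, hb⟩ h4 h5⟩

namespace StabilityCondition

variable (σ : StabilityCondition D)

theorem exists_filtered (E : D) : ∃ a, Filtered σ.P a E := by
  obtain ⟨n, F, A, φ, hF, hφ, hA⟩ := σ.exists_hn E
  obtain ⟨a, ha⟩ := (Set.finite_range φ).bddBelow
  exact ⟨a - 1, Filtered.of_isFiltration hF hφ hA fun i =>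
    (sub_one_lt a).trans_le (ha (Set.mem_range_self i))⟩

theorem interval_of {I : Set ℝ} {φ : ℝ} (hφ : φ ∈ I) {E : D} (hE : σ.P φ E) : σ.interval I E :=
  .of _ ⟨φ, hφ, hE⟩

theorem interval_mono {I J : Set ℝ} (h : I ⊆ J) {E : D} (hE : σ.interval I E) : σ.interval J E :=
  hE.mono fun _ ⟨φ, hφ, hX⟩ => ⟨φ, h hφ, hX⟩

theorem interval_homZero {I J : Set ℝ} (h : ∀ φ ∈ I, ∀ ψ ∈ J, ψ < φ) {E F : D}
    (hE : σ.interval I E) (hF : σ.interval J F) : HomZero E F :=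
  hE.homZero_left fun X ⟨φ, hφ, hX⟩ => hF.homZero_right fun Y ⟨ψ, hψ, hY⟩ =>
    σ.hom_eq_zero φ ψ (h φ hφ ψ hψ) X Y hX hY

theorem interval_isClosedUnderIsomorphisms (I : Set ℝ) :
    (σ.interval I).IsClosedUnderIsomorphisms :=
  ⟨fun e h => ExtensionClosure.of_iso e h⟩

theorem P_shift_neg_one {φ : ℝ} {E : D} (h : σ.P φ E) : σ.P (φ - 1) (E⟦(-1 : ℤ)⟧) := by
  rw [σ.shift_iff, sub_add_cancel]
  have := σ.isClosedUnderIso φ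
  exact (σ.P φ).prop_of_iso (shiftNegShift E (1 : ℤ)).symm h

theorem interval_shift_one {I J : Set ℝ} (h : ∀ φ ∈ I, φ + 1 ∈ J) {E : D} (hE : σ.interval I E) :
    σ.interval J (E⟦(1 : ℤ)⟧) :=
  hE.shift fun _ ⟨φ, hφ, hX⟩ => ⟨φ + 1, h φ hφ, (σ.shift_iff φ _).1 hX⟩

theorem interval_shift_neg_one {I J : Set ℝ} (h : ∀ φ ∈ I, φ - 1 ∈ J) {E : D}
    (hE : σ.interval I E) : σ.interval J (E⟦(-1 : ℤ)⟧) :=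
  hE.shift fun _ ⟨φ, hφ, hX⟩ => ⟨φ - 1, h φ hφ, σ.P_shift_neg_one hX⟩

theorem interval_of_shift_neg_one {I J : Set ℝ} (h : ∀ φ ∈ I, φ + 1 ∈ J) {E : D}
    (hE : σ.interval I (E⟦(-1 : ℤ)⟧)) : σ.interval J E :=
  (σ.interval_shift_one h hE).of_iso (shiftNegShift E (1 : ℤ))

/-- The source of the sign and norm estimates on charges: extensions do not leave a set closed under
addition. Zero objects are set aside because `C` need not contain `0`. -/
theorem charge_mem_of_interval {C : Set ℂ} (hadd : ∀ x ∈ C, ∀ y ∈ C, x + y ∈ C) {I : Set ℝ}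
    (hI : ∀ φ ∈ I, ∀ m : ℝ, 0 < m → m * Complex.exp (Real.pi * φ * Complex.I) ∈ C) {E : D}
    (hE : σ.interval I E) (h0 : ¬ IsZero E) : σ.charge E ∈ C := by
  have H : IsZero E ∨ σ.charge E ∈ C := by
    refine hE.prop (Q := fun E => IsZero E ∨ σ.charge E ∈ C) (fun X h => Or.inl h) ?_ ?_
    · rintro X ⟨φ, hφ, hX⟩
      by_cases h : IsZero X
      · exact Or.inl h
      · obtain ⟨m, hm, hZ⟩ := σ.charge_mem φ X hX h
        right
        rw [charge, hZ]
        exact hI φ hφ m hm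
    · intro X Y Z f g hT hX hZ
      have e : σ.charge Y = σ.charge X + σ.charge Z := by
        rw [charge, K0.of_tri hT, map_add]
        rfl
      rcases hX with hX | hX
      · rcases hZ with hZ | hZ
        · exact Or.inl (hT.isZero₂ hX hZ)
        · right
          rw [e, charge, K0.of_isZero hX, map_zero, zero_add]
          exact hZ
      · rcases hZ with hZ | hZ
        · right
          rw [e, show σ.charge Z = σ.Z (K0.of Z) from rfl, K0.of_isZero hZ, map_zero, add_zero]
          exact hX
        · right
          rw [e]
          exact hadd _ hX _ hZ
  exact H.resolve_left h0

variable [IsTriangulated D]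

theorem isCut {S : Set ℝ} (hS : IsUpperSet S) : IsCut (σ.interval S) (σ.interval Sᶜ) where
  isoU := σ.interval_isClosedUnderIsomorphisms _
  isoV := σ.interval_isClosedUnderIsomorphisms _
  hom _ _ hX hY := σ.interval_homZero (fun φ hφ ψ hψ => by
    by_contra! h
    exact hψ (hS h hφ)) hX hY
  shiftU _ hX := σ.interval_shift_one (fun φ hφ => hS (by linarith) hφ) hX
  shiftV _ hX := σ.interval_shift_neg_one (I := Sᶜ) (J := Sᶜ) (fun φ hφ h => hφ (hS (by linarith) h)) hX
  tri E := by
    obtain ⟨a, ha⟩ := σ.exists_filtered E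
    obtain ⟨X, Y, f, g, hT, hX, hY⟩ := ha.split hS
    exact extensionProduct_of_tri hT (hX.extensionClosure fun φ _ _ h => ⟨φ, h.2, h.1⟩)
      (hY.extensionClosure fun φ _ _ h => ⟨φ, h.2, h.1⟩)

/-- The phases of an object of `P(S)` lie in `S`. -/
theorem exists_filtered_of_interval {S : Set ℝ} (hS : IsUpperSet S) {E : D}
    (hE : σ.interval S E) : ∃ a, Filtered (fun φ X => σ.P φ X ∧ φ ∈ S) a E := by
  obtain ⟨a, ha⟩ := σ.exists_filtered E
  refine ⟨a, ?_⟩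
  cases ha with
  | zero _ _ h => exact .zero _ _ h
  | @snoc a b K _ B f g h1 h2 h3 h4 h5 =>
    -- If `b ∉ S`, all phases in `S` exceed `b`, so `E ⟶ B` is zero. As `K⟦1⟧` has phases above `b +
    -- 1`, this makes `B` zero.
    have hb : b ∈ S := by
      by_contra hb
      have hB : σ.interval {b} B := σ.interval_of (Set.mem_singleton b) h3
      have hg : g = 0 := σ.interval_homZero (fun φ hφ ψ hψ => by
        obtain rfl : ψ = b := hψ
        by_contra! h
        exact hb (hS h hφ)) hE hB g
      have hK : σ.interval (Set.Ioi b) K := h1.extensionClosure fun c hc X hX => ⟨c, hc, hX⟩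
      refine h4 (h2.isZero_of_eq_zero₂ hg (σ.interval_homZero (I := Set.Ioi (b + 1)) ?_
        (σ.interval_shift_one (fun φ (hφ : b < φ) => Set.mem_Ioi.2 (by linarith)) hK) hB))
      rintro φ hφ ψ rfl
      exact (lt_add_one ψ).trans hφ
    exact .snoc (h1.imp (fun c hc X hX => ⟨hX, hS hc.le hb⟩) le_rfl) h2 ⟨h3, hb⟩ h4 h5

/-- Since `P(I)` is an extension closure, this is not formal. It holds because the Harder-Narasimhan
phases of an object of `P(S)` lie in `S`, so that truncating at `T` leaves phases in `S \ T` only.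
-/
theorem interval_inter {S T : Set ℝ} (hS : IsUpperSet S) (hT : IsUpperSet T) {E : D}
    (h₁ : σ.interval S E) (h₂ : σ.interval Tᶜ E) : σ.interval (S ∩ Tᶜ) E := by
  obtain ⟨a, ha⟩ := σ.exists_filtered_of_interval hS h₁
  obtain ⟨X, Y, f, g, hT', hX, hY⟩ := ha.split hT
  have hX' : σ.interval T X := hX.extensionClosure fun φ _ _ h => ⟨φ, h.2, h.1.1⟩
  have hY' : σ.interval Tᶜ Y := hY.extensionClosure fun φ _ _ h => ⟨φ, h.2, h.1.1⟩
  have hY'' : σ.interval (S ∩ Tᶜ) Y :=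
    hY.extensionClosure fun φ _ _ h => ⟨φ, ⟨h.1.2, h.2⟩, h.1.1⟩
  have hcut := σ.isCut hT
  have : IsZero X := hT'.isZero_of_eq_zero₁ (hcut.hom _ _ hX' h₂ f)
    (hcut.hom _ _ (hcut.shiftU _ hX') hY')
  have := hT'.isIso₂ this
  exact hY''.of_iso (asIso g).symm

theorem isCut_Ioi (a : ℝ) : IsCut (σ.interval (Set.Ioi a)) (σ.interval (Set.Iic a)) := by
  simpa using σ.isCut (isUpperSet_Ioi a)

theorem isCut_Ici (a : ℝ) : IsCut (σ.interval (Set.Ici a)) (σ.interval (Set.Iio a)) := by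
  simpa using σ.isCut (isUpperSet_Ici a)

theorem interval_Ioc {a b : ℝ} {E : D} (h₁ : σ.interval (Set.Ioi a) E)
    (h₂ : σ.interval (Set.Iic b) E) : σ.interval (Set.Ioc a b) E := by
  have := σ.interval_inter (isUpperSet_Ioi a) (isUpperSet_Ioi b) h₁ (by simpa using h₂)
  simpa [Set.Ioi_inter_Iic] using this

theorem interval_Ioo {a b : ℝ} {E : D} (h₁ : σ.interval (Set.Ioi a) E)
    (h₂ : σ.interval (Set.Iio b) E) : σ.interval (Set.Ioo a b) E := by
  have := σ.interval_inter (isUpperSet_Ioi a) (isUpperSet_Ici b) h₁ (by simpa using h₂)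
  simpa [Set.Ioi_inter_Iio] using this

theorem interval_Icc {a b : ℝ} {E : D} (h₁ : σ.interval (Set.Ici a) E)
    (h₂ : σ.interval (Set.Iic b) E) : σ.interval (Set.Icc a b) E := by
  have := σ.interval_inter (isUpperSet_Ici a) (isUpperSet_Ioi b) h₁ (by simpa using h₂)
  simpa [Set.Ici_inter_Iic] using this

/-- The t-structure with heart `P(0, 1]`. -/
def tStructure : Triangulated.TStructure D := (σ.isCut_Ioi 0).toTStructure

theorem heart_iff (E : D) :
    σ.heart E ↔ σ.interval (Set.Ioi 0) E ∧ σ.interval (Set.Iic 0) (E⟦(-1 : ℤ)⟧) := by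
  constructor
  · intro h
    exact ⟨σ.interval_mono Set.Ioc_subset_Ioi_self h,
      σ.interval_shift_neg_one (fun φ hφ => by simpa using hφ.2) h⟩
  · rintro ⟨h₁, h₂⟩
    exact σ.interval_Ioc h₁ (σ.interval_of_shift_neg_one (fun φ (hφ : φ ≤ 0) => by
      simpa using hφ) h₂)

theorem tStructure_heart : σ.tStructure.heart = σ.heart := by
  ext E
  rw [σ.heart_iff]
  exact (σ.isCut_Ioi 0).toTStructure_heart E

theorem interval_shift_nat {I J : Set ℝ} (n : ℕ) (h : ∀ φ ∈ I, φ + n ∈ J) {E : D}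
    (hE : σ.interval I E) : σ.interval J (E⟦(n : ℤ)⟧) := by
  induction n generalizing J with
  | zero =>
    refine ExtensionClosure.of_iso ((shiftFunctorZero D ℤ).symm.app E) ?_
    exact σ.interval_mono (fun φ hφ => by simpa using h φ hφ) hE
  | succ n ih =>
    have h1 := ih (J := {ψ | ψ + 1 ∈ J}) (fun φ hφ => by
      have := h φ hφ
      push_cast at this
      rwa [← add_assoc] at this)
    exact ExtensionClosure.of_iso ((shiftFunctorAdd' D (n : ℤ) 1 ((n + 1 : ℕ) : ℤ) (by simp)).symm.app E)
      (σ.interval_shift_one (fun φ hφ => hφ) h1)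

theorem interval_shift_neg_nat {I J : Set ℝ} (n : ℕ) (h : ∀ φ ∈ I, φ - n ∈ J) {E : D}
    (hE : σ.interval I E) : σ.interval J (E⟦(-n : ℤ)⟧) := by
  induction n generalizing J with
  | zero =>
    have h0 : σ.interval J (E⟦(0 : ℤ)⟧) :=
      ExtensionClosure.of_iso ((shiftFunctorZero D ℤ).symm.app E)
        (σ.interval_mono (fun φ hφ => by simpa using h φ hφ) hE)
    simpa using h0
  | succ n ih =>
    have h1 := ih (J := {ψ | ψ - 1 ∈ J}) (fun φ hφ => by
      have := h φ hφ
      push_cast at this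
      rwa [← sub_sub] at this)
    exact ExtensionClosure.of_iso
      ((shiftFunctorAdd' D (-n : ℤ) (-1) (-(n + 1 : ℕ) : ℤ) (by push_cast; ring)).symm.app E)
      (σ.interval_shift_neg_one (fun φ hφ => hφ) h1)

theorem exists_shift_mem_le (E : D) : ∃ n : ℕ, σ.interval (Set.Ioi 0) (E⟦(n : ℤ)⟧) := by
  obtain ⟨a, ha⟩ := σ.exists_filtered E
  obtain ⟨n, hn⟩ := exists_nat_gt (-a)
  have hE : σ.interval (Set.Ioi a) E := ha.extensionClosure fun c hc X hX => ⟨c, hc, hX⟩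
  exact ⟨n, σ.interval_shift_nat n (fun φ (hφ : a < φ) => by
    change 0 < φ + n
    linarith) hE⟩

theorem exists_shift_mem_ge (E : D) : ∃ n : ℕ, σ.interval (Set.Iic 0) (E⟦-(n : ℤ)⟧) := by
  obtain ⟨m, F, A, φ, hF, hφ, hA⟩ := σ.exists_hn E
  obtain ⟨b, hb⟩ := (Set.finite_range φ).bddAbove
  obtain ⟨n, hn⟩ := exists_nat_gt b
  obtain ⟨a, ha⟩ := (Set.finite_range φ).bddBelow
  have hf : Filtered (fun φ X => σ.P φ X ∧ φ ≤ b) (a - 1) E :=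
    Filtered.of_isFiltration hF hφ (fun i => ⟨⟨(hA i).1, hb (Set.mem_range_self i)⟩, (hA i).2⟩)
      fun i => (sub_one_lt a).trans_le (ha (Set.mem_range_self i))
  have hE : σ.interval (Set.Iic b) E := hf.extensionClosure fun c _ X hX => ⟨c, hX.2, hX.1⟩
  exact ⟨n, σ.interval_shift_neg_nat n (fun φ (hφ : φ ≤ b) => by
    change φ - n ≤ 0
    linarith) hE⟩

theorem im_charge_pos_of_free {E : D} (hE : σ.free E) (h0 : ¬ IsZero E) : 0 < (σ.charge E).im := by
  refine σ.charge_mem_of_interval (C := {z | 0 < z.im})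
    (fun x (hx : 0 < x.im) y (hy : 0 < y.im) => ?_) ?_ hE h0
  · exact add_pos hx hy
  rintro φ ⟨h1, h2⟩ m hm
  have : (Real.pi * φ * Complex.I : ℂ) = ((Real.pi * φ : ℝ) : ℂ) * Complex.I := by push_cast; ring
  change 0 < Complex.im _
  rw [this, Complex.im_ofReal_mul, Complex.exp_ofReal_mul_I_im]
  exact mul_pos hm (Real.sin_pos_of_pos_of_lt_pi (mul_pos Real.pi_pos h1)
    (by nlinarith [Real.pi_pos]))

theorem charge_neg_of_phase_one {E : D} (hE : σ.interval (Set.Icc 1 1) E) (h0 : ¬ IsZero E) :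
    (σ.charge E).im = 0 ∧ (σ.charge E).re < 0 := by
  refine σ.charge_mem_of_interval (C := {z | z.im = 0 ∧ z.re < 0})
    (fun x hx y hy => ⟨by simp [hx.1, hy.1], add_neg hx.2 hy.2⟩) ?_ hE h0
  intro φ hφ m hm
  obtain rfl : φ = 1 := by simpa using hφ
  simp [hm]

/-- An object of the heart is an extension of an object of `P(0, 1)` by one of `P(1)`. -/
theorem exists_tri_of_heart {E : D} (hE : σ.heart E) : ∃ (X Y : D) (f : X ⟶ E) (g : E ⟶ Y),
    Tri f g ∧ σ.interval (Set.Icc 1 1) X ∧ σ.free Y := by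
  obtain ⟨X, Y, f, g, hT, hX, hY⟩ := (σ.isCut_Ici 1).exists_tri E
  have h1 : σ.interval (Set.Iic 1) E := σ.interval_mono Set.Ioc_subset_Iic_self hE
  have h2 : σ.interval (Set.Ioi 0) E := σ.interval_mono Set.Ioc_subset_Ioi_self hE
  refine ⟨X, Y, f, g, hT, σ.interval_Icc hX ?_, σ.interval_Ioo ?_ hY⟩
  · exact (σ.isCut_Ioi 1).V_fiber hT h1 (σ.interval_mono Set.Iio_subset_Iic_self hY)
  · refine (σ.isCut_Ioi 0).U_cone hT (σ.interval_mono ?_ hX) h2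
    exact fun φ (hφ : 1 ≤ φ) => one_pos.trans_le hφ

theorem charge_of_tri {X Y Z : D} {f : X ⟶ Y} {g : Y ⟶ Z} (h : Tri f g) :
    σ.charge Y = σ.charge X + σ.charge Z := by
  rw [charge, K0.of_tri h, map_add]
  rfl

theorem charge_of_isZero {X : D} (h : IsZero X) : σ.charge X = 0 := by
  rw [charge, K0.of_isZero h, map_zero]

theorem im_charge_of_phase_one {E : D} (hE : σ.interval (Set.Icc 1 1) E) :
    (σ.charge E).im = 0 := by
  by_cases h0 : IsZero E
  · simp [σ.charge_of_isZero h0]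
  · exact (σ.charge_neg_of_phase_one hE h0).1

theorem im_charge_nonneg {E : D} (hE : σ.heart E) : 0 ≤ (σ.charge E).im := by
  obtain ⟨X, Y, f, g, hT, hX, hY⟩ := σ.exists_tri_of_heart hE
  rw [σ.charge_of_tri hT, Complex.add_im, σ.im_charge_of_phase_one hX, zero_add]
  by_cases h0 : IsZero Y
  · simp [σ.charge_of_isZero h0]
  · exact (σ.im_charge_pos_of_free hY h0).le

/-- The quotient of an object of the heart in `P(0, 1)` has positive imaginary part unless it is
zero, and the part of phase `1` contributes nothing. -/
theorem torsion_iff (E : D) : σ.torsion E ↔ σ.interval (Set.Icc 1 1) E := by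
  constructor
  · rintro ⟨hE, h0⟩
    obtain ⟨X, Y, f, g, hT, hX, hY⟩ := σ.exists_tri_of_heart hE
    have hY0 : IsZero Y := by
      by_contra hY0
      have := σ.im_charge_pos_of_free hY hY0
      rw [σ.charge_of_tri hT, Complex.add_im, σ.im_charge_of_phase_one hX, zero_add] at h0
      exact this.ne' h0
    have := hT.isIso₁ hY0
    exact hX.of_iso (asIso f)
  · intro h
    exact ⟨σ.interval_mono (J := Set.Ioc 0 1) (fun φ hφ => ⟨one_pos.trans_le hφ.1, hφ.2⟩) h,
      σ.im_charge_of_phase_one h⟩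

theorem re_charge_nonpos_of_torsion {E : D} (hE : σ.torsion E) : (σ.charge E).re ≤ 0 := by
  by_cases h0 : IsZero E
  · simp [σ.charge_of_isZero h0]
  · exact (σ.charge_neg_of_phase_one ((σ.torsion_iff E).1 hE) h0).2.le

theorem isZero_of_torsion {E : D} (hE : σ.torsion E) (h : (σ.charge E).re = 0) : IsZero E := by
  by_contra h0
  exact (σ.charge_neg_of_phase_one ((σ.torsion_iff E).1 hE) h0).2.ne h

theorem heart_of_free {E : D} (hE : σ.free E) : σ.heart E :=
  σ.interval_mono Set.Ioo_subset_Ioc_self hE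

theorem heart_isClosedUnderIsomorphisms : σ.heart.IsClosedUnderIsomorphisms :=
  σ.interval_isClosedUnderIsomorphisms _

end StabilityCondition

end Slicings

/-! ### Tilting a t-structure at a torsion pair -/

section Tilting

variable {D : Type u} [Category.{v} D] [Preadditive D] [HasZeroObject D] [HasShift D ℤ]
  [∀ n : ℤ, (shiftFunctor D n).Additive] [Pretriangulated D]

/-- A torsion pair in the heart of a t-structure. -/
structure IsTorsionPair (t : Triangulated.TStructure D) (T F : ObjectProperty D) : Prop where
  isoT : T.IsClosedUnderIsomorphisms
  isoF : F.IsClosedUnderIsomorphisms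
  heartT : T ≤ t.heart
  heartF : F ≤ t.heart
  hom : ∀ X Y, T X → F Y → HomZero X Y
  tri : t.heart ≤ T.extensionProduct F

namespace IsTorsionPair

variable {t : Triangulated.TStructure D} {T F : ObjectProperty D} (h : IsTorsionPair t T F)
include h

theorem exists_ses {E : D} (hE : t.heart E) : ∃ (X Y : D) (f : X ⟶ E) (g : E ⟶ Y),
    Ses t.heart f g ∧ T X ∧ F Y := by
  obtain ⟨X, Y, f, g, hT, hX, hY⟩ := extensionProduct_iff_tri.1 (h.tri _ hE)
  exact ⟨X, Y, f, g, ⟨h.heartT _ hX, hE, h.heartF _ hY, hT⟩, hX, hY⟩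

theorem T_zero {X : D} (hX : IsZero X) : T X := by
  obtain ⟨A, B, f, g, hs, hA, -⟩ := h.exists_ses (heart_zero (t := t) hX)
  have := h.isoT
  exact T.prop_of_iso ((hs.isZero_left_of_mid hX).iso hX) hA

theorem F_zero {X : D} (hX : IsZero X) : F X := by
  obtain ⟨A, B, f, g, hs, -, hB⟩ := h.exists_ses (heart_zero (t := t) hX)
  have := h.isoF
  exact F.prop_of_iso ((hs.isZero_right_of_mid hX).iso hX) hB

theorem F_sub [IsTriangulated D] {X Y Z : D} {f : X ⟶ Y} {g : Y ⟶ Z} (hs : Ses t.heart f g)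
    (hY : F Y) : F X := by
  obtain ⟨A, B, a, b, hs', hA, hB⟩ := h.exists_ses hs.left
  have h0 : a = 0 := hs.eq_zero_of_comp hs'.left a (h.hom _ _ hA hY _)
  have := hs'.tri.isIso₂ (hs'.isZero_left h0)
  have := h.isoF
  exact F.prop_of_iso (asIso b).symm hB

theorem le_of_tilt {X : D} (hX : (t.le (-1)).extensionProduct T X) : t.le 0 X := by
  obtain ⟨A, B, f, g, hT, hA, hB⟩ := extensionProduct_iff_tri.1 hX
  exact le_ext hT (t.le_monotone (by omega) _ hA) (h.heartT _ hB).1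

theorem ge_of_tilt {X : D} (hX : F.extensionProduct (t.ge 1) X) : t.ge 0 X := by
  obtain ⟨A, B, f, g, hT, hA, hB⟩ := extensionProduct_iff_tri.1 hX
  exact ge_ext hT (h.heartF _ hA).2 (t.ge_antitone (by omega) _ hB)

theorem tilt_of_le {X : D} (hX : t.le (-1) X) : (t.le (-1)).extensionProduct T X :=
  extensionProduct_of_tri (Tri.id_zero X (isZero_zero D)) hX (h.T_zero (isZero_zero D))

theorem tilt_of_ge {X : D} (hX : t.ge 1 X) : F.extensionProduct (t.ge 1) X :=
  extensionProduct_of_tri (Tri.zero_id X (isZero_zero D)) (h.F_zero (isZero_zero D)) hX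

theorem tilt_of_T {X : D} (hX : T X) : (t.le (-1)).extensionProduct T X :=
  extensionProduct_of_tri (Tri.zero_id X (isZero_zero D))
    ((isCut_of_tStructure t (-1)).U_zero (isZero_zero D)) hX

theorem tilt_of_F {X : D} (hX : F X) : F.extensionProduct (t.ge 1) X :=
  extensionProduct_of_tri (Tri.id_zero X (isZero_zero D)) hX
    ((isCut_of_tStructure t 0).V_zero (isZero_zero D))

variable [IsTriangulated D]

/-- The tilt of Happel, Reiten and Smalø. The whole category is `D^{≤ -1} ⋆ heart ⋆ D^{≥ 1}`, and
inserting `heart = T ⋆ F` and rebracketing gives the decomposition. -/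
theorem isCut_tilt :
    IsCut ((t.le (-1)).extensionProduct T) (F.extensionProduct (t.ge 1)) where
  isoU := inferInstance
  isoV := inferInstance
  hom X Y hX hY := by
    have hX0 := h.le_of_tilt hX
    have hY0 := h.ge_of_tilt hY
    obtain ⟨A, B, f, g, hT, hA, hB⟩ := extensionProduct_iff_tri.1 hX
    obtain ⟨A', B', f', g', hT', hA', hB'⟩ := extensionProduct_iff_tri.1 hY
    exact hT.homZero_left (hom_of_le_ge t hA hY0 (by omega))
      (hT'.homZero_right (h.hom _ _ hB hA') (hom_of_le_ge t (h.heartT _ hB).1 hB' (by omega)))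
  shiftU X hX := h.tilt_of_le (t.le_shift 0 1 (-1) (by omega) _ (h.le_of_tilt hX))
  shiftV X hX := h.tilt_of_ge (t.ge_shift 0 (-1) 1 (by omega) _ (h.ge_of_tilt hX))
  tri E := by
    have h1 := (isCut_of_tStructure t 0).tri E
    have h2 : t.le 0 ≤ (t.le (-1)).extensionProduct t.heart := by
      intro X hX
      obtain ⟨A, B, f, g, hT, hA, hB⟩ := (isCut_of_tStructure t (-1)).exists_tri X
      exact extensionProduct_of_tri hT hA
        ⟨le_cone hT (t.le_monotone (by omega) _ hA) hX, hB⟩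
    have h3 := extensionProduct_mono (h2.trans (extensionProduct_mono le_rfl h.tri)) le_rfl E h1
    rw [← ObjectProperty.extensionProduct_assoc, ObjectProperty.extensionProduct_assoc] at h3
    exact h3

/-- The tilted t-structure. -/
def tilt : Triangulated.TStructure D := h.isCut_tilt.toTStructure

theorem tilt_heart_iff (E : D) : h.tilt.heart E ↔
    ∃ (X Y : D) (f : X⟦(1 : ℤ)⟧ ⟶ E) (g : E ⟶ Y), Tri f g ∧ F X ∧ T Y := by
  rw [tilt, IsCut.toTStructure_heart]
  constructor
  · rintro ⟨h1, h2⟩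
    obtain ⟨A, B, f, g, hT, hA, hB⟩ := extensionProduct_iff_tri.1 h1
    obtain ⟨A', B', f', g', hT', hA', hB'⟩ := extensionProduct_iff_tri.1 h2
    obtain ⟨f'', g'', hT''⟩ := hT'.unshift
    obtain ⟨w, hw⟩ := id hT
    obtain ⟨w'', hw''⟩ := hT''
    -- Both triangles truncate `E` between degrees `-1` and `0` of `t`, so they agree: the first
    -- vertex is the shift of an object of `F`, the third lies in `T`.
    obtain ⟨e, -⟩ := t.triangle_iso_exists hw hw'' (Iso.refl E) (-1) 0 ⟨hA⟩ ⟨(h.heartT _ hB).2⟩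
      ⟨le_of_heart_shift (h.heartF _ hA') 1⟩ ⟨t.ge_shift 1 1 0 (by omega) _ hB'⟩
    exact ⟨A', B, _, _, hT.of_iso₁ (Triangle.π₁.mapIso e).symm, hA', hB⟩
  · rintro ⟨X, Y, f, g, hT, hX, hY⟩
    have h1 := h.isCut_tilt
    have := h1.isoV
    refine ⟨h1.U_ext hT (h.tilt_of_le (le_of_heart_shift (h.heartF _ hX) 1)) (h.tilt_of_T hY), ?_⟩
    refine h1.V_ext (hT.shift (-1)) ?_ (h.tilt_of_ge (t.ge_shift 0 (-1) 1 (by omega) _ (h.heartT _ hY).2))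
    exact (F.extensionProduct (t.ge 1)).prop_of_iso (shiftShiftNeg X (1 : ℤ)).symm (h.tilt_of_F hX)

theorem tilt_bounded (ht : ∀ E, t.bounded E) (E : D) : h.tilt.bounded E := by
  obtain ⟨⟨n, hn⟩, m, hm⟩ := ht E
  refine ⟨⟨n, ⟨h.tilt_of_ge (t.ge_shift n (n - 1) 1 (by omega) _ hn.ge)⟩⟩, m + 1, ⟨?_⟩⟩
  exact h.tilt_of_le (t.le_shift m (m + 1) (-1) (by omega) _ hm.le)

theorem tilt_heart_of_T {X : D} (hX : T X) : h.tilt.heart X :=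
  (h.tilt_heart_iff X).2 ⟨_, X, _, _, Tri.zero_id X ((shiftFunctor D (1 : ℤ)).map_isZero
    (isZero_zero D)), h.F_zero (isZero_zero D), hX⟩

theorem tilt_heart_of_F {X : D} (hX : F X) : h.tilt.heart (X⟦(1 : ℤ)⟧) :=
  (h.tilt_heart_iff _).2 ⟨X, _, _, _, Tri.id_zero _ (isZero_zero D), hX, h.T_zero (isZero_zero D)⟩

end IsTorsionPair

end Tilting

/-! ### From a bounded heart with a central charge to a stability condition -/

section Construction

variable {D : Type u} [Category.{v} D] [Preadditive D] [HasZeroObject D] [HasShift D ℤ]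
  [∀ n : ℤ, (shiftFunctor D n).Additive] [Pretriangulated D] [IsTriangulated D]

variable (t : Triangulated.TStructure D) (d n : K0 D →+ ℝ)

/-- The phase `arg (-b + i) / π` of an object of slope `b`. -/
noncomputable def phaseOfSlope (b : ℝ) : ℝ := 1 / 2 + Real.arctan b / Real.pi

theorem phaseOfSlope_strictMono : StrictMono phaseOfSlope := fun a b hab => by
  have := Real.arctan_strictMono hab
  unfold phaseOfSlope
  gcongr

theorem phaseOfSlope_pos (b : ℝ) : 0 < phaseOfSlope b := by
  have h1 := Real.neg_pi_div_two_lt_arctan b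
  have h2 : -(1 / 2) < Real.arctan b / Real.pi := by
    rw [lt_div_iff₀ Real.pi_pos]
    linarith
  unfold phaseOfSlope
  linarith

theorem phaseOfSlope_lt_one (b : ℝ) : phaseOfSlope b < 1 := by
  have h1 := Real.arctan_lt_pi_div_two b
  have h2 : Real.arctan b / Real.pi < 1 / 2 := by
    rw [div_lt_iff₀ Real.pi_pos]
    linarith
  unfold phaseOfSlope
  linarith

theorem exp_phaseOfSlope (b : ℝ) : Complex.exp (Real.pi * phaseOfSlope b * Complex.I) =
    ((1 / √(1 + b ^ 2) : ℝ) : ℂ) * (-b + Complex.I) := by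
  have h : (Real.pi * phaseOfSlope b * Complex.I : ℂ) =
      ((Real.arctan b + Real.pi / 2 : ℝ) : ℂ) * Complex.I := by
    have : Real.pi * phaseOfSlope b = Real.arctan b + Real.pi / 2 := by
      unfold phaseOfSlope
      field_simp
      ring
    rw [← this]
    push_cast
    ring
  rw [h, Complex.exp_mul_I, ← Complex.ofReal_cos, ← Complex.ofReal_sin, Real.cos_add_pi_div_two,
    Real.sin_add_pi_div_two, Real.sin_arctan, Real.cos_arctan]
  push_cast
  ring

/-- Semistable objects of the heart of phase `φ ∈ (0, 1]`. -/
def HeartPhase (φ : ℝ) : ObjectProperty D := fun E =>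
  IsZero E ∨ (∃ b, φ = phaseOfSlope b ∧ SemistableOfSlope t d n b E) ∨
    (φ = 1 ∧ t.heart E ∧ d (K0.of E) = 0)

variable {t d n}

theorem SemistableOfSlope.of_iso {b : ℝ} {E E' : D} (h : SemistableOfSlope t d n b E) (e : E' ≅ E) :
    SemistableOfSlope t d n b E' := by
  refine ⟨⟨h.1.1.of_iso e, fun h0 => h.1.2.1 (h0.of_iso e.symm), fun K Q f g hs => ?_⟩, ?_⟩
  · rw [K0.of_iso e]
    exact h.1.2.2 K Q (f ≫ e.hom) (e.inv ≫ g)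
      ⟨hs.left, h.1.1.1, hs.right, hs.tri.of_iso₂ e.symm⟩
  · rw [K0.of_iso e]
    exact h.2

theorem HeartPhase.of_iso {φ : ℝ} {E E' : D} (h : HeartPhase t d n φ E) (e : E' ≅ E) :
    HeartPhase t d n φ E' := by
  rcases h with h | ⟨b, hb, h⟩ | ⟨hφ, h1, h2⟩
  · exact Or.inl (h.of_iso e)
  · exact Or.inr (Or.inl ⟨b, hb, h.of_iso e⟩)
  · exact Or.inr (Or.inr ⟨hφ, heart_of_iso e.symm h1, by rwa [K0.of_iso e]⟩)

theorem HeartPhase.heart {φ : ℝ} {E : D} (h : HeartPhase t d n φ E) : t.heart E := by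
  rcases h with h | ⟨b, hb, h⟩ | ⟨hφ, h1, h2⟩
  · exact heart_zero h
  · exact h.1.1.1
  · exact h1

theorem IsTorsionFree.homZero_of_rank_eq_zero (h : IsSlopeData t d n) {X Y : D} (hX : t.heart X)
    (hd : d (K0.of X) = 0) (hY : IsTorsionFree t d Y) : HomZero X Y := by
  intro f
  obtain ⟨K, I, Q, k, p, i, q, h1, h2, h3⟩ := Ses.exists_image hX hY.1 f
  have e1 := h1.map_eq d
  have e2 := h.rank_nonneg _ h1.left
  have e3 := h.rank_nonneg _ h1.right
  have hI := hY.2 _ _ _ _ h2 (by linarith)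
  rw [← h3, hI.eq_of_tgt p 0, zero_comp]

theorem HeartPhase.homZero (h : IsSlopeData t d n) {φ ψ : ℝ} (hφ : φ ≤ 1) (hψ : ψ < φ) {X Y : D}
    (hX : HeartPhase t d n φ X) (hY : HeartPhase t d n ψ Y) : HomZero X Y := by
  rcases hX with hX | ⟨b, rfl, hX⟩ | ⟨rfl, h1, h2⟩
  · exact HomZero.of_isZero_left hX
  all_goals rcases hY with hY | ⟨c, rfl, hY⟩ | ⟨rfl, h3, h4⟩
  · exact HomZero.of_isZero_right hY
  · exact h.homZero_of_slope_lt (phaseOfSlope_strictMono.lt_iff_lt.1 hψ) hX hY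
  · exact absurd hψ hφ.not_gt
  · exact HomZero.of_isZero_right hY
  · exact hY.1.1.homZero_of_rank_eq_zero h h1 h2
  · exact absurd hψ hφ.not_gt

/-- The torsion part is the factor of phase `1`; the slope filtration of the torsion-free quotient
has phases below `1` and is spliced on after it. -/
theorem exists_filtered_heartPhase (h : IsSlopeData t d n) {E : D} (hE : t.heart E) :
    Filtered (fun φ X => HeartPhase t d n φ X ∧ φ ∈ Set.Ioc 0 1) 0 E := by
  obtain ⟨K, Q, f, g, hs, hK, hQ⟩ := h.torsion E hE
  obtain ⟨a, ha⟩ := h.exists_filtered hQ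
  have h1 := ha.reindex (P' := fun φ X => (HeartPhase t d n φ X ∧ φ ∈ Set.Ioc 0 1) ∧ φ < 1)
    phaseOfSlope_strictMono fun b B hB =>
      ⟨⟨Or.inr (Or.inl ⟨b, rfl, hB⟩), phaseOfSlope_pos b, (phaseOfSlope_lt_one b).le⟩,
        phaseOfSlope_lt_one b⟩
  refine (Filtered.append (R := fun φ => φ < 1) (fun c hc => ?_) hs.tri h1
    (phaseOfSlope_lt_one a)).mono (phaseOfSlope_pos a).le
  exact Filtered.of_mem ⟨Or.inr (Or.inr ⟨rfl, hs.left, hK⟩), one_pos, le_rfl⟩ hc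

variable (t d n) in
/-- Semistable objects of arbitrary phase. -/
def Phase (φ : ℝ) : ObjectProperty D := fun E =>
  ∃ (k : ℤ) (ψ : ℝ), ψ ∈ Set.Ioc (0 : ℝ) 1 ∧ φ = ψ + k ∧ HeartPhase t d n ψ (E⟦-k⟧)

theorem Phase.of_iso {φ : ℝ} {E E' : D} (h : Phase t d n φ E) (e : E' ≅ E) :
    Phase t d n φ E' := by
  obtain ⟨k, ψ, h1, h2, h3⟩ := h
  exact ⟨k, ψ, h1, h2, h3.of_iso ((shiftFunctor D (-k)).mapIso e)⟩

theorem Phase.shift {φ : ℝ} {E : D} (h : Phase t d n φ E) (m : ℤ) : Phase t d n (φ + m) (E⟦m⟧) := by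
  obtain ⟨k, ψ, h1, rfl, h3⟩ := h
  refine ⟨k + m, ψ, h1, by push_cast; ring, h3.of_iso ?_⟩
  exact ((shiftFunctorAdd' D m (-(k + m)) (-k) (by ring)).app E).symm

theorem Phase.unshift {φ : ℝ} {E : D} {m : ℤ} (h : Phase t d n (φ + m) (E⟦m⟧)) :
    Phase t d n φ E := by
  have := (h.shift (-m)).of_iso (shiftShiftNeg E m).symm
  simpa using this

theorem HeartPhase.phase {φ : ℝ} (hφ : φ ∈ Set.Ioc (0 : ℝ) 1) {E : D}
    (h : HeartPhase t d n φ E) : Phase t d n φ E :=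
  ⟨0, φ, hφ, by simp, h.of_iso (by simpa using (shiftFunctorZero D ℤ).app E)⟩

theorem Phase.heartPhase {φ : ℝ} (hφ : φ ∈ Set.Ioc (0 : ℝ) 1) {E : D} (h : Phase t d n φ E) :
    HeartPhase t d n φ E := by
  obtain ⟨k, ψ, h1, rfl, h3⟩ := h
  have h4 : (k : ℝ) < 1 := by linarith [hφ.2, h1.1]
  have h5 : (-1 : ℝ) < k := by linarith [hφ.1, h1.2]
  have h6 : k = 0 := by
    have h4' : k < 1 := by exact_mod_cast h4
    have h5' : -1 < k := by exact_mod_cast h5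
    omega
  subst h6
  simp only [Int.cast_zero, add_zero]
  exact h3.of_iso (by simpa using ((shiftFunctorZero D ℤ).app E).symm)

theorem Phase.homZero (h : IsSlopeData t d n) {φ ψ : ℝ} (hψ : ψ < φ) {X Y : D}
    (hX : Phase t d n φ X) (hY : Phase t d n ψ Y) : HomZero X Y := by
  obtain ⟨k, φ₀, h1, rfl, h3⟩ := hX
  obtain ⟨l, ψ₀, h1', rfl, h3'⟩ := hY
  have hlk : l ≤ k := by
    have : (l : ℝ) < k + 1 := by linarith [h1.2, h1'.1]
    have : l < k + 1 := by exact_mod_cast this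
    omega
  rcases hlk.lt_or_eq with hlk | rfl
  · refine HomZero.of_shift (n := -l) ?_
    have h4 := heart_hom h3.heart h3'.heart (n := k - l) (by omega)
    exact h4.of_iso ((shiftFunctorAdd' D (-k) (k - l) (-l) (by ring)).app X).symm (Iso.refl _)
  · exact HomZero.of_shift (h3.homZero h h1.2 (by linarith) h3')

/-- Induction on the number `m` of cohomological degrees. The cohomology in the top degree `k` has
phases in `(-k, -k + 1]`, and the truncation below it has larger phases. -/
theorem exists_filtered_phase (h : IsSlopeData t d n) (m : ℕ) {k : ℤ} {E : D}
    (h1 : t.le k E) (h2 : t.ge (k + 1 - m) E) : Filtered (Phase t d n) (-k) E := by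
  induction m generalizing k E with
  | zero =>
    have h3 : HomZero E E := hom_of_le_ge t h1 h2 (by simp)
    exact Filtered.zero _ _ ((IsZero.iff_id_eq_zero E).2 (h3 _))
  | succ m ih =>
    obtain ⟨X, Y, f, g, hT, hX, hY⟩ := (isCut_of_tStructure t (k - 1)).exists_tri E
    rw [sub_add_cancel] at hY
    have hY' : t.le k Y := le_cone hT (t.le_monotone (by omega) _ hX) h1
    have hX' : t.ge (k - 1 + 1 - m) X := by
      push_cast at h2
      exact t.ge_antitone (by omega) _ (ge_fiber hT h2 (t.ge_antitone (by omega) _ hY))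
    have hYh : t.heart (Y⟦k⟧) := ⟨t.le_shift k k 0 (by omega) _ hY', t.ge_shift k k 0 (by omega) _ hY⟩
    have h3 := (exists_filtered_heartPhase h hYh).shift (c := -k) (-k)
      (P' := fun φ X => Phase t d n φ X ∧ φ ≤ -k + 1) fun b B hB => by
        refine ⟨?_, by linarith [hB.2.2]⟩
        have := (hB.1.phase hB.2).shift (-k)
        push_cast at this
        exact this
    rw [zero_add] at h3
    refine Filtered.append (R := fun φ => φ ≤ -k + 1) (fun c hc => ?_) hT
      (h3.of_iso (shiftShiftNeg Y k).symm) (by linarith)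
    refine (ih hX hX').mono ?_
    push_cast
    linarith

theorem im_pos_or_re_neg {z : ℂ} (h : 0 < z.arg) : 0 < z.im ∨ (z.im = 0 ∧ z.re < 0) := by
  rcases (Complex.arg_nonneg_iff.1 h.le).lt_or_eq with h1 | h1
  · exact Or.inl h1
  · refine Or.inr ⟨h1.symm, ?_⟩
    by_contra! h2
    exact h.ne' (Complex.arg_eq_zero_iff.2 ⟨h2, h1.symm⟩)

theorem exp_pi_mul_int (k : ℤ) : Complex.exp (Real.pi * k * Complex.I) = (k.negOnePow : ℤ) := by
  rcases k.even_or_odd with hk | hk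
  · rw [Int.negOnePow_even k hk]
    obtain ⟨l, rfl⟩ := hk
    have : (Real.pi * ((l + l : ℤ) : ℂ) * Complex.I : ℂ) = l * (2 * Real.pi * Complex.I) := by
      push_cast
      ring
    rw [this, Complex.exp_int_mul_two_pi_mul_I]
    simp
  · rw [Int.negOnePow_odd k hk]
    obtain ⟨l, rfl⟩ := hk
    have : (Real.pi * ((2 * l + 1 : ℤ) : ℂ) * Complex.I : ℂ) =
        l * (2 * Real.pi * Complex.I) + Real.pi * Complex.I := by
      push_cast
      ring
    rw [this, Complex.exp_add, Complex.exp_int_mul_two_pi_mul_I, Complex.exp_pi_mul_I]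
    simp

variable {Z : K0 D →+ ℂ}

theorem HeartPhase.charge_mem (hZ : IsCentralCharge t.heart Z)
    (h : IsSlopeData t (Complex.imAddGroupHom.comp Z) (-(Complex.reAddGroupHom.comp Z)))
    {φ : ℝ} {E : D}
    (hE : HeartPhase t (Complex.imAddGroupHom.comp Z) (-(Complex.reAddGroupHom.comp Z)) φ E)
    (h0 : ¬ IsZero E) :
    ∃ m : ℝ, 0 < m ∧ Z (K0.of E) = m * Complex.exp (Real.pi * φ * Complex.I) := by
  rcases hE with hE | ⟨b, rfl, hE⟩ | ⟨rfl, h1, h2⟩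
  · exact absurd hE h0
  · have h1 : 0 < (Z (K0.of E)).im := hE.1.1.rank_pos h h0
    have h2 : -(Z (K0.of E)).re = b * (Z (K0.of E)).im := hE.2
    have h3 : 0 < √(1 + b ^ 2) := Real.sqrt_pos.2 (by positivity)
    refine ⟨(Z (K0.of E)).im * √(1 + b ^ 2), by positivity, ?_⟩
    rw [exp_phaseOfSlope, ← mul_assoc, ← Complex.ofReal_mul, mul_assoc,
      mul_one_div_cancel h3.ne', mul_one]
    apply Complex.ext <;> simp
    linarith
  · have h2 : (Z (K0.of E)).im = 0 := h2
    have h3 := (im_pos_or_re_neg (hZ E h1 h0).1).resolve_left (by simp [h2])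
    refine ⟨-(Z (K0.of E)).re, by linarith [h3.2], ?_⟩
    rw [Complex.ofReal_one, mul_one, Complex.exp_pi_mul_I]
    apply Complex.ext <;> simp [h2]

theorem Phase.charge_mem (hZ : IsCentralCharge t.heart Z)
    (h : IsSlopeData t (Complex.imAddGroupHom.comp Z) (-(Complex.reAddGroupHom.comp Z)))
    {φ : ℝ} {E : D}
    (hE : Phase t (Complex.imAddGroupHom.comp Z) (-(Complex.reAddGroupHom.comp Z)) φ E)
    (h0 : ¬ IsZero E) :
    ∃ m : ℝ, 0 < m ∧ Z (K0.of E) = m * Complex.exp (Real.pi * φ * Complex.I) := by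
  obtain ⟨k, ψ, -, rfl, h3⟩ := hE
  have e : E⟦-k⟧⟦k⟧ ≅ E := shiftNegShift E k
  obtain ⟨m, hm, h4⟩ := h3.charge_mem hZ h fun h5 =>
    h0 (((shiftFunctor D k).map_isZero h5).of_iso e.symm)
  refine ⟨m, hm, ?_⟩
  have h5 : (Real.pi * (ψ + k : ℝ) * Complex.I : ℂ) =
      Real.pi * ψ * Complex.I + Real.pi * k * Complex.I := by
    push_cast
    ring
  rw [← K0.of_iso e, K0.of_shift, h5, Complex.exp_add, exp_pi_mul_int, ← mul_assoc, ← h4,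
    Units.smul_def, map_zsmul, zsmul_eq_mul, mul_comm]

/-- A bounded heart and a central charge with Harder-Narasimhan filtrations define a stability
condition. -/
theorem exists_stabilityCondition (hb : ∀ E, t.bounded E) (hZ : IsCentralCharge t.heart Z)
    (h : IsSlopeData t (Complex.imAddGroupHom.comp Z) (-(Complex.reAddGroupHom.comp Z))) :
    ∃ σ : StabilityCondition D, σ.heart = t.heart ∧ σ.Z = Z := by
  refine ⟨{
    Z := Z
    P := Phase t (Complex.imAddGroupHom.comp Z) (-(Complex.reAddGroupHom.comp Z))
    isClosedUnderIso := fun φ => ⟨fun e hX => hX.of_iso e.symm⟩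
    -- Shifting by `⌈φ⌉ - 1` moves `φ` into `(0, 1]`, with `1` included.
    zero_mem := fun φ E hE => ⟨⌈φ⌉ - 1, φ - (⌈φ⌉ - 1), ⟨by linarith [Int.ceil_lt_add_one φ],
      by linarith [Int.le_ceil φ]⟩, by push_cast; ring,
      Or.inl ((shiftFunctor D _).map_isZero hE)⟩
    charge_mem := fun φ E hE h0 => hE.charge_mem hZ h h0
    shift_iff := fun φ E => ⟨fun hE => by simpa using hE.shift 1,
      fun hE => Phase.unshift (m := 1) (by simpa using hE)⟩
    hom_eq_zero := fun φ ψ hψ E F hE hF => Phase.homZero h hψ hE hF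
    exists_hn := fun E => ?_ }, ?_, rfl⟩
  · obtain ⟨⟨a, ha⟩, b, hb⟩ := hb E
    obtain ⟨m, hm⟩ : ∃ m : ℕ, b + 1 - m ≤ a := ⟨(b + 1 - a).toNat, by omega⟩
    obtain ⟨n, F, A, φ, h1, h2, h3, -⟩ := (exists_filtered_phase h m hb.le
      (t.ge_antitone hm _ ha.ge)).exists_isFiltration
    exact ⟨n, F, A, φ, h1, h2, fun i => (h3 i).2⟩
  · ext E
    constructor
    · intro hE
      refine ExtensionClosure.prop hE (fun X hX => heart_zero hX) ?_ fun hT hX hZ =>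
        heart_ext hT hX hZ
      rintro X ⟨φ, hφ, hX⟩
      exact (Phase.heartPhase hφ hX).heart
    · intro hE
      refine (exists_filtered_heartPhase h hE).extensionClosure fun b _ X hX => ?_
      exact ⟨b, hX.2, hX.1.phase hX.2⟩

end Construction

/-! ### Local finiteness from discreteness of the charge -/

section LocalFiniteness

theorem finite_setOf_norm_le_of_discrete {N : ℝ} (hN : 0 < N) (B : ℝ) :
    {z : ℂ | ‖z‖ ≤ B ∧ ∃ a b : ℤ, N * z = a + b * Complex.I}.Finite := by
  refine (((Set.finite_Icc (-⌈N * B⌉) ⌈N * B⌉).prod (Set.finite_Icc (-⌈N * B⌉) ⌈N * B⌉)).image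
    fun p : ℤ × ℤ => ((p.1 : ℂ) + p.2 * Complex.I) / N).subset ?_
  rintro z ⟨hz, a, b, hab⟩
  have h0 : (N : ℂ) ≠ 0 := by exact_mod_cast hN.ne'
  have key : ∀ c : ℤ, |(c : ℝ)| ≤ N * B → c ∈ Set.Icc (-⌈N * B⌉) ⌈N * B⌉ := fun c hc => by
    have h1 := abs_le.1 (hc.trans (Int.le_ceil _))
    exact ⟨by exact_mod_cast h1.1, by exact_mod_cast h1.2⟩
  have h1 : (N * z).re = a := by rw [hab]; simp
  have h2 : (N * z).im = b := by rw [hab]; simp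
  have h3 : ‖(N * z : ℂ)‖ ≤ N * B := by
    rw [norm_mul, Complex.norm_real, Real.norm_of_nonneg hN.le]
    gcongr
  refine ⟨(a, b), ⟨key a ?_, key b ?_⟩, ?_⟩
  · rw [← h1]
    exact (Complex.abs_re_le_norm _).trans h3
  · rw [← h2]
    exact (Complex.abs_im_le_norm _).trans h3
  · change ((a : ℂ) + b * Complex.I) / N = z
    rw [← hab, mul_div_cancel_left₀ _ h0]

theorem _root_.Monotone.eventually_const_of_finite_range {u : ℕ → ℝ} (hu : Monotone u)
    (h : (Set.range u).Finite) : ∃ N, ∀ n ≥ N, u n = u N := by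
  obtain ⟨_, ⟨N, rfl⟩, hN⟩ := Set.exists_max_image _ id h (Set.range_nonempty u)
  exact ⟨N, fun n hn => le_antisymm (hN _ ⟨n, rfl⟩) (hu hn)⟩

variable {D : Type u} [Category.{v} D] [Preadditive D] [HasZeroObject D] [HasShift D ℤ]
  [∀ n : ℤ, (shiftFunctor D n).Additive] [Pretriangulated D] [IsTriangulated D]

namespace StabilityCondition

variable (σ : StabilityCondition D)

/-- The component of the charge in the direction of phase `φ`. -/
noncomputable def component (φ : ℝ) (E : D) : ℝ :=
  (σ.charge E * Complex.exp (-(Real.pi * φ * Complex.I))).re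

theorem component_of_tri (φ : ℝ) {X Y Z : D} {f : X ⟶ Y} {g : Y ⟶ Z} (h : Tri f g) :
    σ.component φ Y = σ.component φ X + σ.component φ Z := by
  rw [component, σ.charge_of_tri h, add_mul, Complex.add_re]
  rfl

/-- For a phase within `1/4` of `φ` the cosine of the angle to the direction `φ` is at least `1/2`.
The norm is subadditive and the component additive, so the bound passes to extensions. -/
theorem norm_charge_le_component {φ : ℝ} {E : D}
    (hE : σ.interval (Set.Ioo (φ - 1 / 4) (φ + 1 / 4)) E) (h0 : ¬ IsZero E) :
    ‖σ.charge E‖ ≤ 2 * σ.component φ E ∧ 0 < σ.component φ E := by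
  refine σ.charge_mem_of_interval (C := {z | ‖z‖ ≤ 2 * (z * Complex.exp
    (-(Real.pi * φ * Complex.I))).re ∧ 0 < (z * Complex.exp (-(Real.pi * φ * Complex.I))).re})
    ?_ ?_ hE h0
  · rintro x ⟨h1, h2⟩ y ⟨h3, h4⟩
    simp only [Set.mem_ofPred_eq, add_mul, Complex.add_re]
    exact ⟨(norm_add_le x y).trans (by linarith), by linarith⟩
  · intro ψ hψ m hm
    have h1 : (m * Complex.exp (Real.pi * ψ * Complex.I) *
        Complex.exp (-(Real.pi * φ * Complex.I))).re = m * Real.cos (Real.pi * (ψ - φ)) := by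
      rw [mul_assoc, ← Complex.exp_add, Complex.re_ofReal_mul]
      congr 1
      rw [← Complex.exp_ofReal_mul_I_re]
      congr 2
      push_cast
      ring
    have h2 : ‖(m * Complex.exp (Real.pi * ψ * Complex.I) : ℂ)‖ = m := by
      rw [norm_mul, Complex.norm_real, Real.norm_of_nonneg hm.le, ← Complex.ofReal_mul,
        Complex.norm_exp_ofReal_mul_I, mul_one]
    have h3 : 1 / 2 ≤ Real.cos (Real.pi * (ψ - φ)) := by
      rw [← Real.cos_pi_div_three, ← Real.cos_abs (Real.pi * (ψ - φ))]
      have h4 : |ψ - φ| ≤ 1 / 4 := abs_le.2 ⟨by linarith [hψ.1], by linarith [hψ.2]⟩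
      refine Real.cos_le_cos_of_nonneg_of_le_pi (abs_nonneg _) (by linarith [Real.pi_pos]) ?_
      rw [abs_mul, abs_of_pos Real.pi_pos]
      nlinarith [Real.pi_pos]
    refine ⟨?_, ?_⟩
    · rw [h1, h2]
      nlinarith
    · rw [h1]
      positivity

theorem component_nonneg {φ : ℝ} {E : D}
    (hE : σ.interval (Set.Ioo (φ - 1 / 4) (φ + 1 / 4)) E) : 0 ≤ σ.component φ E := by
  by_cases h0 : IsZero E
  · rw [component, σ.charge_of_isZero h0]
    simp
  · exact (σ.norm_charge_le_component hE h0).2.le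

theorem norm_charge_le {φ : ℝ} {E : D}
    (hE : σ.interval (Set.Ioo (φ - 1 / 4) (φ + 1 / 4)) E) :
    ‖σ.charge E‖ ≤ 2 * σ.component φ E := by
  by_cases h0 : IsZero E
  · rw [component, σ.charge_of_isZero h0]
    simp
  · exact (σ.norm_charge_le_component hE h0).1

/-- The quotient of two nested strict subobjects. -/
theorem exists_cone_mem_of_comp {a b : ℝ} {X Y E W W' : D} {f : X ⟶ Y} {i : Y ⟶ E} {j : X ⟶ E}
    {p : E ⟶ W} {q : E ⟶ W'} (hf : f ≫ i = j) (hi : Ses (σ.interval (Set.Ioo a b)) i p)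
    (hj : Ses (σ.interval (Set.Ioo a b)) j q) :
    ∃ (V : D) (g : Y ⟶ V), Tri f g ∧ σ.interval (Set.Ioo a b) V := by
  obtain ⟨V, g, hg⟩ := Tri.exists_cone f
  -- As the cone of `X ⟶ Y`, `V` has phases above `a`. The octahedron makes it the fibre of `W' ⟶
  -- W`, which bounds its phases by `b`.
  obtain ⟨c, d, hcd, -⟩ := hg.comp_left_of hi.tri hf hj.tri
  refine ⟨V, g, hg, σ.interval_Ioo ?_ ?_⟩
  · exact (σ.isCut_Ioi a).U_cone hg (σ.interval_mono (fun _ h => h.1) hj.left)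
      (σ.interval_mono (fun _ h => h.1) hi.left)
  · exact (σ.isCut_Ici b).V_fiber hcd (σ.interval_mono (fun _ h => h.2) hj.right)
      (σ.interval_mono (fun _ h => h.2) hi.right)

/-- The charges of the strict subobjects of `E` are bounded by twice the component of `E`, so by
discreteness they take finitely many values. Along a chain the component is monotone, hence
eventually constant, and a quotient with component `0` is zero. -/
theorem isLocallyFinite_of_discrete {N : ℝ} (hN : 0 < N)
    (hZ : ∀ x, ∃ a b : ℤ, N * σ.Z x = a + b * Complex.I) : σ.IsLocallyFinite := by
  refine fun φ => ⟨1 / 4, by norm_num, by norm_num, fun E X ι hι => ?_⟩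
  choose W p hs using fun n => isStrictMono_iff.1 (hι n)
  have hfin : (Set.range fun n => σ.component φ (X n)).Finite := by
    refine ((finite_setOf_norm_le_of_discrete hN (2 * σ.component φ E)).image
      fun z => (z * Complex.exp (-(Real.pi * φ * Complex.I))).re).subset ?_
    rintro _ ⟨n, rfl⟩
    refine ⟨σ.charge (X n), ⟨(σ.norm_charge_le (hs n).left).trans ?_, hZ _⟩, rfl⟩
    rw [σ.component_of_tri φ (hs n).tri]
    linarith [σ.component_nonneg (hs n).right]
  have key : ∀ {m k : ℕ} {f : X m ⟶ X k}, f ≫ ι k = ι m →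
      σ.component φ (X m) ≤ σ.component φ (X k) ∧
      (σ.component φ (X m) = σ.component φ (X k) → IsIso f) := by
    intro m k f hf
    obtain ⟨V, g, hg, hV⟩ := σ.exists_cone_mem_of_comp hf (hs k) (hs m)
    have h1 := σ.component_of_tri φ hg
    refine ⟨by linarith [σ.component_nonneg hV], fun h2 => hg.isIso₁ ?_⟩
    by_contra h0
    linarith [(σ.norm_charge_le_component hV h0).2]
  constructor
  · intro f hf
    obtain ⟨M, hM⟩ := (monotone_nat_of_le_succ fun n =>
      (key (hf n)).1).eventually_const_of_finite_range hfin
    exact ⟨M, fun n hn => (key (hf n)).2 ((hM n hn).trans (hM (n + 1) (by omega)).symm)⟩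
  · intro f hf
    have hfin' : (Set.range fun n => -σ.component φ (X n)).Finite := by
      refine (hfin.image fun x => -x).subset ?_
      rintro _ ⟨n, rfl⟩
      exact ⟨_, ⟨n, rfl⟩, rfl⟩
    obtain ⟨M, hM⟩ := (monotone_nat_of_le_succ fun n =>
      neg_le_neg (key (hf n)).1).eventually_const_of_finite_range hfin'
    exact ⟨M, fun n hn => (key (hf n)).2
      (neg_injective ((hM (n + 1) (by omega)).trans (hM n hn).symm))⟩

end StabilityCondition

end LocalFiniteness

/-! ### Bounded denominators of rational charges -/

section Discreteness

/-- A homomorphism to `ℚ + ℚ i` from a finitely generated group has bounded denominators. -/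
theorem exists_denominator_of_fg {G : Type*} [AddCommGroup G] (hG : AddGroup.FG G) (f : G →+ ℂ)
    (hf : ∀ x, ∃ a b : ℚ, f x = (a : ℂ) + (b : ℂ) * Complex.I) :
    ∃ N : ℕ, 0 < N ∧ ∀ x, ∃ a b : ℤ, N * f x = a + b * Complex.I := by
  obtain ⟨s, hs, hfin⟩ := AddGroup.fg_iff.1 hG
  have h1 : ∃ N : ℕ, 0 < N ∧ ∀ x ∈ s, ∃ a b : ℤ, N * f x = a + b * Complex.I := by
    clear hs
    induction s, hfin using Set.Finite.induction_on with
    | empty => exact ⟨1, one_pos, by simp⟩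
    | @insert x s _ _ ih =>
      obtain ⟨N, hN, h⟩ := ih
      obtain ⟨a, b, hab⟩ := hf x
      have key : ∀ q : ℚ, (q.den : ℂ) * q = q.num := fun q => by
        exact_mod_cast Rat.den_mul_eq_num q
      refine ⟨N * (a.den * b.den), by positivity, ?_⟩
      rintro y (rfl | hy)
      · refine ⟨N * b.den * a.num, N * a.den * b.num, ?_⟩
        rw [hab]
        push_cast
        linear_combination (N * b.den : ℂ) * key a + (N * a.den * Complex.I : ℂ) * key b
      · obtain ⟨c, d, hcd⟩ := h y hy
        refine ⟨a.den * b.den * c, a.den * b.den * d, ?_⟩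
        push_cast
        linear_combination (a.den * b.den : ℂ) * hcd
  obtain ⟨N, hN, h⟩ := h1
  refine ⟨N, hN, fun x => ?_⟩
  have hx : x ∈ AddSubgroup.closure s := hs ▸ AddSubgroup.mem_top x
  induction hx using AddSubgroup.closure_induction with
  | mem x hx => exact h x hx
  | zero => exact ⟨0, 0, by simp⟩
  | add x y _ _ hx hy =>
    obtain ⟨a, b, hab⟩ := hx
    obtain ⟨c, d, hcd⟩ := hy
    refine ⟨a + c, b + d, ?_⟩
    rw [map_add]
    push_cast
    linear_combination hab + hcd
  | neg x _ hx =>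
    obtain ⟨a, b, hab⟩ := hx
    refine ⟨-a, -b, ?_⟩
    rw [map_neg]
    push_cast
    linear_combination -hab

/-- A homomorphism to `ℚ + ℚ i` from a group which is finitely generated up to torsion has bounded
denominators. -/
theorem exists_denominator {G : Type*} [AddCommGroup G]
    (hG : AddGroup.FG (G ⧸ AddCommGroup.torsion G)) (f : G →+ ℂ)
    (hf : ∀ x, ∃ a b : ℚ, f x = (a : ℂ) + (b : ℂ) * Complex.I) :
    ∃ N : ℝ, 0 < N ∧ ∀ x, ∃ a b : ℤ, N * f x = a + b * Complex.I := by
  -- The target `ℂ` is torsion-free, so `f` descends to the finitely generated quotient.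
  have hle : AddCommGroup.torsion G ≤ f.ker := by
    intro x hx
    obtain ⟨n, hn, hx⟩ := isOfFinAddOrder_iff_nsmul_eq_zero.1 hx
    have h := congrArg f hx
    rw [map_nsmul, map_zero, nsmul_eq_mul, mul_eq_zero] at h
    exact h.resolve_left (by exact_mod_cast hn.ne')
  obtain ⟨N, hN, h⟩ := exists_denominator_of_fg hG (QuotientAddGroup.lift _ f hle) fun x => by
    obtain ⟨x, rfl⟩ := QuotientAddGroup.mk_surjective x
    exact hf x
  exact ⟨N, by exact_mod_cast hN, fun x => by exact_mod_cast h (x : G ⧸ AddCommGroup.torsion G)⟩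

end Discreteness

/-! ### Gluing t-structures along a semiorthogonal decomposition -/

section Gluing

variable {D : Type u} [Category.{v} D] [Preadditive D] [HasZeroObject D] [HasShift D ℤ]
  [∀ n : ℤ, (shiftFunctor D n).Additive] [Pretriangulated D]
  {D₁ : Type u₁} [Category.{v₁} D₁] [Preadditive D₁] [HasZeroObject D₁] [HasShift D₁ ℤ]
  [∀ n : ℤ, (shiftFunctor D₁ n).Additive] [Pretriangulated D₁]
  {D₂ : Type u₂} [Category.{v₂} D₂] [Preadditive D₂] [HasZeroObject D₂] [HasShift D₂ ℤ]
  [∀ n : ℤ, (shiftFunctor D₂ n).Additive] [Pretriangulated D₂]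

theorem HomZero.of_adjunction {F : D₁ ⥤ D} {G : D ⥤ D₁} (adj : F ⊣ G) {X : D₁} {Y : D}
    (h : HomZero X (G.obj Y)) : HomZero (F.obj X) Y := fun _ =>
  (adj.homEquiv X Y).injective ((h _).trans (h _).symm)

theorem HomZero.of_adjunction' {F : D₁ ⥤ D} {G : D ⥤ D₁} (adj : F ⊣ G) {X : D₁} {Y : D}
    (h : HomZero (F.obj X) Y) : HomZero X (G.obj Y) := fun _ =>
  (adj.homEquiv X Y).symm.injective ((h _).trans (h _).symm)

theorem HomZero.map {F : D₁ ⥤ D} [F.Full] [F.Faithful] {X Y : D₁} (h : HomZero X Y) :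
    HomZero (F.obj X) (F.obj Y) := fun f => by
  obtain ⟨g, rfl⟩ := F.map_surjective f
  exact (congrArg F.map ((h g).trans (h 0).symm)).trans <| by
    obtain ⟨g', hg'⟩ := F.map_surjective (0 : F.obj X ⟶ F.obj Y)
    rw [← hg', h g', h 0]

theorem isZero_of_map {F : D₁ ⥤ D} [F.Faithful] {X : D₁} (h : IsZero (F.obj X)) : IsZero X := by
  rw [IsZero.iff_id_eq_zero]
  exact F.map_injective (h.eq_of_src _ _)

namespace SemiorthogonalDecomposition

instance (S : SemiorthogonalDecomposition D D₁ D₂) : S.i₁.Full := S.full₁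
instance (S : SemiorthogonalDecomposition D D₁ D₂) : S.i₁.Faithful := S.faithful₁
instance (S : SemiorthogonalDecomposition D D₁ D₂) : S.i₂.Full := S.full₂
instance (S : SemiorthogonalDecomposition D D₁ D₂) : S.i₂.Faithful := S.faithful₂

variable (S : SemiorthogonalDecomposition D D₁ D₂)

noncomputable def τ₁LIso (X : D₁) : S.τ₁L.obj (S.i₁.obj X) ≅ X := asIso (S.adj₁.counit.app X)

noncomputable def τ₂RIso (X : D₂) : X ≅ S.τ₂R.obj (S.i₂.obj X) := asIso (S.adj₂.unit.app X)

/-- Applying `τ₁L` and `τ₂R` to a decomposing triangle identifies its outer vertices with the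
projections of `E`. -/
theorem exists_tri (E : D) : ∃ (f : S.i₂.obj (S.τ₂R.obj E) ⟶ E) (g : E ⟶ S.i₁.obj (S.τ₁L.obj E)),
    Tri f g := by
  obtain ⟨A, B, f, g, w, hw⟩ := S.exists_triangle E
  have hT : Tri f g := ⟨w, hw⟩
  have := (hT.map S.τ₁L).isIso₂ (S.isZero₁₂ A)
  have := (hT.map S.τ₂R).isIso₁ (S.isZero₂₁ B)
  let a : S.τ₂R.obj E ≅ A := (asIso (S.τ₂R.map f)).symm ≪≫ (S.τ₂RIso A).symm
  let b : S.τ₁L.obj E ≅ B := asIso (S.τ₁L.map g) ≪≫ S.τ₁LIso B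
  exact ⟨_, _, (hT.of_iso₁ (S.i₂.mapIso a)).of_iso₃ (S.i₁.mapIso b)⟩

theorem homZero_i₂_i₁ (X : D₂) (Y : D₁) : HomZero (S.i₂.obj X) (S.i₁.obj Y) :=
  HomZero.of_adjunction' S.adj₁ (HomZero.of_isZero_left (S.isZero₁₂ X))

theorem isZero_of_components {E : D} (h1 : IsZero (S.τ₁L.obj E)) (h2 : IsZero (S.τ₂R.obj E)) :
    IsZero E := by
  obtain ⟨f, g, h⟩ := S.exists_tri E
  exact h.isZero₂ (S.i₂.map_isZero h2) (S.i₁.map_isZero h1)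

variable {S}

namespace ConditionOne

variable (h : S.ConditionOne)

noncomputable instance : h.τ₁R.CommShift ℤ := h.adj.rightAdjointCommShift ℤ

instance : h.τ₁R.IsTriangulated :=
  haveI : h.adj.CommShift ℤ := h.adj.commShift_of_leftAdjoint ℤ
  h.adj.isTriangulated_rightAdjoint

noncomputable def τ₁RIso (X : D₁) : X ≅ h.τ₁R.obj (S.i₁.obj X) := asIso (h.adj.unit.app X)

noncomputable def gluingShift (X : D₂) (n : ℤ) :
    h.gluingFunctor.obj (X⟦n⟧) ≅ (h.gluingFunctor.obj X)⟦n⟧ :=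
  (shiftFunctor D₁ (1 : ℤ)).mapIso (h.τ₁R.mapIso ((S.i₂.commShiftIso n).app X) ≪≫
    (h.τ₁R.commShiftIso n).app (S.i₂.obj X)) ≪≫ shiftComm _ _ _

theorem gluing_tri {X Y Z : D₂} {f : X ⟶ Y} {g : Y ⟶ Z} (hT : Tri f g) :
    Tri (h.gluingFunctor.map f) (h.gluingFunctor.map g) :=
  ((hT.map S.i₂).map h.τ₁R).shift 1

/-- By adjunction `Φ` governs the extensions of `i₁ X` by `i₂ Y`: `Hom(i₁ X, i₂ Y[1]) = Hom(X, Φ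
Y)`. -/
theorem homZero_i₁_i₂ {X : D₁} {Y : D₂} (hXY : HomZero X (h.gluingFunctor.obj Y)) :
    HomZero (S.i₁.obj X) ((S.i₂.obj Y)⟦(1 : ℤ)⟧) :=
  HomZero.of_adjunction h.adj
    (hXY.of_iso (Iso.refl _) ((h.τ₁R.commShiftIso (1 : ℤ)).app (S.i₂.obj Y)).symm)

variable [IsTriangulated D]

/-- Gluing of aisles and coaisles along a semiorthogonal decomposition. -/
theorem isCut_glue {U₁ V₁ : ObjectProperty D₁} {U₂ V₂ : ObjectProperty D₂} (c₁ : IsCut U₁ V₁)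
    (c₂ : IsCut U₂ V₂) (hV : ∀ X, V₂ X → V₁ (h.gluingFunctor.obj X)) :
    IsCut (fun E : D => U₁ (S.τ₁L.obj E) ∧ U₂ (S.τ₂R.obj E))
      (fun E : D => V₁ (S.τ₁L.obj E) ∧ V₂ (S.τ₂R.obj E)) := by
  have := c₁.isoU
  have := c₁.isoV
  have := c₂.isoU
  have := c₂.isoV
  refine ⟨⟨fun e hX => ⟨U₁.prop_of_iso (S.τ₁L.mapIso e) hX.1, U₂.prop_of_iso (S.τ₂R.mapIso e) hX.2⟩⟩,
    ⟨fun e hX => ⟨V₁.prop_of_iso (S.τ₁L.mapIso e) hX.1, V₂.prop_of_iso (S.τ₂R.mapIso e) hX.2⟩⟩,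
    fun X Y hX hY => ?_, fun X hX => ⟨?_, ?_⟩, fun X hX => ⟨?_, ?_⟩, fun E => ?_⟩
  · obtain ⟨f, g, hT⟩ := S.exists_tri X
    obtain ⟨f', g', hT'⟩ := S.exists_tri Y
    have key : HomZero (S.i₁.obj (S.τ₁L.obj X)) (S.i₂.obj (S.τ₂R.obj Y)) := by
      refine HomZero.of_adjunction h.adj (HomZero.of_shift (n := 1) ?_)
      exact c₁.hom _ _ (c₁.shiftU _ hX.1) (hV _ hY.2)
    exact hT.homZero_left
      (hT'.homZero_right (c₂.hom _ _ hX.2 hY.2).map (S.homZero_i₂_i₁ _ _))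
      (hT'.homZero_right key (c₁.hom _ _ hX.1 hY.1).map)
  · exact U₁.prop_of_iso ((S.τ₁L.commShiftIso (1 : ℤ)).app X).symm (c₁.shiftU _ hX.1)
  · exact U₂.prop_of_iso ((S.τ₂R.commShiftIso (1 : ℤ)).app X).symm (c₂.shiftU _ hX.2)
  · exact V₁.prop_of_iso ((S.τ₁L.commShiftIso (-1 : ℤ)).app X).symm (c₁.shiftV _ hX.1)
  · exact V₂.prop_of_iso ((S.τ₂R.commShiftIso (-1 : ℤ)).app X).symm (c₂.shiftV _ hX.2)
  · obtain ⟨f, g, hT⟩ := S.exists_tri E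
    obtain ⟨X₂, Y₂, f₂, g₂, hT₂, hX₂, hY₂⟩ := c₂.exists_tri (S.τ₂R.obj E)
    obtain ⟨X₁, Y₁, f₁, g₁, hT₁, hX₁, hY₁⟩ := c₁.exists_tri (S.τ₁L.obj E)
    let PU₂ : ObjectProperty D := fun E => ∃ X, U₂ X ∧ Nonempty (E ≅ S.i₂.obj X)
    let PV₂ : ObjectProperty D := fun E => ∃ X, V₂ X ∧ Nonempty (E ≅ S.i₂.obj X)
    let PU₁ : ObjectProperty D := fun E => ∃ X, U₁ X ∧ Nonempty (E ≅ S.i₁.obj X)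
    let PV₁ : ObjectProperty D := fun E => ∃ X, V₁ X ∧ Nonempty (E ≅ S.i₁.obj X)
    have h1 : (PU₂.extensionProduct PV₂).extensionProduct (PU₁.extensionProduct PV₁) E :=
      extensionProduct_of_tri hT
        (extensionProduct_of_tri (hT₂.map S.i₂) ⟨_, hX₂, ⟨Iso.refl _⟩⟩ ⟨_, hY₂, ⟨Iso.refl _⟩⟩)
        (extensionProduct_of_tri (hT₁.map S.i₁) ⟨_, hX₁, ⟨Iso.refl _⟩⟩ ⟨_, hY₁, ⟨Iso.refl _⟩⟩)
    -- The decomposition has order `U₂, V₂, U₁, V₁`. Extensions of `U₁` by `V₂` split because `Φ V₂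
    -- ⊆ V₁`, so the middle terms may be exchanged, leaving the aisle `U₂ ⋆ U₁` and the coaisle `V₂
    -- ⋆ V₁`.
    have hswap : PV₂.extensionProduct PU₁ ≤ PU₁.extensionProduct PV₂ := by
      apply extensionProduct_swap
      rintro X Y ⟨X', hX', ⟨e⟩⟩ ⟨Y', hY', ⟨e'⟩⟩
      exact (h.homZero_i₁_i₂ (c₁.hom _ _ hY' (hV _ hX'))).of_iso e'.symm
        ((shiftFunctor D (1 : ℤ)).mapIso e.symm)
    rw [ObjectProperty.extensionProduct_assoc, ← ObjectProperty.extensionProduct_assoc PV₂] at h1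
    have h2 := extensionProduct_mono le_rfl (extensionProduct_mono hswap le_rfl) _ h1
    rw [ObjectProperty.extensionProduct_assoc, ← ObjectProperty.extensionProduct_assoc PU₂] at h2
    refine extensionProduct_mono ?_ ?_ _ h2
    · intro X hX
      obtain ⟨A, B, a, b, hab, ⟨A', hA', ⟨e⟩⟩, ⟨B', hB', ⟨e'⟩⟩⟩ := extensionProduct_iff_tri.1 hX
      refine ⟨c₁.U_ext (hab.map S.τ₁L) ?_ ?_, c₂.U_ext (hab.map S.τ₂R) ?_ ?_⟩
      · exact c₁.U_zero ((S.isZero₁₂ A').of_iso (S.τ₁L.mapIso e))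
      · exact U₁.prop_of_iso (S.τ₁L.mapIso e' ≪≫ S.τ₁LIso B').symm hB'
      · exact U₂.prop_of_iso (S.τ₂R.mapIso e ≪≫ (S.τ₂RIso A').symm).symm hA'
      · exact c₂.U_zero ((S.isZero₂₁ B').of_iso (S.τ₂R.mapIso e'))
    · intro X hX
      obtain ⟨A, B, a, b, hab, ⟨A', hA', ⟨e⟩⟩, ⟨B', hB', ⟨e'⟩⟩⟩ := extensionProduct_iff_tri.1 hX
      refine ⟨c₁.V_ext (hab.map S.τ₁L) ?_ ?_, c₂.V_ext (hab.map S.τ₂R) ?_ ?_⟩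
      · exact c₁.V_zero ((S.isZero₁₂ A').of_iso (S.τ₁L.mapIso e))
      · exact V₁.prop_of_iso (S.τ₁L.mapIso e' ≪≫ S.τ₁LIso B').symm hB'
      · exact V₂.prop_of_iso (S.τ₂R.mapIso e ≪≫ (S.τ₂RIso A').symm).symm hA'
      · exact c₂.V_zero ((S.isZero₂₁ B').of_iso (S.τ₂R.mapIso e'))

variable [IsTriangulated D₁] [IsTriangulated D₂] {h} {σ₁ : StabilityCondition D₁}
  {σ₂ : StabilityCondition D₂}

namespace IsConditionFive

variable (h₅ : h.IsConditionFive σ₁ σ₂)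
include h₅

theorem map_Iic_zero {X : D₂} (hX : σ₂.interval (Set.Iic 0) X) :
    σ₁.interval (Set.Iic 0) (h.gluingFunctor.obj X) := by
  have h1 := h₅.map_ge0 _ (σ₂.interval_shift_one (J := Set.Iic 1) (fun φ hφ => by
    have : φ ≤ 0 := hφ
    change φ + 1 ≤ 1
    linarith) hX)
  have h2 := σ₁.interval_shift_neg_one (J := Set.Iic 0) (fun φ hφ => by
    have : φ ≤ 1 := hφ
    change φ - 1 ≤ 0
    linarith) h1
  exact (σ₁.interval_isClosedUnderIsomorphisms _).of_iso
    ((shiftFunctor D₁ (-1 : ℤ)).mapIso (h.gluingShift X 1) ≪≫ shiftShiftNeg _ (1 : ℤ)) h2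

theorem map_Ioi_one {X : D₂} (hX : σ₂.interval (Set.Ioi 1) X) :
    σ₁.interval (Set.Ioi 1) (h.gluingFunctor.obj X) := by
  have h1 := h₅.map_le0 _ (σ₂.interval_shift_neg_one (J := Set.Ioi 0) (fun φ hφ => by
    have : 1 < φ := hφ
    change 0 < φ - 1
    linarith) hX)
  have h2 := σ₁.interval_shift_one (J := Set.Ioi 1) (fun φ hφ => by
    have : 0 < φ := hφ
    change 1 < φ + 1
    linarith) h1
  exact (σ₁.interval_isClosedUnderIsomorphisms _).of_iso
    ((shiftFunctor D₁ (1 : ℤ)).mapIso (h.gluingShift X (-1)) ≪≫ shiftNegShift _ (1 : ℤ)) h2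

/-- Split at phase `0`: t-exactness handles the phases `≤ 0`, preservation of free objects the
phases in `(0, 1)`. This allows gluing at phase `1`. -/
theorem map_Iio_one {X : D₂} (hX : σ₂.interval (Set.Iio 1) X) :
    σ₁.interval (Set.Iio 1) (h.gluingFunctor.obj X) := by
  obtain ⟨A, B, f, g, hT, hA, hB⟩ := (σ₂.isCut_Ioi 0).exists_tri X
  have hB' : σ₂.interval (Set.Iio 1) B :=
    σ₂.interval_mono (fun φ (hφ : φ ≤ 0) => by change φ < 1; linarith) hB
  have hA' := (σ₂.isCut_Ici 1).V_fiber hT hX hB'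
  refine (σ₁.isCut_Ici 1).V_ext (h.gluing_tri hT) ?_ ?_
  · exact σ₁.interval_mono (fun _ hφ => hφ.2) (h₅.map_free _ (σ₂.interval_Ioo hA hA'))
  · exact σ₁.interval_mono (fun φ (hφ : φ ≤ 0) => by change φ < 1; linarith) (h₅.map_Iic_zero hB)

theorem map_heart {X : D₂} (hX : σ₂.heart X) : σ₁.heart (h.gluingFunctor.obj X) :=
  σ₁.interval_Ioc (h₅.map_le0 _ (σ₂.interval_mono (fun _ hφ => hφ.1) hX))
    (h₅.map_ge0 _ (σ₂.interval_mono (fun _ hφ => hφ.2) hX))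

/-- If the gluing functor reflects zero objects, then it reflects the hearts. -/
theorem heart_of_map (h0 : ∀ X, IsZero (h.gluingFunctor.obj X) → IsZero X) {X : D₂}
    (hX : σ₁.heart (h.gluingFunctor.obj X)) : σ₂.heart X := by
  have hX₁ := σ₁.interval_mono (J := Set.Ioi 0) (fun _ hφ => hφ.1) hX
  have hX₂ := σ₁.interval_mono (J := Set.Iic 1) (fun _ hφ => hφ.2) hX
  refine σ₂.interval_Ioc ?_ ?_
  · obtain ⟨A, B, f, g, hT, hA, hB⟩ := (σ₂.isCut_Ioi 0).exists_tri X
    -- `Φ B` has positive phases as a cone and phases `≤ 0` by exactness, so it vanishes, and then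
    -- so does `B`.
    have h1 := (σ₁.isCut_Ioi 0).U_cone (h.gluing_tri hT) (h₅.map_le0 _ hA) hX₁
    have h2 := (σ₁.isCut_Ioi 0).hom _ _ h1 (h₅.map_Iic_zero hB)
    have := hT.isIso₁ (h0 _ ((IsZero.iff_id_eq_zero _).2 (h2 _)))
    exact (σ₂.interval_isClosedUnderIsomorphisms _).of_iso (asIso f) hA
  · obtain ⟨A, B, f, g, hT, hA, hB⟩ := (σ₂.isCut_Ioi 1).exists_tri X
    have h1 := (σ₁.isCut_Ioi 1).V_fiber (h.gluing_tri hT) hX₂ (h₅.map_ge0 _ hB)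
    have h2 := (σ₁.isCut_Ioi 1).hom _ _ (h₅.map_Ioi_one hA) h1
    have := hT.isIso₂ (h0 _ ((IsZero.iff_id_eq_zero _).2 (h2 _)))
    exact (σ₂.interval_isClosedUnderIsomorphisms _).of_iso (asIso g).symm hB

theorem isCut_zero : IsCut
    (fun E : D => σ₁.interval (Set.Ioi 0) (S.τ₁L.obj E) ∧ σ₂.interval (Set.Ioi 0) (S.τ₂R.obj E))
    (fun E : D => σ₁.interval (Set.Iic 0) (S.τ₁L.obj E) ∧ σ₂.interval (Set.Iic 0) (S.τ₂R.obj E)) :=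
  h.isCut_glue (σ₁.isCut_Ioi 0) (σ₂.isCut_Ioi 0) fun _ hX => h₅.map_Iic_zero hX

/-- Truncating an object of the glued heart along this cut gives its torsion part and its free part.
-/
theorem isCut_one : IsCut
    (fun E : D => σ₁.interval (Set.Ici 1) (S.τ₁L.obj E) ∧ σ₂.interval (Set.Ici 1) (S.τ₂R.obj E))
    (fun E : D => σ₁.interval (Set.Iio 1) (S.τ₁L.obj E) ∧ σ₂.interval (Set.Iio 1) (S.τ₂R.obj E)) :=
  h.isCut_glue (σ₁.isCut_Ici 1) (σ₂.isCut_Ici 1) fun _ hX => h₅.map_Iio_one hX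

/-- The glued t-structure. -/
def tStructure : Triangulated.TStructure D := h₅.isCut_zero.toTStructure

theorem tStructure_heart : h₅.tStructure.heart = S.gluedHeart σ₁ σ₂ := by
  ext E
  have e₁ := (S.τ₁L.commShiftIso (-1 : ℤ)).app E
  have e₂ := (S.τ₂R.commShiftIso (-1 : ℤ)).app E
  rw [tStructure, IsCut.toTStructure_heart, gluedHeart, σ₁.heart_iff, σ₂.heart_iff]
  have i₁ := σ₁.interval_isClosedUnderIsomorphisms (Set.Iic 0)
  have i₂ := σ₂.interval_isClosedUnderIsomorphisms (Set.Iic 0)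
  constructor
  · rintro ⟨⟨h1, h2⟩, h3, h4⟩
    exact ⟨⟨h1, i₁.of_iso e₁ h3⟩, h2, i₂.of_iso e₂ h4⟩
  · rintro ⟨⟨h1, h3⟩, h2, h4⟩
    exact ⟨⟨h1, h2⟩, i₁.of_iso e₁.symm h3, i₂.of_iso e₂.symm h4⟩

theorem tStructure_bounded (E : D) : h₅.tStructure.bounded E := by
  obtain ⟨n₁, hn₁⟩ := σ₁.exists_shift_mem_le (S.τ₁L.obj E)
  obtain ⟨n₂, hn₂⟩ := σ₂.exists_shift_mem_le (S.τ₂R.obj E)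
  obtain ⟨m₁, hm₁⟩ := σ₁.exists_shift_mem_ge (S.τ₁L.obj E)
  obtain ⟨m₂, hm₂⟩ := σ₂.exists_shift_mem_ge (S.τ₂R.obj E)
  have i₁ := σ₁.interval_isClosedUnderIsomorphisms (Set.Ioi 0)
  have i₂ := σ₂.interval_isClosedUnderIsomorphisms (Set.Ioi 0)
  have j₁ := σ₁.interval_isClosedUnderIsomorphisms (Set.Iic 0)
  have j₂ := σ₂.interval_isClosedUnderIsomorphisms (Set.Iic 0)
  constructor
  · refine ⟨1 - (m₁ + m₂), ⟨?_⟩⟩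
    have h1 : h₅.tStructure.ge 1 (E⟦(-(m₁ + m₂) : ℤ)⟧) := by
      rw [tStructure, IsCut.toTStructure_ge_one]
      refine ⟨j₁.of_iso ?_ ((σ₁.isCut_Ioi 0).V_shift hm₁ m₂),
        j₂.of_iso ?_ ((σ₂.isCut_Ioi 0).V_shift hm₂ m₁)⟩
      · exact ((S.τ₁L.commShiftIso (-(m₁ + m₂) : ℤ)).app E ≪≫
          (shiftFunctorAdd' D₁ (-m₁ : ℤ) (-m₂) (-(m₁ + m₂)) (by ring)).app _).symm
      · exact ((S.τ₂R.commShiftIso (-(m₁ + m₂) : ℤ)).app E ≪≫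
          (shiftFunctorAdd' D₂ (-m₂ : ℤ) (-m₁) (-(m₁ + m₂)) (by ring)).app _).symm
    have h2 := h₅.tStructure.ge_shift 1 (m₁ + m₂) (1 - (m₁ + m₂)) (by ring) _ h1
    exact (h₅.tStructure.ge _).prop_of_iso (shiftNegShift E (m₁ + m₂ : ℤ)) h2
  · refine ⟨n₁ + n₂, ⟨?_⟩⟩
    have h1 : h₅.tStructure.le 0 (E⟦(n₁ + n₂ : ℤ)⟧) := by
      rw [tStructure, IsCut.toTStructure_le_zero]
      refine ⟨i₁.of_iso ?_ ((σ₁.isCut_Ioi 0).U_shift hn₁ n₂),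
        i₂.of_iso ?_ ((σ₂.isCut_Ioi 0).U_shift hn₂ n₁)⟩
      · exact ((S.τ₁L.commShiftIso (n₁ + n₂ : ℤ)).app E ≪≫
          (shiftFunctorAdd' D₁ (n₁ : ℤ) n₂ (n₁ + n₂) rfl).app _).symm
      · exact ((S.τ₂R.commShiftIso (n₁ + n₂ : ℤ)).app E ≪≫
          (shiftFunctorAdd' D₂ (n₂ : ℤ) n₁ (n₁ + n₂) (by ring)).app _).symm
    have h2 := h₅.tStructure.le_shift 0 (-(n₁ + n₂)) (n₁ + n₂) (by ring) _ h1
    exact (h₅.tStructure.le _).prop_of_iso (shiftShiftNeg E (n₁ + n₂ : ℤ)) h2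

end IsConditionFive

namespace IsConditionTwo

variable {C : Type u₃} [Category.{v₃} C] {e₁ : D₁ ≌ C} {e₂ : D₂ ≌ C}

/-- As `i₂` is fully faithful, the counit of its left adjoint is invertible. Under condition 2 that
left adjoint is `τ₁R` up to an equivalence, so `X` is recovered from `τ₁R (i₂ X)`. -/
theorem isZero_of_isZero_gluing (h₂ : h.IsConditionTwo e₁ e₂) {X : D₂}
    (hX : IsZero (h.gluingFunctor.obj X)) : IsZero X := by
  obtain ⟨adj⟩ := h₂
  have h1 : IsZero (h.τ₁R.obj (S.i₂.obj X)) :=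
    ((shiftFunctor D₁ (-1 : ℤ)).map_isZero hX).of_iso (shiftShiftNeg _ (1 : ℤ)).symm
  have h2 : IsZero ((h.τ₁R ⋙ e₁.functor ⋙ e₂.inverse).obj (S.i₂.obj X)) :=
    (e₁.functor ⋙ e₂.inverse).map_isZero h1
  exact h2.of_iso (asIso (adj.counit.app X)).symm

/-- Each object `F` of `D` is an extension of an object of `i₂ D₂` by an object of the kernel of
`τ₁R`. -/
theorem exists_tri (h₂ : h.IsConditionTwo e₁ e₂) (F : D) : ∃ (G : D) (Q : D₂) (f : G ⟶ F)
    (g : F ⟶ S.i₂.obj Q), Tri f g ∧ IsZero (h.τ₁R.obj G) ∧ IsIso (h.τ₁R.map g) := by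
  obtain ⟨adj⟩ := h₂
  obtain ⟨G, f, hT⟩ := Tri.exists_fiber (adj.unit.app F)
  -- By the triangle identity the left adjoint sends the unit to the inverse of a counit, which is
  -- invertible because `i₂` is fully faithful.
  have h1 : IsIso ((e₁.functor ⋙ e₂.inverse).map (h.τ₁R.map (adj.unit.app F))) := by
    have h2 := adj.left_triangle_components F
    have h3 : (e₁.functor ⋙ e₂.inverse).map (h.τ₁R.map (adj.unit.app F)) =
        inv (adj.counit.app _) := by
      rw [← IsIso.eq_comp_inv] at h2
      simpa using h2
    rw [h3]
    infer_instance
  have h4 : IsIso (h.τ₁R.map (adj.unit.app F)) := isIso_of_reflects_iso _ (e₁.functor ⋙ e₂.inverse)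
  exact ⟨G, _, f, _, hT, (hT.map h.τ₁R).isZero₁ h4, h4⟩

end IsConditionTwo

end ConditionOne

end SemiorthogonalDecomposition

end Gluing

/-! ### Slope stability on the glued heart and the tilted t-structure -/

section SlopeStability

variable {D : Type u} [Category.{v} D] [Preadditive D] [HasZeroObject D] [HasShift D ℤ]
  [∀ n : ℤ, (shiftFunctor D n).Additive] [Pretriangulated D]
  {D₁ : Type u₁} [Category.{v₁} D₁] [Preadditive D₁] [HasZeroObject D₁] [HasShift D₁ ℤ]
  [∀ n : ℤ, (shiftFunctor D₁ n).Additive] [Pretriangulated D₁]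
  {D₂ : Type u₂} [Category.{v₂} D₂] [Preadditive D₂] [HasZeroObject D₂] [HasShift D₂ ℤ]
  [∀ n : ℤ, (shiftFunctor D₂ n).Additive] [Pretriangulated D₂]

theorem StabilityCondition.torsion_and_free_of_tri [IsTriangulated D]
    (σ : StabilityCondition D) {X Y Z : D}
    {f : X ⟶ Y} {g : Y ⟶ Z} (hT : Tri f g) (hX : σ.interval (Set.Ici 1) X) (hY : σ.heart Y)
    (hZ : σ.interval (Set.Iio 1) Z) : σ.torsion X ∧ σ.free Z := by
  have h1 := (σ.isCut_Ioi 1).V_fiber hT (σ.interval_mono (fun _ h => h.2) hY)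
    (σ.interval_mono Set.Iio_subset_Iic_self hZ)
  have h2 := (σ.isCut_Ioi 0).U_cone hT (σ.interval_mono (Set.Ici_subset_Ioi.2 one_pos) hX)
    (σ.interval_mono (fun _ h => h.1) hY)
  exact ⟨(σ.torsion_iff X).2 (σ.interval_Icc hX h1), σ.interval_Ioo h2 hZ⟩

namespace SemiorthogonalDecomposition

variable (S : SemiorthogonalDecomposition D D₁ D₂)
  (σ₁ : StabilityCondition D₁) (σ₂ : StabilityCondition D₂) (β ω : ℝ)

/-- The denominator of the slope. -/
noncomputable def rankHom : K0 D →+ ℝ :=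
  Complex.imAddGroupHom.comp (σ₁.Z.comp (K0.map S.τ₁L) + σ₂.Z.comp (K0.map S.τ₂R))

/-- The numerator of the slope. -/
noncomputable def degreeHom : K0 D →+ ℝ :=
  Complex.imAddGroupHom.comp (S.tiltedCharge σ₁ σ₂ β ω)

theorem rankHom_of (E : D) : S.rankHom σ₁ σ₂ (K0.of E) =
    (σ₁.charge (S.τ₁L.obj E)).im + (σ₂.charge (S.τ₂R.obj E)).im := by
  simp [rankHom, StabilityCondition.charge]

theorem tiltedCharge_of (E : D) : S.tiltedCharge σ₁ σ₂ β ω (K0.of E) =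
    σ₁.charge (S.τ₁L.obj E) + ((β : ℂ) - Complex.I * ω) * σ₂.charge (S.τ₂R.obj E) := by
  simp [tiltedCharge, StabilityCondition.charge]

theorem degreeHom_of (E : D) : S.degreeHom σ₁ σ₂ β ω (K0.of E) =
    (σ₁.charge (S.τ₁L.obj E)).im - ω * (σ₂.charge (S.τ₂R.obj E)).re
      + β * (σ₂.charge (S.τ₂R.obj E)).im := by
  change (S.tiltedCharge σ₁ σ₂ β ω (K0.of E)).im = _
  rw [tiltedCharge_of]
  simp
  ring

theorem re_tiltedCharge_of (E : D) : (S.tiltedCharge σ₁ σ₂ β ω (K0.of E)).re =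
    (σ₁.charge (S.τ₁L.obj E)).re + β * (σ₂.charge (S.τ₂R.obj E)).re
      + ω * (σ₂.charge (S.τ₂R.obj E)).im := by
  rw [tiltedCharge_of]
  simp
  ring

theorem slope_eq (E : D) : S.slope σ₁ σ₂ β ω E =
    S.degreeHom σ₁ σ₂ β ω (K0.of E) / S.rankHom σ₁ σ₂ (K0.of E) := by
  rw [degreeHom_of, rankHom_of, slope]

theorem gluedFree_isClosedUnderIsomorphisms :
    (S.gluedFree σ₁ σ₂).IsClosedUnderIsomorphisms := by
  refine ⟨fun e h => ⟨⟨?_, ?_⟩, ?_, ?_⟩⟩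
  · exact (σ₁.interval_isClosedUnderIsomorphisms _).of_iso (S.τ₁L.mapIso e) h.1.1
  · exact (σ₂.interval_isClosedUnderIsomorphisms _).of_iso (S.τ₂R.mapIso e) h.1.2
  · exact (σ₁.interval_isClosedUnderIsomorphisms _).of_iso (S.τ₁L.mapIso e) h.2.1
  · exact (σ₂.interval_isClosedUnderIsomorphisms _).of_iso (S.τ₂R.mapIso e) h.2.2

variable {S σ₁ σ₂}

theorem gluedFree_ext {X Y Z : D} {f : X ⟶ Y} {g : Y ⟶ Z} (hT : Tri f g)
    (hX : S.gluedFree σ₁ σ₂ X) (hZ : S.gluedFree σ₁ σ₂ Z) : S.gluedFree σ₁ σ₂ Y :=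
  ⟨⟨.of_tri (hT.map S.τ₁L) hX.1.1 hZ.1.1, .of_tri (hT.map S.τ₂R) hX.1.2 hZ.1.2⟩,
    .of_tri (hT.map S.τ₁L) hX.2.1 hZ.2.1, .of_tri (hT.map S.τ₂R) hX.2.2 hZ.2.2⟩

theorem gluedFree_zero {X : D} (hX : IsZero X) : S.gluedFree σ₁ σ₂ X :=
  ⟨⟨.zero _ (S.τ₁L.map_isZero hX), .zero _ (S.τ₂R.map_isZero hX)⟩,
    .zero _ (S.τ₁L.map_isZero hX), .zero _ (S.τ₂R.map_isZero hX)⟩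

namespace ConditionOne

namespace IsConditionFive

variable [IsTriangulated D] [IsTriangulated D₁] [IsTriangulated D₂]
  {h : S.ConditionOne} (h₅ : h.IsConditionFive σ₁ σ₂)
include h₅

theorem heart_iff (E : D) : h₅.tStructure.heart E ↔ S.gluedHeart σ₁ σ₂ E := by
  rw [h₅.tStructure_heart]

theorem rank_nonneg {E : D} (hE : h₅.tStructure.heart E) : 0 ≤ S.rankHom σ₁ σ₂ (K0.of E) := by
  rw [rankHom_of]
  have hE := (h₅.heart_iff E).1 hE
  linarith [σ₁.im_charge_nonneg hE.1, σ₂.im_charge_nonneg hE.2]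

theorem gluedTorsion_iff (E : D) : S.gluedTorsion σ₁ σ₂ E ↔
    h₅.tStructure.heart E ∧ S.rankHom σ₁ σ₂ (K0.of E) = 0 := by
  rw [rankHom_of, h₅.heart_iff]
  constructor
  · rintro ⟨h1, h2, h3⟩
    exact ⟨h1, by rw [h2.2, h3.2, add_zero]⟩
  · rintro ⟨h1, h2⟩
    have h3 := σ₁.im_charge_nonneg h1.1
    have h4 := σ₂.im_charge_nonneg h1.2
    exact ⟨h1, ⟨h1.1, by linarith⟩, h1.2, by linarith⟩

theorem exists_ses_torsion_free {E : D} (hE : h₅.tStructure.heart E) :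
    ∃ (X Y : D) (f : X ⟶ E) (g : E ⟶ Y), Ses h₅.tStructure.heart f g ∧
      S.gluedTorsion σ₁ σ₂ X ∧ S.gluedFree σ₁ σ₂ Y := by
  have hE := (h₅.heart_iff E).1 hE
  obtain ⟨X, Y, f, g, hT, hX, hY⟩ := h₅.isCut_one.exists_tri E
  obtain ⟨a1, a2⟩ := σ₁.torsion_and_free_of_tri (hT.map S.τ₁L) hX.1 hE.1 hY.1
  obtain ⟨b1, b2⟩ := σ₂.torsion_and_free_of_tri (hT.map S.τ₂R) hX.2 hE.2 hY.2
  have h1 : S.gluedTorsion σ₁ σ₂ X := ⟨⟨a1.1, b1.1⟩, a1, b1⟩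
  have h2 : S.gluedFree σ₁ σ₂ Y := ⟨⟨σ₁.heart_of_free a2, σ₂.heart_of_free b2⟩, a2, b2⟩
  exact ⟨X, Y, f, g, ⟨(h₅.heart_iff _).2 h1.1, (h₅.heart_iff _).2 hE, (h₅.heart_iff _).2 h2.1, hT⟩,
    h1, h2⟩

theorem isTorsionFree_iff (E : D) :
    IsTorsionFree h₅.tStructure (S.rankHom σ₁ σ₂) E ↔ S.gluedFree σ₁ σ₂ E := by
  constructor
  · rintro ⟨hE, hE'⟩
    obtain ⟨X, Y, f, g, hs, hX, hY⟩ := h₅.exists_ses_torsion_free hE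
    have := hs.tri.isIso₂ (hE' _ _ _ _ hs ((h₅.gluedTorsion_iff X).1 hX).2)
    exact (S.gluedFree_isClosedUnderIsomorphisms σ₁ σ₂).of_iso (asIso g).symm hY
  · intro hE
    refine ⟨(h₅.heart_iff E).2 hE.1, fun K Q f g hs hK => hs.isZero_left ?_⟩
    obtain ⟨-, h1, h2⟩ := (h₅.gluedTorsion_iff K).2 ⟨hs.left, hK⟩
    refine h₅.isCut_one.hom K E ⟨?_, ?_⟩ ⟨?_, ?_⟩ f
    · exact σ₁.interval_mono (fun _ h => h.1) ((σ₁.torsion_iff _).1 h1)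
    · exact σ₂.interval_mono (fun _ h => h.1) ((σ₂.torsion_iff _).1 h2)
    · exact σ₁.interval_mono (fun _ h => h.2) hE.2.1
    · exact σ₂.interval_mono (fun _ h => h.2) hE.2.2

variable {β ω}

theorem degree_nonneg_of_torsion (hω : 0 < ω) {E : D} (hE : S.gluedTorsion σ₁ σ₂ E) :
    0 ≤ S.degreeHom σ₁ σ₂ β ω (K0.of E) := by
  rw [degreeHom_of, hE.2.1.2, hE.2.2.2]
  nlinarith [σ₂.re_charge_nonpos_of_torsion hE.2.2]

/-- The parameters may be arbitrary reals: only the rank has to be discrete, and it does not involve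
them. -/
theorem isSlopeData (hK : AddGroup.FG (K0 D ⧸ AddCommGroup.torsion (K0 D)))
    (hrat₁ : σ₁.IsRational) (hrat₂ : σ₂.IsRational) (hω : 0 < ω) :
    IsSlopeData h₅.tStructure (S.rankHom σ₁ σ₂) (S.degreeHom σ₁ σ₂ β ω) where
  rank_nonneg _ hE := h₅.rank_nonneg hE
  degree_nonneg E hE hd := h₅.degree_nonneg_of_torsion hω ((h₅.gluedTorsion_iff E).2 ⟨hE, hd⟩)
  discrete := by
    obtain ⟨N, hN, h⟩ := exists_denominator hK
      (σ₁.Z.comp (K0.map S.τ₁L) + σ₂.Z.comp (K0.map S.τ₂R)) fun x => by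
        obtain ⟨a, b, hab⟩ := hrat₁ (K0.map S.τ₁L x)
        obtain ⟨c, d, hcd⟩ := hrat₂ (K0.map S.τ₂R x)
        refine ⟨a + c, b + d, ?_⟩
        rw [AddMonoidHom.add_apply, AddMonoidHom.comp_apply, AddMonoidHom.comp_apply, hab, hcd]
        push_cast
        ring
    refine ⟨N, hN, fun x => ?_⟩
    obtain ⟨a, b, hab⟩ := h x
    refine ⟨b, ?_⟩
    have := congrArg Complex.im hab
    simp only [Complex.im_ofReal_mul] at this
    simpa [rankHom] using this
  torsion E hE := by
    obtain ⟨X, Y, f, g, hs, hX, hY⟩ := h₅.exists_ses_torsion_free hE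
    exact ⟨X, Y, f, g, hs, ((h₅.gluedTorsion_iff X).1 hX).2, (h₅.isTorsionFree_iff Y).2 hY⟩

/-- Semistable objects of slope `b` in the glued heart. -/
def Stable (β ω b : ℝ) : ObjectProperty D :=
  SemistableOfSlope h₅.tStructure (S.rankHom σ₁ σ₂) (S.degreeHom σ₁ σ₂ β ω) b

variable (hd : IsSlopeData h₅.tStructure (S.rankHom σ₁ σ₂) (S.degreeHom σ₁ σ₂ β ω))
include hd

theorem isSlopeSemistable_iff (E : D) : S.IsSlopeSemistable σ₁ σ₂ β ω E ↔
    IsSemistable h₅.tStructure (S.rankHom σ₁ σ₂) (S.degreeHom σ₁ σ₂ β ω) E := by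
  rw [IsSlopeSemistable, IsSemistable, h₅.isTorsionFree_iff, ← h₅.tStructure_heart]
  refine and_congr_right fun hE => and_congr_right fun h0 => ?_
  have hE' := (h₅.isTorsionFree_iff E).2 hE
  constructor
  · intro H K Q f g hs
    by_cases hK : IsZero K
    · simp [K0.of_isZero hK]
    · have h1 := H K f (isStrictMono_iff.2 ⟨_, _, hs⟩) hK
      rwa [slope_eq, slope_eq, div_le_div_iff₀ ((hE'.of_sub hs).rank_pos hd hK)
        (hE'.rank_pos hd h0)] at h1
  · intro H K f hf hK
    obtain ⟨Q, g, hs⟩ := isStrictMono_iff.1 hf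
    rw [slope_eq, slope_eq, div_le_div_iff₀ ((hE'.of_sub hs).rank_pos hd hK) (hE'.rank_pos hd h0)]
    exact H _ _ _ _ hs

theorem stable_iff (b : ℝ) (E : D) : h₅.Stable β ω b E ↔
    S.IsSlopeSemistable σ₁ σ₂ β ω E ∧ S.slope σ₁ σ₂ β ω E = b := by
  rw [Stable, SemistableOfSlope, h₅.isSlopeSemistable_iff hd]
  refine and_congr_right fun hE => ?_
  rw [slope_eq, div_eq_iff (hE.1.rank_pos hd hE.2.1).ne']

theorem stable_gluedFree {b : ℝ} {E : D} (hE : h₅.Stable β ω b E) : S.gluedFree σ₁ σ₂ E :=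
  (h₅.isTorsionFree_iff E).1 hE.1.1

theorem filtered_gluedFree {R : ℝ → Prop} {a : ℝ} {E : D}
    (hE : Filtered (fun b X => h₅.Stable β ω b X ∧ R b) a E) : S.gluedFree σ₁ σ₂ E :=
  hE.prop (fun _ hX => gluedFree_zero hX) (fun _ _ _ hX => h₅.stable_gluedFree hd hX.1)
    gluedFree_ext

/-- Harder-Narasimhan filtrations with conditions on the slopes. -/
theorem exists_isSlopeHN_iff (R : ℝ → Prop) (E : D) :
    (∃ (n : ℕ) (F : Fin (n + 1) → D) (A : Fin n → D), S.IsSlopeHN σ₁ σ₂ β ω n F A E ∧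
      ∀ i, R (S.slope σ₁ σ₂ β ω (A i))) ↔
    ∃ a, Filtered (fun b X => h₅.Stable β ω b X ∧ R b) a E := by
  constructor
  · rintro ⟨n, F, A, ⟨h1, h2, h3, h4⟩, h5⟩
    obtain ⟨a, ha⟩ := (Set.finite_range fun i => S.slope σ₁ σ₂ β ω (A i)).bddBelow
    exact ⟨a - 1, Filtered.of_isFiltration h1 h4
      (fun i => ⟨⟨(h₅.stable_iff hd _ _).2 ⟨h3 i, rfl⟩, h5 i⟩, (h3 i).2.1⟩) fun i =>
      (sub_one_lt a).trans_le (ha ⟨i, rfl⟩)⟩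
  · rintro ⟨a, ha⟩
    obtain ⟨n, F, A, φ, h1, h2, h3, h4⟩ := ha.exists_isFiltration
    have h6 : ∀ i, S.slope σ₁ σ₂ β ω (A i) = φ i := fun i =>
      ((h₅.stable_iff hd _ _).1 (h3 i).2.1.1).2
    refine ⟨n, F, A, ⟨h1, fun i => (h₅.filtered_gluedFree hd (h4 i)).1,
      fun i => ((h₅.stable_iff hd _ _).1 (h3 i).2.1.1).1, fun i j hij => ?_⟩, fun i => ?_⟩
    · simp only [h6]
      exact h2 hij
    · rw [h6]
      exact (h3 i).2.1.2

theorem tiltFree_iff (E : D) : S.tiltFree σ₁ σ₂ β ω E ↔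
    ∃ a, Filtered (fun b X => h₅.Stable β ω b X ∧ b ≤ 0) a E := by
  rw [tiltFree, h₅.exists_isSlopeHN_iff hd (· ≤ 0) E]
  exact and_iff_right_of_imp fun ⟨a, ha⟩ => h₅.filtered_gluedFree hd ha

theorem tiltTorsion_iff (E : D) : S.tiltTorsion σ₁ σ₂ β ω E ↔
    ∃ (X Y : D) (f : X ⟶ E) (g : E ⟶ Y), Ses h₅.tStructure.heart f g ∧ S.gluedTorsion σ₁ σ₂ X ∧
      ∃ a, Filtered (fun b X => h₅.Stable β ω b X ∧ 0 < b) a Y := by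
  constructor
  · rintro ⟨hE, X, Y, f, g, w, hT, hX, hY, hn⟩
    exact ⟨X, Y, f, g, ⟨(h₅.heart_iff _).2 hX.1, (h₅.heart_iff _).2 hE, (h₅.heart_iff _).2 hY.1,
      w, hT⟩, hX, (h₅.exists_isSlopeHN_iff hd (0 < ·) Y).1 hn⟩
  · rintro ⟨X, Y, f, g, ⟨-, hE, -, w, hT⟩, hX, hn⟩
    exact ⟨(h₅.heart_iff _).1 hE, X, Y, f, g, w, hT, hX, h₅.filtered_gluedFree hd hn.choose_spec,
      (h₅.exists_isSlopeHN_iff hd (0 < ·) Y).2 hn⟩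

/-- Cut the Harder-Narasimhan filtration of the free part at slope `0`. The torsion part joins the
factors of positive slope, as it has no maps to free objects. -/
theorem isTorsionPair :
    IsTorsionPair h₅.tStructure (S.tiltTorsion σ₁ σ₂ β ω) (S.tiltFree σ₁ σ₂ β ω) where
  isoT := by
    refine ⟨fun e hE => ?_⟩
    obtain ⟨X, Y, f, g, hs, hX, hn⟩ := (h₅.tiltTorsion_iff hd _).1 hE
    exact (h₅.tiltTorsion_iff hd _).2 ⟨X, Y, _, _, ⟨hs.left, heart_of_iso e hs.mid, hs.right,
      hs.tri.of_iso₂ e.symm⟩, hX, hn⟩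
  isoF := by
    refine ⟨fun e hE => ?_⟩
    obtain ⟨a, ha⟩ := (h₅.tiltFree_iff hd _).1 hE
    exact (h₅.tiltFree_iff hd _).2 ⟨a, ha.of_iso e.symm⟩
  heartT E hE := (h₅.heart_iff E).2 hE.1
  heartF E hE := (h₅.heart_iff E).2 hE.1.1
  hom X Y hX hY := by
    obtain ⟨K, Q, f, g, hs, hK, c, hc⟩ := (h₅.tiltTorsion_iff hd X).1 hX
    obtain ⟨a, ha⟩ := (h₅.tiltFree_iff hd Y).1 hY
    refine hs.tri.homZero_left ?_ ?_
    · exact IsTorsionFree.homZero_of_rank_eq_zero hd hs.left ((h₅.gluedTorsion_iff K).1 hK).2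
        ((h₅.isTorsionFree_iff Y).2 hY.1)
    · exact hc.homZero le_rfl fun b _ B hB => ha.homZero_right fun b' _ B' hB' =>
        hd.homZero_of_slope_lt (hB'.2.trans_lt hB.2) hB.1 hB'.1
  tri E hE := by
    obtain ⟨K, Q, f, g, hs, hK, hQ⟩ := h₅.exists_ses_torsion_free hE
    obtain ⟨a, ha⟩ := hd.exists_filtered ((h₅.isTorsionFree_iff Q).2 hQ)
    obtain ⟨X, Y, f', g', hT, hX, hY⟩ := ha.split (isUpperSet_Ioi (0 : ℝ))
    have hY' : Filtered (fun b X => h₅.Stable β ω b X ∧ b ≤ 0) a Y :=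
      hY.imp (fun b _ B hB => ⟨hB.1, not_lt.1 hB.2⟩) le_rfl
    have hXh := (h₅.heart_iff X).2 (h₅.filtered_gluedFree (R := (0 < ·)) hd hX).1
    have hYh := (h₅.heart_iff Y).2 (h₅.filtered_gluedFree hd hY').1
    obtain ⟨C, k, x, y, h1, h2⟩ := hs.comp_epi ⟨hXh, hs.right, hYh, hT⟩
    exact extensionProduct_of_tri h1.tri ((h₅.tiltTorsion_iff hd C).2 ⟨K, X, x, y, h2, hK, a, hX⟩)
      ((h₅.tiltFree_iff hd Y).2 ⟨a, hY'⟩)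

/-- The tilted t-structure. -/
def tilt : Triangulated.TStructure D := (h₅.isTorsionPair hd).tilt

theorem tilt_heart_iff (E : D) : (h₅.tilt hd).heart E ↔
    ∃ (X Y : D) (f : X⟦(1 : ℤ)⟧ ⟶ E) (g : E ⟶ Y), Tri f g ∧
      S.tiltFree σ₁ σ₂ β ω X ∧ S.tiltTorsion σ₁ σ₂ β ω Y :=
  (h₅.isTorsionPair hd).tilt_heart_iff E

theorem tilt_heart : (h₅.tilt hd).heart = S.tiltedHeart σ₁ σ₂ β ω := by
  ext E
  rw [h₅.tilt_heart_iff hd]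
  constructor
  · rintro ⟨X, Y, f, g, ⟨w, hw⟩, hX, hY⟩
    exact ⟨X, Y, f, g, w, hw, hX, hY⟩
  · rintro ⟨X, Y, f, g, w, hw, hX, hY⟩
    exact ⟨X, Y, f, g, ⟨w, hw⟩, hX, hY⟩

theorem tilt_bounded (E : D) : (h₅.tilt hd).bounded E :=
  (h₅.isTorsionPair hd).tilt_bounded h₅.tStructure_bounded E

theorem degree_of_stable {b : ℝ} {E : D} (hE : h₅.Stable β ω b E) :
    S.degreeHom σ₁ σ₂ β ω (K0.of E) = b * S.rankHom σ₁ σ₂ (K0.of E) ∧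
      0 < S.rankHom σ₁ σ₂ (K0.of E) :=
  ⟨hE.2, hE.1.1.rank_pos hd hE.1.2.1⟩

theorem degree_nonneg_of_filtered {R : ℝ → Prop} (hR : ∀ b, R b → 0 ≤ b) {a : ℝ} {E : D}
    (hE : Filtered (fun b X => h₅.Stable β ω b X ∧ R b) a E) :
    0 ≤ S.degreeHom σ₁ σ₂ β ω (K0.of E) := by
  refine hE.prop (Q := fun E => 0 ≤ S.degreeHom σ₁ σ₂ β ω (K0.of E))
    (fun X hX => by rw [K0.of_isZero hX, map_zero]) (fun b _ X hX => ?_)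
    (fun hT h1 h2 => by rw [K0.of_tri hT, map_add]; linarith)
  obtain ⟨h1, h2⟩ := h₅.degree_of_stable hd hX.1
  rw [h1]
  exact mul_nonneg (hR b hX.2) h2.le

theorem degree_nonpos_of_filtered {R : ℝ → Prop} (hR : ∀ b, R b → b ≤ 0) {a : ℝ} {E : D}
    (hE : Filtered (fun b X => h₅.Stable β ω b X ∧ R b) a E) :
    S.degreeHom σ₁ σ₂ β ω (K0.of E) ≤ 0 := by
  refine hE.prop (Q := fun E => S.degreeHom σ₁ σ₂ β ω (K0.of E) ≤ 0)
    (fun X hX => by rw [K0.of_isZero hX, map_zero]) (fun b _ X hX => ?_)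
    (fun hT h1 h2 => by rw [K0.of_tri hT, map_add]; linarith)
  obtain ⟨h1, h2⟩ := h₅.degree_of_stable hd hX.1
  rw [h1]
  exact mul_nonpos_of_nonpos_of_nonneg (hR b hX.2) h2.le

theorem isZero_of_filtered_pos {a : ℝ} {E : D}
    (hE : Filtered (fun b X => h₅.Stable β ω b X ∧ 0 < b) a E)
    (h0 : S.degreeHom σ₁ σ₂ β ω (K0.of E) = 0) : IsZero E := by
  cases hE with
  | zero _ _ h => exact h
  | snoc h1 h2 h3 h4 h5 =>
    have h6 := h₅.degree_nonneg_of_filtered hd (fun _ h => le_of_lt h) h1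
    obtain ⟨h7, h8⟩ := h₅.degree_of_stable hd h3.1
    rw [K0.of_tri h2, map_add, h7] at h0
    nlinarith [mul_pos h3.2 h8]

theorem isZero_of_filtered_neg {a : ℝ} {E : D}
    (hE : Filtered (fun b X => h₅.Stable β ω b X ∧ b < 0) a E)
    (h0 : S.degreeHom σ₁ σ₂ β ω (K0.of E) = 0) : IsZero E := by
  cases hE with
  | zero _ _ h => exact h
  | snoc h1 h2 h3 h4 h5 =>
    have h6 := h₅.degree_nonpos_of_filtered hd (fun _ h => le_of_lt h) h1
    obtain ⟨h7, h8⟩ := h₅.degree_of_stable hd h3.1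
    rw [K0.of_tri h2, map_add, h7] at h0
    nlinarith [mul_pos (neg_pos.2 h3.2) h8]

theorem degree_nonpos {E : D} (hE : S.tiltFree σ₁ σ₂ β ω E) :
    S.degreeHom σ₁ σ₂ β ω (K0.of E) ≤ 0 := by
  obtain ⟨a, ha⟩ := (h₅.tiltFree_iff hd E).1 hE
  exact h₅.degree_nonpos_of_filtered hd (fun _ h => h) ha

theorem degree_nonneg (hω : 0 < ω) {E : D} (hE : S.tiltTorsion σ₁ σ₂ β ω E) :
    0 ≤ S.degreeHom σ₁ σ₂ β ω (K0.of E) := by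
  obtain ⟨X, Y, f, g, hs, hX, a, ha⟩ := (h₅.tiltTorsion_iff hd E).1 hE
  rw [hs.map_eq]
  exact add_nonneg (h₅.degree_nonneg_of_torsion hω hX)
    (h₅.degree_nonneg_of_filtered hd (fun _ h => le_of_lt h) ha)

end IsConditionFive

end ConditionOne

end SemiorthogonalDecomposition

end SlopeStability

/-! ### The central charge on the tilted heart -/

section CentralCharge

variable {D : Type u} [Category.{v} D] [Preadditive D] [HasZeroObject D] [HasShift D ℤ]
  [∀ n : ℤ, (shiftFunctor D n).Additive] [Pretriangulated D] [IsTriangulated D]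
  {D₁ : Type u₁} [Category.{v₁} D₁] [Preadditive D₁] [HasZeroObject D₁] [HasShift D₁ ℤ]
  [∀ n : ℤ, (shiftFunctor D₁ n).Additive] [Pretriangulated D₁] [IsTriangulated D₁]
  {D₂ : Type u₂} [Category.{v₂} D₂] [Preadditive D₂] [HasZeroObject D₂] [HasShift D₂ ℤ]
  [∀ n : ℤ, (shiftFunctor D₂ n).Additive] [Pretriangulated D₂] [IsTriangulated D₂]

theorem StabilityCondition.charge_of_iso (σ : StabilityCondition D) {X Y : D} (e : X ≅ Y) :
    σ.charge X = σ.charge Y := by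
  rw [charge, charge, K0.of_iso e]

theorem Tri.nonempty_iso₃ {X Y Z Z' : D} {f : X ⟶ Y} {g : Y ⟶ Z} {g' : Y ⟶ Z'} (h : Tri f g)
    (h' : Tri f g') : Nonempty (Z ≅ Z') := by
  obtain ⟨w, hw⟩ := h
  obtain ⟨w', hw'⟩ := h'
  exact ⟨Triangle.π₃.mapIso (isoTriangleOfIso₁₂ _ _ hw hw' (Iso.refl X) (Iso.refl Y)
    ((Category.comp_id f).trans (Category.id_comp f).symm))⟩

namespace SemiorthogonalDecomposition

variable {S : SemiorthogonalDecomposition D D₁ D₂}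
  {σ₁ : StabilityCondition D₁} {σ₂ : StabilityCondition D₂} {β ω : ℝ}

theorem nonempty_iso_i₁ {E : D} (hE : IsZero (S.τ₂R.obj E)) :
    Nonempty (E ≅ S.i₁.obj (S.τ₁L.obj E)) := by
  obtain ⟨f, g, hT⟩ := S.exists_tri E
  have := hT.isIso₂ (S.i₂.map_isZero hE)
  exact ⟨asIso g⟩

theorem rankHom_i₁ (X : D₁) : S.rankHom σ₁ σ₂ (K0.of (S.i₁.obj X)) = (σ₁.charge X).im := by
  rw [rankHom_of, σ₁.charge_of_iso (S.τ₁LIso X), σ₂.charge_of_isZero (S.isZero₂₁ X)]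
  simp

theorem degreeHom_i₁ (X : D₁) :
    S.degreeHom σ₁ σ₂ β ω (K0.of (S.i₁.obj X)) = (σ₁.charge X).im := by
  rw [degreeHom_of, σ₁.charge_of_iso (S.τ₁LIso X), σ₂.charge_of_isZero (S.isZero₂₁ X)]
  simp

namespace ConditionOne

namespace IsConditionFive

variable {h : S.ConditionOne} (h₅ : h.IsConditionFive σ₁ σ₂)
include h₅

theorem heart_i₁ {X : D₁} (hX : σ₁.heart X) : h₅.tStructure.heart (S.i₁.obj X) :=
  (h₅.heart_iff _).2 ⟨σ₁.heart_isClosedUnderIsomorphisms.of_iso (S.τ₁LIso X).symm hX,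
    .zero _ (S.isZero₂₁ X)⟩

theorem isZero_τ₂R_of_ses {K Y Q : D} {f : K ⟶ Y} {g : Y ⟶ Q} (hs : Ses h₅.tStructure.heart f g)
    (hY : IsZero (S.τ₂R.obj Y)) : IsZero (S.τ₂R.obj K) := by
  refine (hs.tri.map S.τ₂R).isZero_of_eq_zero₁ (hY.eq_of_tgt _ _) ?_
  refine heart_hom (t := σ₂.tStructure) ?_ ?_ one_pos
  · rw [σ₂.tStructure_heart]
    exact ((h₅.heart_iff K).1 hs.left).2
  · rw [σ₂.tStructure_heart]
    exact ((h₅.heart_iff Q).1 hs.right).2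

/-- Subobjects of `i₁ X` in the glued heart come from `D₁`, where rank and degree are both `Im Z₁`.
Hence all slopes are `1`, whatever `β` and `ω`. -/
theorem stable_i₁ {X : D₁} (hX : σ₁.free X) (h0 : ¬ IsZero X) :
    h₅.Stable β ω 1 (S.i₁.obj X) := by
  have h1 : S.gluedFree σ₁ σ₂ (S.i₁.obj X) :=
    ⟨(h₅.heart_iff _).1 (h₅.heart_i₁ (σ₁.heart_of_free hX)),
      (σ₁.interval_isClosedUnderIsomorphisms _).of_iso (S.τ₁LIso X).symm hX,
      .zero _ (S.isZero₂₁ X)⟩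
  refine ⟨⟨(h₅.isTorsionFree_iff _).2 h1, fun h2 => h0 (isZero_of_map h2), ?_⟩, ?_⟩
  · intro K Q f g hs
    obtain ⟨e⟩ := nonempty_iso_i₁ (h₅.isZero_τ₂R_of_ses hs (S.isZero₂₁ X))
    rw [K0.of_iso e, rankHom_i₁, degreeHom_i₁, rankHom_i₁, degreeHom_i₁, mul_comm]
  · rw [rankHom_i₁, degreeHom_i₁, one_mul]

variable (hd : IsSlopeData h₅.tStructure (S.rankHom σ₁ σ₂) (S.degreeHom σ₁ σ₂ β ω))
include hd

theorem tiltTorsion_i₁ {X : D₁} (hX : σ₁.heart X) : S.tiltTorsion σ₁ σ₂ β ω (S.i₁.obj X) := by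
  obtain ⟨K, Q, f, g, hT, hK, hQ⟩ := σ₁.exists_tri_of_heart hX
  have hK' := (σ₁.torsion_iff K).2 hK
  refine (h₅.tiltTorsion_iff hd _).2 ⟨_, _, _, _, ⟨h₅.heart_i₁ hK'.1, h₅.heart_i₁ hX,
    h₅.heart_i₁ (σ₁.heart_of_free hQ), hT.map S.i₁⟩, ?_, 0, ?_⟩
  · refine (h₅.gluedTorsion_iff _).2 ⟨h₅.heart_i₁ hK'.1, ?_⟩
    rw [rankHom_i₁]
    exact hK'.2
  · by_cases h0 : IsZero Q
    · exact .zero _ _ (S.i₁.map_isZero h0)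
    · exact .of_mem ⟨h₅.stable_i₁ hQ h0, one_pos⟩ one_pos

/-- Right exactness of `i₁` for the tilted t-structure, since `i₁` sends the heart of `σ₁` into the
torsion class. By adjunction it yields left exactness of `τ₁R`. -/
theorem tilt_le_i₁ {X : D₁} (hX : σ₁.interval (Set.Ioi 0) X) :
    (h₅.tilt hd).le 0 (S.i₁.obj X) := by
  obtain ⟨A, B, f, g, hT, hA, hB⟩ := (σ₁.isCut_Ioi 1).exists_tri X
  have hB' := (σ₁.isCut_Ioi 0).U_cone hT
    (σ₁.interval_mono (Set.Ioi_subset_Ioi zero_le_one) hA) hX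
  rw [tilt, IsTorsionPair.tilt, IsCut.toTStructure_le_zero]
  refine extensionProduct_of_tri (hT.map S.i₁) ?_ (h₅.tiltTorsion_i₁ hd (σ₁.interval_Ioc hB' hB))
  have h1 : h₅.tStructure.le 0 (S.i₁.obj (A⟦(-1 : ℤ)⟧)) := by
    rw [tStructure, IsCut.toTStructure_le_zero]
    refine ⟨(σ₁.interval_isClosedUnderIsomorphisms _).of_iso (S.τ₁LIso _).symm ?_,
      .zero _ (S.isZero₂₁ _)⟩
    exact σ₁.interval_shift_neg_one (fun φ (hφ : 1 < φ) => Set.mem_Ioi.2 (by linarith)) hA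
  have h2 := h₅.tStructure.le_shift 0 1 (-1) (by norm_num) _ h1
  exact (h₅.tStructure.le (-1)).prop_of_iso
    ((S.i₁.commShiftIso (1 : ℤ)).symm.app _ ≪≫ S.i₁.mapIso (shiftNegShift A (1 : ℤ))) h2

theorem τ₁R_of_ge {E : D} (hE : (h₅.tilt hd).ge 0 E) :
    σ₁.interval (Set.Iic 1) (h.τ₁R.obj E) := by
  have h1 : (h₅.tilt hd).ge 1 (E⟦(-1 : ℤ)⟧) := (h₅.tilt hd).ge_shift 0 (-1) 1 (by norm_num) _ hE
  have h2 : σ₁.interval (Set.Iic 0) (h.τ₁R.obj (E⟦(-1 : ℤ)⟧)) :=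
    ((σ₁.isCut_Ioi 0).V_iff _).2 fun X hX => HomZero.of_adjunction' h.adj
      (hom_of_le_ge _ (h₅.tilt_le_i₁ hd hX) h1 one_pos)
  refine σ₁.interval_of_shift_neg_one (fun φ (hφ : φ ≤ 0) => Set.mem_Iic.2 (by linarith))
    ((σ₁.interval_isClosedUnderIsomorphisms _).of_iso ((h.τ₁R.commShiftIso (-1 : ℤ)).app E) h2)

/-- The lower bound on the phases comes from the triangle with outer terms `Φ(τ₂R F)` and `(τ₁L
F)⟦1⟧`, the upper bound from left exactness of `τ₁R` applied to `F⟦1⟧` in the tilted heart. -/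
theorem τ₁R_shift_of_tiltFree {F : D} (hF : S.tiltFree σ₁ σ₂ β ω F) :
    σ₁.heart ((h.τ₁R.obj F)⟦(1 : ℤ)⟧) := by
  refine σ₁.interval_Ioc ?_ ?_
  · obtain ⟨f, g, hT⟩ := S.exists_tri F
    refine (σ₁.isCut_Ioi 0).U_ext ((hT.map h.τ₁R).shift 1) ?_ ?_
    · exact σ₁.interval_mono (fun _ hφ => hφ.1) (h₅.map_heart hF.1.1.2)
    · refine (σ₁.isCut_Ioi 0).shiftU _ ((σ₁.interval_isClosedUnderIsomorphisms _).of_iso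
        (h.τ₁RIso _) ?_)
      exact σ₁.interval_mono (fun _ hφ => hφ.1) hF.1.1.1
  · have h1 := (h₅.isTorsionPair hd).tilt_heart_of_F hF
    exact (σ₁.interval_isClosedUnderIsomorphisms _).of_iso ((h.τ₁R.commShiftIso (1 : ℤ)).app F)
      (h₅.τ₁R_of_ge hd h1.2)

/-- An inequality of Bogomolov-Gieseker type. -/
theorem re_charge_pos (hω : 0 < ω) {C : Type u₃} [Category.{v₃} C] {e₁ : D₁ ≌ C} {e₂ : D₂ ≌ C}
    (h₂ : h.IsConditionTwo e₁ e₂) {F : D} (hF : S.tiltFree σ₁ σ₂ β ω F)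
    (hn : S.degreeHom σ₁ σ₂ β ω (K0.of F) = 0) (h0 : ¬ IsZero F) :
    0 < (S.tiltedCharge σ₁ σ₂ β ω (K0.of F)).re := by
  obtain ⟨G, Q, f, g, hT, hG, hg⟩ := h₂.exists_tri F
  -- `Φ Q` is isomorphic to `(τ₁R F)⟦1⟧`, which lies in the heart of `σ₁`, and `Φ` reflects hearts.
  have hQ : σ₂.heart Q := by
    refine h₅.heart_of_map (fun X hX => h₂.isZero_of_isZero_gluing hX) ?_
    exact σ₁.heart_isClosedUnderIsomorphisms.of_iso
      ((shiftFunctor D₁ (1 : ℤ)).mapIso (asIso (h.τ₁R.map g))) (h₅.τ₁R_shift_of_tiltFree hd hF)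
  have := (hT.map S.τ₁L).isIso₁ (S.isZero₁₂ Q)
  have eF : S.τ₁L.obj G ≅ S.τ₁L.obj F := asIso (S.τ₁L.map f)
  obtain ⟨a, b, hab⟩ := S.exists_tri G
  -- Because `τ₁R G = 0`, the connecting map from `τ₁L G` to `Φ(τ₂R G)` is an isomorphism.
  obtain ⟨w, hw, -⟩ := (hab.map h.τ₁R).rotate_shift
  have := hw.isIso₂ hG
  have eΦ : h.gluingFunctor.obj (S.τ₂R.obj G) ≅ S.τ₁L.obj F :=
    (asIso w).symm ≪≫ (h.τ₁RIso _).symm ≪≫ eF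
  have hF₁ := (h₅.heart_iff F).2 hF.1.1
  have hG₂ : σ₂.heart (S.τ₂R.obj G) :=
    h₅.heart_of_map (fun X hX => h₂.isZero_of_isZero_gluing hX)
      (σ₁.heart_isClosedUnderIsomorphisms.of_iso eΦ.symm hF.1.1.1)
  have hs : Ses h₅.tStructure.heart f g :=
    ⟨(h₅.heart_iff G).2 ⟨σ₁.heart_isClosedUnderIsomorphisms.of_iso eF.symm hF.1.1.1, hG₂⟩, hF₁,
      (h₅.heart_iff _).2 ⟨.zero _ (S.isZero₁₂ Q),
        σ₂.heart_isClosedUnderIsomorphisms.of_iso (S.τ₂RIso Q) hQ⟩, hT⟩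
  -- As a subobject of `F`, `G` is in the torsion-free class. Its two charges are both equal to `x₁
  -- + i y₁`, so this reads `(1 + β) y₁ ≤ ω x₁`.
  have h1 := h₅.degree_nonpos hd ((h₅.isTorsionPair hd).F_sub hs hF)
  have h2 : σ₂.charge (S.τ₂R.obj G) = σ₁.charge (S.τ₁L.obj F) := by
    rw [h₅.charge_eq _ hG₂, σ₁.charge_of_iso eΦ]
  have h3 := congrArg Complex.im (σ₂.charge_of_tri (hT.map S.τ₂R))
  have h4 : 0 ≤ (σ₂.charge (S.τ₂R.obj (S.i₂.obj Q))).im := by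
    rw [← σ₂.charge_of_iso (S.τ₂RIso Q)]
    exact σ₂.im_charge_nonneg hQ
  have h5 := σ₁.im_charge_nonneg hF.1.1.1
  have h6 := ((h₅.isTorsionFree_iff F).2 hF.1).rank_pos hd h0
  rw [rankHom_of] at h6
  rw [Complex.add_im, h2] at h3
  rw [degreeHom_of, h2, σ₁.charge_of_iso eF] at h1
  rw [degreeHom_of] at hn
  rw [re_tiltedCharge_of]
  set x₁ := (σ₁.charge (S.τ₁L.obj F)).re
  set y₁ := (σ₁.charge (S.τ₁L.obj F)).im
  set x₂ := (σ₂.charge (S.τ₂R.obj F)).re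
  set y₂ := (σ₂.charge (S.τ₂R.obj F)).im
  have h7 : y₁ ≤ y₂ := by linarith
  have h8 : 0 < y₂ := by linarith
  -- Multiply `h1` by `y₂` and substitute `ω x₂ = y₁ + β y₂` from `hn`: the left side of the claim
  -- is bounded below by `y₁ (y₂ - y₁)`.
  have h9 : 0 ≤ ω * (y₂ * x₁ - y₁ * x₂) := by
    nlinarith [mul_nonneg h5 (sub_nonneg.2 h7), mul_nonneg h8.le (sub_nonneg.2 h1)]
  have h10 := nonneg_of_mul_nonneg_right h9 hω
  -- Again by `hn`, `β y₂ = ω x₂ - y₁`, which completes the square `ω (x₂² + y₂²)`.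
  have h11 : 0 < y₂ * (x₁ + β * x₂ + ω * y₂) := by
    have : y₂ * (x₁ + β * x₂ + ω * y₂) = (y₂ * x₁ - y₁ * x₂) + ω * (x₂ ^ 2 + y₂ ^ 2) := by
      linear_combination x₂ * hn
    rw [this]
    positivity
  exact pos_of_mul_pos_right h11 h8.le

/-- Both the torsion part and the free part have nonnegative degree. Degree `0` kills the free part,
whose slopes are positive, and then forces `Re Z₂ = 0` on the torsion part. The first component of a
torsion object does not contribute to the degree and may survive. -/
theorem of_degree_eq_zero (hω : 0 < ω) {E : D} (hE : S.tiltTorsion σ₁ σ₂ β ω E)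
    (hn : S.degreeHom σ₁ σ₂ β ω (K0.of E) = 0) :
    IsZero (S.τ₂R.obj E) ∧ σ₁.torsion (S.τ₁L.obj E) := by
  obtain ⟨X, Y, f, g, hs, hX, a, ha⟩ := (h₅.tiltTorsion_iff hd E).1 hE
  have h1 := h₅.degree_nonneg_of_torsion (β := β) hω hX
  have h2 := h₅.degree_nonneg_of_filtered hd (fun _ h => le_of_lt h) ha
  rw [hs.map_eq] at hn
  have := hs.tri.isIso₁ (h₅.isZero_of_filtered_pos hd ha (by linarith))
  have h3 : S.degreeHom σ₁ σ₂ β ω (K0.of X) = 0 := by linarith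
  rw [degreeHom_of, hX.2.1.2, hX.2.2.2] at h3
  have h4 : (σ₂.charge (S.τ₂R.obj X)).re = 0 := by
    have : ω * (σ₂.charge (S.τ₂R.obj X)).re = 0 := by linarith
    exact (mul_eq_zero.1 this).resolve_left hω.ne'
  refine ⟨(σ₂.isZero_of_torsion hX.2.2 h4).of_iso (S.τ₂R.mapIso (asIso f)).symm, ?_⟩
  rw [σ₁.torsion_iff]
  exact (σ₁.interval_isClosedUnderIsomorphisms _).of_iso (S.τ₁L.mapIso (asIso f))
    ((σ₁.torsion_iff _).1 hX.2.1)

theorem tilt_degree_nonneg (hω : 0 < ω) {E : D} (hE : (h₅.tilt hd).heart E) :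
    0 ≤ S.degreeHom σ₁ σ₂ β ω (K0.of E) := by
  obtain ⟨F, T, f, g, hT, hF, hT'⟩ := (h₅.tilt_heart_iff hd E).1 hE
  rw [K0.of_tri hT, map_add, K0.of_shift_one, map_neg]
  linarith [h₅.degree_nonpos hd hF, h₅.degree_nonneg hd hω hT']

/-- Both constituents have degree `0`: `F⟦1⟧` contributes `-Re Z_{β,ω}(F)`, negative by
`re_charge_pos` unless `F = 0`, and `T` comes from objects of phase `1` in `D₁`. -/
theorem tilt_re_charge_neg (hω : 0 < ω) {C : Type u₃} [Category.{v₃} C] {e₁ : D₁ ≌ C}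
    {e₂ : D₂ ≌ C} (h₂ : h.IsConditionTwo e₁ e₂) {E : D} (hE : (h₅.tilt hd).heart E)
    (hn : S.degreeHom σ₁ σ₂ β ω (K0.of E) = 0) (h0 : ¬ IsZero E) :
    (S.tiltedCharge σ₁ σ₂ β ω (K0.of E)).re < 0 := by
  obtain ⟨F, T, f, g, hT, hF, hT'⟩ := (h₅.tilt_heart_iff hd E).1 hE
  have h1 := h₅.degree_nonpos hd hF
  have h2 := h₅.degree_nonneg hd hω hT'
  rw [K0.of_tri hT, map_add, K0.of_shift_one, map_neg] at hn
  obtain ⟨h3, h4⟩ := h₅.of_degree_eq_zero hd hω hT' (by linarith)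
  have h5 : (S.tiltedCharge σ₁ σ₂ β ω (K0.of T)).re = (σ₁.charge (S.τ₁L.obj T)).re := by
    rw [re_tiltedCharge_of, σ₂.charge_of_isZero h3]
    simp
  have h6 := σ₁.re_charge_nonpos_of_torsion h4
  rw [K0.of_tri hT, map_add, K0.of_shift_one, map_neg, Complex.add_re, Complex.neg_re, h5]
  by_cases hF0 : IsZero F
  · rw [K0.of_isZero hF0, map_zero, Complex.zero_re, neg_zero, zero_add]
    refine lt_of_le_of_ne h6 fun h7 => h0 ?_
    exact hT.isZero₂ ((shiftFunctor D (1 : ℤ)).map_isZero hF0)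
      (S.isZero_of_components (σ₁.isZero_of_torsion h4 h7) h3)
  · linarith [h₅.re_charge_pos hd hω h₂ hF (by linarith) hF0]

theorem isCentralCharge (hω : 0 < ω) {C : Type u₃} [Category.{v₃} C] {e₁ : D₁ ≌ C}
    {e₂ : D₂ ≌ C} (h₂ : h.IsConditionTwo e₁ e₂) :
    IsCentralCharge (h₅.tilt hd).heart (S.tiltedCharge σ₁ σ₂ β ω) := by
  refine fun E hE h0 => ⟨?_, Complex.arg_le_pi _⟩
  have h1 : 0 ≤ (S.tiltedCharge σ₁ σ₂ β ω (K0.of E)).im := h₅.tilt_degree_nonneg hd hω hE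
  refine lt_of_le_of_ne (Complex.arg_nonneg_iff.2 h1) fun h2 => ?_
  obtain ⟨h3, h4⟩ := Complex.arg_eq_zero_iff.1 h2.symm
  exact (h₅.tilt_re_charge_neg hd hω h₂ hE h4 h0).not_ge h3

/-! ### Torsion-free objects of the tilted heart -/

/-- All slopes of `G` are `≤ 0` and its degree is `0`, so its part of negative slope vanishes and
only slope `0` remains. -/
theorem homZero_of_degree_eq_zero {G Y : D} (hG : S.tiltFree σ₁ σ₂ β ω G)
    (hn : S.degreeHom σ₁ σ₂ β ω (K0.of G) = 0) {a : ℝ}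
    (hY : Filtered (fun b X => h₅.Stable β ω b X ∧ b < 0) a Y) : HomZero G Y := by
  obtain ⟨c, hc⟩ := (h₅.tiltFree_iff hd G).1 hG
  obtain ⟨X, Z, f, g, hT, hX, hZ⟩ := hc.split (isUpperSet_Ici (0 : ℝ))
  have hX' : Filtered (fun b X => h₅.Stable β ω b X ∧ 0 ≤ b) c X :=
    hX.imp (fun b _ B hB => ⟨hB.1.1, hB.2⟩) le_rfl
  have hX'' : Filtered (fun b X => h₅.Stable β ω b X ∧ b ≤ 0) c X :=
    hX.imp (fun b _ B hB => hB.1) le_rfl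
  have hZ' : Filtered (fun b X => h₅.Stable β ω b X ∧ b < 0) c Z :=
    hZ.imp (fun b _ B hB => ⟨hB.1.1, not_le.1 hB.2⟩) le_rfl
  have h1 := h₅.degree_nonneg_of_filtered hd (fun _ h => h) hX'
  have h2 := h₅.degree_nonpos_of_filtered hd (fun _ h => h) hX''
  rw [K0.of_tri hT, map_add] at hn
  refine hT.homZero_left ?_
    (HomZero.of_isZero_left (h₅.isZero_of_filtered_neg hd hZ' (by linarith)))
  exact hX'.homZero le_rfl fun b _ B hB => hY.homZero_right fun b' _ B' hB' =>
    hd.homZero_of_slope_lt (hB'.2.trans_le hB.2) hB.1 hB'.1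

/-- Divide by `X⟦1⟧`, where `X` is the slope-`0` part of `F`. The quotient is an extension of `T` by
the shift of an object of negative slopes, and `G⟦1⟧` maps to neither. -/
theorem exists_ses_homZero_shift {E : D} (hE : (h₅.tilt hd).heart E) :
    ∃ (K E' : D) (f : K ⟶ E) (g : E ⟶ E'), Ses (h₅.tilt hd).heart f g ∧
      S.degreeHom σ₁ σ₂ β ω (K0.of K) = 0 ∧ ∀ G, S.tiltFree σ₁ σ₂ β ω G →
        S.degreeHom σ₁ σ₂ β ω (K0.of G) = 0 → HomZero (G⟦(1 : ℤ)⟧) E' := by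
  obtain ⟨F, T, f, g, hT, hF, hT'⟩ := (h₅.tilt_heart_iff hd E).1 hE
  obtain ⟨c, hc⟩ := (h₅.tiltFree_iff hd F).1 hF
  obtain ⟨X, Z, x, z, hXZ, hX, hZ⟩ := hc.split (isUpperSet_Ici (0 : ℝ))
  have hX' : Filtered (fun b X => h₅.Stable β ω b X ∧ 0 ≤ b) c X :=
    hX.imp (fun b _ B hB => ⟨hB.1.1, hB.2⟩) le_rfl
  have hX'' : Filtered (fun b X => h₅.Stable β ω b X ∧ b ≤ 0) c X :=
    hX.imp (fun b _ B hB => hB.1) le_rfl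
  have hZ' : Filtered (fun b X => h₅.Stable β ω b X ∧ b < 0) c Z :=
    hZ.imp (fun b _ B hB => ⟨hB.1.1, not_le.1 hB.2⟩) le_rfl
  have hZf := (h₅.tiltFree_iff hd Z).2 ⟨c, hZ'.imp (fun b _ B hB => ⟨hB.1, hB.2.le⟩) le_rfl⟩
  have h1 := h₅.degree_nonneg_of_filtered hd (fun _ h => h) hX'
  have h2 := h₅.degree_nonpos_of_filtered hd (fun _ h => h) hX''
  obtain ⟨E', k, a, b, h3, h4, -, -⟩ := (hXZ.shift 1).comp_left hT
  refine ⟨_, E', _, k, ⟨?_, hE, (h₅.tilt_heart_iff hd E').2 ⟨_, _, a, b, h4, hZf, hT'⟩, h3⟩, ?_,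
    fun G hG hn => h4.homZero_right ?_ ?_⟩
  · exact (h₅.isTorsionPair hd).tilt_heart_of_F ((h₅.tiltFree_iff hd X).2 ⟨c, hX''⟩)
  · rw [K0.of_shift_one, map_neg]
    linarith
  · exact (h₅.homZero_of_degree_eq_zero hd hG hn hZ').shift 1
  · exact heart_hom ((h₅.heart_iff G).2 hG.1.1) ((h₅.heart_iff T).2 hT'.1) one_pos

/-- Subobjects of `i₁ U` of rank zero in the tilted heart. -/
theorem exists_iso_of_ses_tilt (hω : 0 < ω) {U : D₁} (hU : σ₁.heart U) {N Q : D}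
    {f : N ⟶ S.i₁.obj U} {g : S.i₁.obj U ⟶ Q} (hs : Ses (h₅.tilt hd).heart f g)
    (hN : S.degreeHom σ₁ σ₂ β ω (K0.of N) = 0) :
    ∃ N₁ : D₁, σ₁.torsion N₁ ∧ Nonempty (S.i₁.obj N₁ ≅ N) := by
  obtain ⟨F, T, a, b, hT, hF, hT'⟩ := (h₅.tilt_heart_iff hd N).1 hs.left
  have hF' := (h₅.isTorsionPair hd).tilt_heart_of_F hF
  have hs' : Ses (h₅.tilt hd).heart a b :=
    ⟨hF', hs.left, (h₅.isTorsionPair hd).tilt_heart_of_T hT', hT⟩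
  have h1 : HomZero (F⟦(1 : ℤ)⟧) (S.i₁.obj U) :=
    heart_hom ((h₅.heart_iff F).2 hF.1.1) (h₅.heart_i₁ hU) one_pos
  -- The subobject `F⟦1⟧` of `N` maps to `i₁ U` by zero, as both `F` and `i₁ U` are in the glued
  -- heart. Hence `F⟦1⟧ = 0` and `N` is in the torsion class.
  have := hT.isIso₂ (hs'.isZero_left (hs.eq_zero_of_comp hF' a (h1 _)))
  rw [K0.of_iso (asIso b)] at hN
  obtain ⟨h2, h3⟩ := h₅.of_degree_eq_zero hd hω hT' hN
  obtain ⟨e⟩ := nonempty_iso_i₁ h2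
  exact ⟨_, h3, ⟨e.symm ≪≫ (asIso b).symm⟩⟩

/-- An object with `Im Z_{β,ω} = 0` in the tilted heart is an extension of `i₁` of an object of
phase `1` by some `G⟦1⟧`. Maps from the latter are excluded by hypothesis. The former are detected
by `τ₁R E`, so one divides by `i₁` of its phase-`1` part `U`, and checks that this map is a
monomorphism and that the quotient has no maps of either kind. -/
theorem exists_ses_torsionFree_of_homZero (hω : 0 < ω) {E : D} (hE : (h₅.tilt hd).heart E)
    (hE' : ∀ G, S.tiltFree σ₁ σ₂ β ω G →
        S.degreeHom σ₁ σ₂ β ω (K0.of G) = 0 → HomZero (G⟦(1 : ℤ)⟧) E) :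
    ∃ (K Q : D) (f : K ⟶ E) (g : E ⟶ Q), Ses (h₅.tilt hd).heart f g ∧
      S.degreeHom σ₁ σ₂ β ω (K0.of K) = 0 ∧
      IsTorsionFree (h₅.tilt hd) (S.degreeHom σ₁ σ₂ β ω) Q := by
  obtain ⟨U, R, u, r, hT, hU, hR⟩ := (σ₁.isCut_Ici 1).exists_tri (h.τ₁R.obj E)
  have hU1 : σ₁.interval (Set.Icc 1 1) U := σ₁.interval_Icc hU ((σ₁.isCut_Ioi 1).V_fiber hT
    (h₅.τ₁R_of_ge hd hE.2) (σ₁.interval_mono Set.Iio_subset_Iic_self hR))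
  have hUt := (σ₁.torsion_iff U).2 hU1
  have hUd : S.degreeHom σ₁ σ₂ β ω (K0.of (S.i₁.obj U)) = 0 := by
    rw [degreeHom_i₁]
    exact hUt.2
  have hUh : (h₅.tilt hd).heart (S.i₁.obj U) :=
    (h₅.isTorsionPair hd).tilt_heart_of_T (h₅.tiltTorsion_i₁ hd hUt.1)
  let j : S.i₁.obj U ⟶ E := (h.adj.homEquiv U E).symm u
  have hj : h.adj.unit.app U ≫ h.τ₁R.map j = u :=
    (h.adj.homEquiv_unit ..).symm.trans (Equiv.apply_symm_apply _ u)
  obtain ⟨N, I, Q, k, p, i, q, h1, h2, h3⟩ := Ses.exists_image hUh hE j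
  have hNd : S.degreeHom σ₁ σ₂ β ω (K0.of N) = 0 := by
    have h4 := h1.map_eq (S.degreeHom σ₁ σ₂ β ω)
    linarith [h₅.tilt_degree_nonneg hd hω h1.left, h₅.tilt_degree_nonneg hd hω h1.right]
  obtain ⟨N₁, hN₁, ⟨e⟩⟩ := h₅.exists_iso_of_ses_tilt hd hω hUt.1 h1 hNd
  obtain ⟨a, ha⟩ := S.i₁.map_surjective (e.hom ≫ k)
  -- The kernel of `j` is `i₁ N₁` with `N₁` of phase `1`, included by `i₁ a`. The composite `a ≫ u`
  -- is zero, so `a` factors through `R⟦-1⟧`, whose phases are below `0`; thus the kernel is zero.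
  have hR' : HomZero N₁ (R⟦(-1 : ℤ)⟧) :=
    (σ₁.isCut_Ici 1).hom _ _ (σ₁.interval_mono (fun _ hφ => hφ.1) ((σ₁.torsion_iff N₁).1 hN₁))
      ((σ₁.isCut_Ici 1).shiftV _ hR)
  have ha0 : a = 0 := by
    have h4 : a ≫ u = 0 := by
      rw [← hj, ← Category.assoc, ← h.adj.unit_naturality, Category.assoc,
        ← CategoryTheory.Functor.map_comp, ha, Category.assoc, ← h3, ← Category.assoc k,
        h1.tri.zero, zero_comp, comp_zero, CategoryTheory.Functor.map_zero, comp_zero]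
    obtain ⟨w, hw⟩ := hT.invRotate
    obtain ⟨l, hl⟩ := hw.lift a h4
    rw [hl, hR' l, zero_comp]
  have hk : k = 0 := by
    rw [ha0, CategoryTheory.Functor.map_zero] at ha
    rw [← cancel_epi e.hom, ← ha, comp_zero]
  have hp := h1.tri.isIso₂ (h1.isZero_left hk)
  have hjq : Ses (h₅.tilt hd).heart j q := by
    refine ⟨hUh, hE, h2.right, ?_⟩
    rw [← h3]
    exact h2.tri.of_iso₁ (asIso p)
  -- This identifies `τ₁R Q` with `R`, all of whose phases are below `1`.
  have hτ : Tri u (h.τ₁R.map q) := by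
    rw [← hj]
    exact (hjq.tri.map h.τ₁R).of_iso₁ (h.τ₁RIso U)
  obtain ⟨eR⟩ := hT.nonempty_iso₃ hτ
  have hi₁ : ∀ X : D₁, σ₁.interval (Set.Ici 1) X → HomZero (S.i₁.obj X) Q := fun X hX =>
    HomZero.of_adjunction h.adj (((σ₁.isCut_Ici 1).hom _ _ hX hR).of_iso (Iso.refl _) eR)
  have hF : ∀ G, S.tiltFree σ₁ σ₂ β ω G → S.degreeHom σ₁ σ₂ β ω (K0.of G) = 0 →
      HomZero (G⟦(1 : ℤ)⟧) Q := by
    intro G hG hn φ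
    obtain ⟨w, hw, -⟩ := hjq.tri.rotate_shift
    -- The obstruction to lifting `φ` to `E` is a map `ψ : G ⟶ i₁ U`. On its kernel `G'`, again of
    -- degree `0`, `φ` lifts to `E` and so vanishes by `hE'`. Hence `φ` factors through `J⟦1⟧`, with
    -- `J` the image of `ψ`, and `J` comes from phase `1` in `D₁`.
    obtain ⟨ψ, hψ⟩ := (shiftFunctor D (1 : ℤ)).map_surjective (φ ≫ w)
    obtain ⟨G', J, V, g, s, m, v, h4, h5, h6⟩ := Ses.exists_image
      ((h₅.heart_iff G).2 hG.1.1) (h₅.heart_i₁ hUt.1) ψ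
    obtain ⟨eJ⟩ := nonempty_iso_i₁ (h₅.isZero_τ₂R_of_ses h5 (S.isZero₂₁ U))
    have hJd : (σ₁.charge (S.τ₁L.obj J)).im = 0 := by
      have h7 := h5.map_eq (S.rankHom σ₁ σ₂)
      rw [rankHom_i₁, hUt.2, K0.of_iso eJ, rankHom_i₁] at h7
      linarith [h₅.rank_nonneg h5.right,
        σ₁.im_charge_nonneg ((h₅.heart_iff J).1 h5.left).1]
    have hG' : S.degreeHom σ₁ σ₂ β ω (K0.of G') = 0 := by
      have h7 := h4.map_eq (S.degreeHom σ₁ σ₂ β ω)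
      rw [hn, K0.of_iso eJ, degreeHom_i₁, hJd] at h7
      linarith
    have h7 : g⟦(1 : ℤ)⟧' ≫ φ = 0 := by
      have h8 : (g⟦(1 : ℤ)⟧' ≫ φ) ≫ w = 0 := by
        rw [Category.assoc, ← hψ, ← CategoryTheory.Functor.map_comp, ← h6, ← Category.assoc,
          h4.tri.zero, zero_comp, CategoryTheory.Functor.map_zero]
      obtain ⟨l, hl⟩ := hw.lift _ h8
      rw [hl, hE' G' ((h₅.isTorsionPair hd).F_sub h4 hG) hG' l, zero_comp]
    obtain ⟨l, hl⟩ := (h4.tri.shift 1).desc φ h7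
    have h8 : HomZero (J⟦(1 : ℤ)⟧) Q := by
      refine (hi₁ ((S.τ₁L.obj J)⟦(1 : ℤ)⟧) ((σ₁.isCut_Ici 1).shiftU _ ?_)).of_iso
        ((S.i₁.commShiftIso (1 : ℤ)).app _ ≪≫ (shiftFunctor D (1 : ℤ)).mapIso eJ.symm) (Iso.refl _)
      exact σ₁.interval_mono (fun _ hφ => hφ.1)
        ((σ₁.torsion_iff _).1 ⟨((h₅.heart_iff J).1 h5.left).1, hJd⟩)
    rw [hl, h8 l, comp_zero]
  refine ⟨_, Q, j, q, hjq, hUd, h2.right, fun K Q' f g hs hK => hs.isZero_left ?_⟩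
  obtain ⟨F, T, a', b', hT', hF', hT''⟩ := (h₅.tilt_heart_iff hd K).1 hs.left
  have h5 := h₅.degree_nonpos hd hF'
  have h6 := h₅.degree_nonneg hd hω hT''
  rw [K0.of_tri hT', map_add, K0.of_shift_one, map_neg] at hK
  obtain ⟨h7, h8⟩ := h₅.of_degree_eq_zero hd hω hT'' (by linarith)
  obtain ⟨eT⟩ := nonempty_iso_i₁ h7
  exact hT'.homZero_left (hF F hF' (by linarith)) ((hi₁ _ (σ₁.interval_mono (fun _ hφ => hφ.1)
    ((σ₁.torsion_iff _).1 h8))).of_iso eT.symm (Iso.refl _)) f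

theorem exists_ses_torsionFree (hω : 0 < ω) {E : D} (hE : (h₅.tilt hd).heart E) :
    ∃ (K Q : D) (f : K ⟶ E) (g : E ⟶ Q), Ses (h₅.tilt hd).heart f g ∧
      S.degreeHom σ₁ σ₂ β ω (K0.of K) = 0 ∧
      IsTorsionFree (h₅.tilt hd) (S.degreeHom σ₁ σ₂ β ω) Q := by
  obtain ⟨K, E', f, g, hs, hK, hE'⟩ := h₅.exists_ses_homZero_shift hd hE
  obtain ⟨L, Q, f', g', hs', hL, hQ⟩ := h₅.exists_ses_torsionFree_of_homZero hd hω hs.right hE'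
  obtain ⟨M, k, a, b, h1, h2⟩ := hs.comp_epi hs'
  exact ⟨M, Q, k, _, h1, by rw [h2.map_eq, hK, hL, add_zero], hQ⟩

end IsConditionFive

end ConditionOne

theorem tiltedCharge_rational (hrat₁ : σ₁.IsRational) (hrat₂ : σ₂.IsRational) (β ω : ℚ)
    (x : K0 D) : ∃ a b : ℚ, S.tiltedCharge σ₁ σ₂ β ω x = (a : ℂ) + (b : ℂ) * Complex.I := by
  obtain ⟨a, b, hab⟩ := hrat₁ (K0.map S.τ₁L x)
  obtain ⟨c, d, hcd⟩ := hrat₂ (K0.map S.τ₂R x)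
  refine ⟨a + β * c + ω * d, b + β * d - ω * c, ?_⟩
  change σ₁.Z (K0.map S.τ₁L x) + ((β : ℝ) - Complex.I * (ω : ℝ)) * σ₂.Z (K0.map S.τ₂R x) = _
  rw [hab, hcd]
  push_cast
  linear_combination -(ω * d : ℂ) * Complex.I_sq

end SemiorthogonalDecomposition

end CentralCharge

end TriStab

/-! ### Proof of the theorem -/

theorem mainTheorem5
    {D : Type u} [Category.{v} D] [Preadditive D] [HasZeroObject D] [HasShift D ℤ]
    [∀ n : ℤ, (shiftFunctor D n).Additive] [Pretriangulated D] [IsTriangulated D]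
    {D₁ : Type u₁} [Category.{v₁} D₁] [Preadditive D₁] [HasZeroObject D₁] [HasShift D₁ ℤ]
    [∀ n : ℤ, (shiftFunctor D₁ n).Additive] [Pretriangulated D₁] [IsTriangulated D₁]
    {D₂ : Type u₂} [Category.{v₂} D₂] [Preadditive D₂] [HasZeroObject D₂] [HasShift D₂ ℤ]
    [∀ n : ℤ, (shiftFunctor D₂ n).Additive] [Pretriangulated D₂] [IsTriangulated D₂]
    {C : Type u₃} [Category.{v₃} C] [Preadditive C] [HasZeroObject C] [HasShift C ℤ]
    [∀ n : ℤ, (shiftFunctor C n).Additive] [Pretriangulated C] [IsTriangulated C]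
    -- the Grothendieck group is finitely generated up to torsion
    (hK : AddGroup.FG (TriStab.K0 D ⧸ AddCommGroup.torsion (TriStab.K0 D)))
    (S : TriStab.SemiorthogonalDecomposition D D₁ D₂) (h₁ : S.ConditionOne)
    (e₁ : D₁ ≌ C) [e₁.functor.CommShift ℤ] [e₁.functor.IsTriangulated]
    (e₂ : D₂ ≌ C) [e₂.functor.CommShift ℤ] [e₂.functor.IsTriangulated]
    (h₂ : h₁.IsConditionTwo e₁ e₂)
    (σ₁ : TriStab.StabilityCondition D₁) (σ₂ : TriStab.StabilityCondition D₂)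
    (hlf₁ : σ₁.IsLocallyFinite) (hlf₂ : σ₂.IsLocallyFinite)
    (hrat₁ : σ₁.IsRational) (hrat₂ : σ₂.IsRational)
    (h₅ : h₁.IsConditionFive σ₁ σ₂) :
    (∀ β ω : ℝ, 0 < ω →
      TriStab.IsBoundedHeart (S.tiltedHeart σ₁ σ₂ β ω) ∧
      TriStab.IsCentralCharge (S.tiltedHeart σ₁ σ₂ β ω) (S.tiltedCharge σ₁ σ₂ β ω)) ∧
    (∀ β ω : ℚ, 0 < ω →
      ∃ σ : TriStab.StabilityCondition D,
        σ.heart = S.tiltedHeart σ₁ σ₂ β ω ∧ σ.Z = S.tiltedCharge σ₁ σ₂ β ω ∧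
        σ.IsLocallyFinite ∧ σ.IsRational) := by
  have hd := fun (β ω : ℝ) (hω : 0 < ω) => h₅.isSlopeData (β := β) hK hrat₁ hrat₂ hω
  refine ⟨fun β ω hω => ?_, fun β ω hω => ?_⟩
  · rw [← h₅.tilt_heart (hd β ω hω)]
    exact ⟨⟨_, h₅.tilt_bounded _, rfl⟩, h₅.isCentralCharge _ hω h₂⟩
  · have hω' : (0 : ℝ) < ω := by exact_mod_cast hω
    have hrat := S.tiltedCharge_rational hrat₁ hrat₂ β ω
    obtain ⟨N, hN, hint⟩ := TriStab.exists_denominator hK (S.tiltedCharge σ₁ σ₂ β ω) hrat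
    have hZ := h₅.isCentralCharge (hd β ω hω') hω' h₂
    -- Now the rank is `Im Z_{β,ω}`, which depends on `β` and `ω`; it is discrete because both are
    -- rational.
    obtain ⟨σ, h1, h2⟩ := TriStab.exists_stabilityCondition (h₅.tilt_bounded (hd β ω hω')) hZ {
      rank_nonneg := fun E hE => h₅.tilt_degree_nonneg _ hω' hE
      degree_nonneg := fun E hE h0 => by
        by_cases hE0 : IsZero E
        · rw [TriStab.K0.of_isZero hE0, map_zero]
        · exact neg_nonneg.2 (h₅.tilt_re_charge_neg _ hω' h₂ hE h0 hE0).le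
      discrete := by
        refine ⟨N, hN, fun x => ?_⟩
        obtain ⟨a, b, hab⟩ := hint x
        refine ⟨b, ?_⟩
        have := congrArg Complex.im hab
        rw [Complex.im_ofReal_mul] at this
        simpa using this
      torsion := fun E hE => h₅.exists_ses_torsionFree _ hω' hE }
    refine ⟨σ, h1.trans (h₅.tilt_heart _), h2, σ.isLocallyFinite_of_discrete hN ?_, fun x => ?_⟩
    · rw [h2]
      exact hint
    · rw [h2]
      exact hrat x
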